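/- Let $p$ be an odd prime, $h=(p-1)/2$, and let $H^*(BE^m;\mathbb F_p)=E(x_1,\dots,x_m)\otimes P(y_1,\dots,y_m)$ with $\dim x_i=1$, $y_i=\beta x_i$, where $E^m$ is the elementary abelian $p$-group of rank $m$. Let $\mathcal A_*=E(\tau_0,\tau_1,\dots)\otimes P(\xi_1,\xi_2,\dots)$ be the dual of the mod $p$ Steenrod algebra (Milnor). For $S=\{s_1<\dots<s_t\}\subseteq\{0,\dots,N-1\}$ and $R=(r_1,\dots,r_N)$, $r_i\ge 0$, let $St^{S,R}$ be the Steenrod operation dual to $\tau_S\xi^R=\tau_{s_1}\cdots\tau_{s_t}\xi_1^{r_1}\cdots\xi_N^{r_N}$ with respect to the monomial basis of $\mathcal A_*$. On $H^*(BE^m)$ it sends $z$ to the coefficient of $\tau_S\xi^R$ (written on the left) in $\lambda(z)$, where $\lambda$ is Milnor's multiplicative coaction, $\lambda(x_i)=x_i+\sum_{s\ge0}\tau_s y_i^{p^s}$, $\lambda(y_i)=y_i+\sum_{j\ge1}\xi_j y_i^{p^j}$. Put $r(S,R)=t+\sum_i s_i+\sum_i i\,r_i$. Define $[e_1,\dots,e_k]=\det\big(y_i^{p^{e_j}}\big)_{1\le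 i,j\le k}$, and let $[1;e_2,\dots,e_k]$ be the determinant with first row $x_1,\dots,x_k$ and further rows $y_1^{p^{e_j}},\dots,y_k^{p^{e_j}}$, $2\le j\le k$. Put $L_{k,s}=[0,\dots,\hat s,\dots,k]$ for $0\le s\le k$, $L_k=L_{k,k}$, $L_0=1$, and $M_{k,s}=[1;0,\dots,\hat s,\dots,k-1]$ for $0\le s<k$. Put $$\tilde L_k=L_k^h,\quad Q_{k,s}=L_{k,s}/L_k,\quad \tilde M_{k,s}=M_{k,s}L_k^{h-1},\quad \tilde M_{k,-1}=\tilde L_k,$$ $$U_{k+1}=M_{k+1,k}L_k^{h-1},\quad V_{k+1}=L_{k+1}/L_k,\quad V_{k+1}^{1/p}=U_{k+1}.$$ For $S=\{s_1<\dots<s_t\}\subseteq\{0,\dots,m-1\}$ and $H=(h_0,\dots,h_{m-1})$, $h_i\ge0$, put $\tilde M_S\tilde Q^H=\tilde M_{m,s_1}\cdots\tilde M_{m,s_t}\tilde L_m^{h_0}Q_{m,1}^{h_1}\cdots Q_{m,m-1}^{h_{m-1}}$. For $R=(r_1,\dots,r_m)$ and $q\in\mathbb Z$ put $R_q^*=(q-2(r_1+\dots+r_m),r_1,\dots,r_{m-1})$.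 Let $[a]$ denote the greatest integer $\le a$. Let $n\ge1$, $k\ge0$, $\delta\in\{0,1\}$, $S'\subseteq\{0,\dots,n-1\}$, $t'=|S'|$, and $R'=(r'_1,\dots,r'_n)$ with $r'_i\ge0$. Then the monomials $\tilde M_{T}\tilde Q^{H}$ ($T\subseteq\{0,\dots,n-1\}$, $H\in\mathbb N^n$) are linearly independent in $H^*(BE^n)$. For all $-\delta\le s\le n-\delta$, $S\subseteq\{0,\dots,k-1\}$ and $R=(r_1,\dots,r_k)$, the element $St^{S,R}(\tilde M_{n,s}^{\delta}Q_{n,s}^{1-\delta})$ lies in their span. Let $$C_{s,S,R}=\big\langle \tilde m_{S'}\tilde q_{R'^*_{(2-\delta)p^k-t'}},\,St^{S,R}\big(\tilde M_{n,s}^{\delta}Q_{n,s}^{1-\delta}\big)\big\rangle\in\mathbb F_p$$ be the coefficient of $\tilde M_{S'}\tilde Q^{R'^*_{(2-\delta)p^k-t'}}$ in its expansion in these monomials ($C_{s,S,R}=0$ if the first entry of $R'^*_{(2-\delta)p^k-t'}$ is negative). Then in $H^*(BE^{k+1})$ $$St^{S',R'}\big(U_{k+1}^{\delta}V_{k+1}^{1-\delta}\big)=\sum_{s=-\delta}^{n-\delta}\Big(\sum_{S,R}(-1)^{\sigma}\,C_{s,S,R}\,\tilde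 M_S\tilde Q^{R^*_{(2-\delta)p^n+[-2p^s]-t}}\Big)V_{k+1}^{p^s},$$ where $\tilde M_S\tilde Q^{H}$ on the right is formed with $m=k$ in the first $k$ variables, the inner sum runs over all $S\subseteq\{0,\dots,k-1\}$, $t=|S|$, and all $R=(r_1,\dots,r_k)$, $r_i\ge0$, for which the first entry $(2-\delta)p^n+[-2p^s]-t-2(r_1+\dots+r_k)$ is non-negative, and $$\sigma=r(S,R)+r(S',R')+s+\delta+(t+[-2p^s])\,t'+nhk\delta .$$ (For $k=0$ the only pair $(S,R)$ is the empty one and $\tilde M_S\tilde Q^{H}=1$.) -/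

import Mathlib

open scoped TensorProduct

namespace MuiSteenrod

noncomputable section

/-! ### The algebras `E(I) ⊗ P(J)` over the prime field -/

/-- The exterior algebra over `𝔽_p` on generators indexed by `I`. -/
abbrev Ext (p : ℕ) (I : Type) : Type :=
  ExteriorAlgebra (ZMod p) (I → ZMod p)

/-- `E(I) ⊗ P(J)`: exterior algebra on generators indexed by `I`, tensored with the polynomial
algebra on generators indexed by `J`, over `𝔽_p`.  The polynomial generators have even degree, so
the graded tensor product of algebras is the ordinary one. -/
abbrev EP (p : ℕ) (I J : Type) : Type :=
  Ext p I ⊗[ZMod p] MvPolynomial J (ZMod p)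

/-- `H^*(BE^m; 𝔽_p) = E(x_1, …, x_m) ⊗ P(y_1, …, y_m)` for `p` odd. -/
abbrev Coh (p m : ℕ) : Type := EP p (Fin m) (Fin m)

/-- The `i`-th exterior generator. -/
def extGen (p : ℕ) {I : Type} [DecidableEq I] (i : I) : Ext p I :=
  ExteriorAlgebra.ι (ZMod p) (Pi.single i 1)

/-- A polynomial in the even generators, as an element of `E(I) ⊗ P(J)`. -/
def pol (p : ℕ) (I J : Type) : MvPolynomial J (ZMod p) →ₐ[ZMod p] EP p I J :=
  Algebra.TensorProduct.includeRight

theorem pol_commute {p : ℕ} {I J : Type} (f : MvPolynomial J (ZMod p)) (z : EP p I J) :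
    Commute z (pol p I J f) := by
  induction z using TensorProduct.induction_on with
  | zero => exact Commute.zero_left _
  | add a b ha hb => exact ha.add_left hb
  | tmul a g =>
    simp only [Commute, SemiconjBy, pol, Algebra.TensorProduct.includeRight_apply,
      Algebra.TensorProduct.tmul_mul_tmul, mul_one, one_mul, mul_comm]

/-- Elements of `E¹ ⊗ P`, i.e. linear in the exterior generators. -/
def linPart {p : ℕ} {I J : Type} :
    ((I → ZMod p) ⊗[ZMod p] MvPolynomial J (ZMod p)) →ₗ[ZMod p] EP p I J :=
  TensorProduct.map (ExteriorAlgebra.ι (ZMod p)) LinearMap.id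

theorem linPart_anticomm {p : ℕ} {I J : Type}
    (z w : (I → ZMod p) ⊗[ZMod p] MvPolynomial J (ZMod p)) :
    linPart z * linPart w + linPart w * linPart z = 0 := by
  induction z with
  | zero => simp
  | add a b ha hb =>
    have : linPart (a + b) * linPart w + linPart w * linPart (a + b)
        = (linPart a * linPart w + linPart w * linPart a)
          + (linPart b * linPart w + linPart w * linPart b) := by
      rw [map_add, add_mul, mul_add]; abel
    rw [this, ha, hb, add_zero]
  | tmul u f =>
    induction w with
    | zero => simp
    | add a b ha hb =>
      have : linPart (u ⊗ₜ[ZMod p] f) * linPart (a + b) + linPart (a + b) * linPart (u ⊗ₜ f)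
          = (linPart (u ⊗ₜ f) * linPart a + linPart a * linPart (u ⊗ₜ f))
            + (linPart (u ⊗ₜ f) * linPart b + linPart b * linPart (u ⊗ₜ f)) := by
        rw [map_add, add_mul, mul_add]; abel
      rw [this, ha, hb, add_zero]
    | tmul v g =>
      simp only [linPart, TensorProduct.map_tmul, LinearMap.id_apply,
        Algebra.TensorProduct.tmul_mul_tmul]
      rw [mul_comm g f, ← TensorProduct.add_tmul, ExteriorAlgebra.ι_add_mul_swap,
        TensorProduct.zero_tmul]

theorem linPart_sq {p : ℕ} {I J : Type}
    (z : (I → ZMod p) ⊗[ZMod p] MvPolynomial J (ZMod p)) :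
    linPart z * linPart z = 0 := by
  induction z with
  | zero => simp
  | add a b ha hb =>
    have : linPart (a + b) * linPart (a + b)
        = linPart a * linPart a + linPart b * linPart b
          + (linPart a * linPart b + linPart b * linPart a) := by
      rw [map_add, add_mul, mul_add, mul_add]; abel
    rw [this, ha, hb, linPart_anticomm, add_zero, add_zero]
  | tmul u f =>
    simp [linPart]

/-! ### Milnor's coaction and the operations `St^{S,R}`

The dual Steenrod algebra is `A_* = E(τ_0, τ_1, …) ⊗ P(ξ_1, ξ_2, …)`, and `H^*(BE^m)` is a
comodule algebra over it through the multiplicative coaction with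
`x_i ↦ x_i + ∑_{s ≥ 0} τ_s y_i^{p^s}` and `y_i ↦ y_i + ∑_{j ≥ 1} ξ_j y_i^{p^j}`.
`St^{S,R}`, the element of the Steenrod algebra dual to the monomial `τ_S ξ^R`, sends `z` to the
coefficient of `τ_S ξ^R`, written to the left, in the coaction on `z`.
For `S ⊆ {0, …, N-1}` and `R = (r_1, …, r_N)` this coefficient does not change when `τ_s` for
`s ≥ N` and `ξ_j` for `j > N` are set to zero, which makes the sums finite.

`E(τ, x) ⊗ P(ξ, y)` is `EP p (Fin N ⊕ Fin m) (Fin N ⊕ Fin m)`: `inl s` is `τ_s`, respectively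
`ξ_{s+1}`, and `inr i` is `x_i`, respectively `y_i`. -/

/-- The coaction on a linear combination of the `x_i`, as an element of `E¹ ⊗ P`. -/
def coactX (p N m : ℕ) : (Fin m → ZMod p) →ₗ[ZMod p]
    ((Fin N ⊕ Fin m → ZMod p) ⊗[ZMod p] MvPolynomial (Fin N ⊕ Fin m) (ZMod p)) :=
  Fintype.linearCombination (ZMod p) fun i : Fin m =>
    (Pi.single (Sum.inr i) 1) ⊗ₜ[ZMod p] (1 : MvPolynomial (Fin N ⊕ Fin m) (ZMod p)) +
      ∑ s : Fin N, (Pi.single (Sum.inl s) 1) ⊗ₜ[ZMod p]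
        ((MvPolynomial.X (Sum.inr i) : MvPolynomial (Fin N ⊕ Fin m) (ZMod p)) ^ p ^ (s : ℕ))

/-- The coaction on `y_i`. -/
def coactY (p N m : ℕ) (i : Fin m) : MvPolynomial (Fin N ⊕ Fin m) (ZMod p) :=
  MvPolynomial.X (Sum.inr i) +
    ∑ j : Fin N, MvPolynomial.X (Sum.inl j) * MvPolynomial.X (Sum.inr i) ^ p ^ ((j : ℕ) + 1)

/-- Milnor's coaction on `H^*(BE^m)`, modulo `τ_s` for `s ≥ N` and `ξ_j` for `j > N`. -/
def coaction (p N m : ℕ) :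
    Coh p m →ₐ[ZMod p] EP p (Fin N ⊕ Fin m) (Fin N ⊕ Fin m) :=
  Algebra.TensorProduct.lift
    (ExteriorAlgebra.lift (ZMod p)
      ⟨linPart ∘ₗ coactX p N m, fun v => linPart_sq (coactX p N m v)⟩)
    ((pol p _ _).comp (MvPolynomial.aeval (coactY p N m)))
    (fun _ _ => pol_commute _ _)

/-- The coefficient of `τ_S = τ_{s_1} ⋯ τ_{s_t}`, `s_1 < ⋯ < s_t`, written to the left, of an
element of `E(τ, x)`: apply the left derivations `∂/∂τ_{s_1}`, …, `∂/∂τ_{s_t}` in this order, then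
set all `τ_s` to zero. -/
def extCoeff (p : ℕ) {N m : ℕ} (S : Finset (Fin N)) :
    Ext p (Fin N ⊕ Fin m) →ₗ[ZMod p] Ext p (Fin m) :=
  (ExteriorAlgebra.map (LinearMap.funLeft (ZMod p) (ZMod p)
      (Sum.inr : Fin m → Fin N ⊕ Fin m))).toLinearMap ∘ₗ
    (S.sort (· ≤ ·)).foldl
      (fun f s => CliffordAlgebra.contractLeft (LinearMap.proj (Sum.inl s)) ∘ₗ f)
      LinearMap.id

/-- The coefficient of `ξ^R = ξ_1^{r_1} ⋯ ξ_N^{r_N}` of an element of `P(ξ, y)`. -/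
def polCoeff (p : ℕ) {N m : ℕ} (R : Fin N → ℕ) :
    MvPolynomial (Fin N ⊕ Fin m) (ZMod p) →ₗ[ZMod p] MvPolynomial (Fin m) (ZMod p) :=
  (MvPolynomial.lcoeff (R := MvPolynomial (Fin m) (ZMod p))
      (Finsupp.equivFunOnFinite.symm R)).restrictScalars (ZMod p) ∘ₗ
    (MvPolynomial.sumAlgEquiv (ZMod p) (Fin N) (Fin m)).toLinearMap

/-- The operation `St^{S,R}` on `H^*(BE^m)`, for `S ⊆ {0, …, N-1}` and `R = (r_1, …, r_N)`;
`r_j` is `R (j-1)`. -/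
def St (p : ℕ) {N m : ℕ} (S : Finset (Fin N)) (R : Fin N → ℕ) :
    Coh p m →ₗ[ZMod p] Coh p m :=
  TensorProduct.map (extCoeff p S) (polCoeff p R) ∘ₗ (coaction p N m).toLinearMap

/-! ### Dickson and Mùi invariants

They are taken in the variables `x_{v 0}, …, x_{v (k-1)}, y_{v 0}, …, y_{v (k-1)}` of
`H^*(BE^m)`. -/

/-- `[e_1, …, e_k] = det (y_i^{p^{e_j}})`. -/
def bracket (p : ℕ) {k m : ℕ} (v : Fin k → Fin m) (e : Fin k → ℕ) :
    MvPolynomial (Fin m) (ZMod p) :=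
  Matrix.det (Matrix.of fun i j : Fin k =>
    (MvPolynomial.X (v i) : MvPolynomial (Fin m) (ZMod p)) ^ p ^ e j)

/-- `[1; e_2, …, e_{k+1}]`, the determinant with first row `x_1, …, x_{k+1}` and further rows
`y_1^{p^{e_j}}, …, y_{k+1}^{p^{e_j}}`, by expansion along the first row. -/
def bracketX (p : ℕ) {k m : ℕ} (v : Fin (k + 1) → Fin m) (e : Fin k → ℕ) : Coh p m :=
  ∑ i : Fin (k + 1), ((-1 : ZMod p) ^ (i : ℕ)) •
    (extGen p (v i) ⊗ₜ[ZMod p] bracket p (fun j => v (i.succAbove j)) e)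

/-- The `j`-th term of the sequence `0, 1, …, ŝ, …`. -/
def skip (s j : ℕ) : ℕ := if j < s then j else j + 1

/-- `L_{k,s} = [0, …, ŝ, …, k]`, for `0 ≤ s ≤ k`. -/
def dicksonL (p : ℕ) {k m : ℕ} (v : Fin k → Fin m) (s : ℕ) : MvPolynomial (Fin m) (ZMod p) :=
  bracket p v fun j => skip s j

/-- `M_{k,s} = [1; 0, …, ŝ, …, k-1]`, for `0 ≤ s < k`. -/
def muiM (p : ℕ) {m : ℕ} : {k : ℕ} → (Fin k → Fin m) → ℕ → Coh p m
  | 0, _, _ => 0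
  | _ + 1, v, s => bracketX p v fun j => skip s j

/-- The quotient `a / b` for `b ∣ a`. -/
def exactQuot {A : Type} [CommRing A] (a b : A) : A :=
  open scoped Classical in if h : b ∣ a then h.choose else 0

/-- `h = (p - 1) / 2`. -/
def hh (p : ℕ) : ℕ := (p - 1) / 2

/-- `L̃_k = L_k^h`, where `L_k = L_{k,k}`. -/
def dicksonLt (p : ℕ) {k m : ℕ} (v : Fin k → Fin m) : MvPolynomial (Fin m) (ZMod p) :=
  dicksonL p v k ^ hh p

/-- `Q_{k,s} = L_{k,s} / L_k`, for `0 ≤ s ≤ k`. -/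
def dicksonQ (p : ℕ) {k m : ℕ} (v : Fin k → Fin m) (s : ℕ) : MvPolynomial (Fin m) (ZMod p) :=
  exactQuot (dicksonL p v s) (dicksonL p v k)

/-- `M̃_{k,s} = M_{k,s} L_k^{h-1}` for `0 ≤ s < k`, and `M̃_{k,-1} = L̃_k`. -/
def muiMt (p : ℕ) {k m : ℕ} (v : Fin k → Fin m) (s : ℤ) : Coh p m :=
  if s = -1 then pol p _ _ (dicksonLt p v)
  else muiM p v s.toNat * pol p _ _ (dicksonL p v k ^ (hh p - 1))

/-- `U_{k+1} = M_{k+1,k} L_k^{h-1}` in `H^*(BE^{k+1})`. -/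
def muiU (p k : ℕ) : Coh p (k + 1) :=
  muiM p (id : Fin (k + 1) → Fin (k + 1)) k *
    pol p _ _ (dicksonL p (Fin.castSucc : Fin k → Fin (k + 1)) k ^ (hh p - 1))

/-- `V_{k+1} = L_{k+1} / L_k` in `H^*(BE^{k+1})`. -/
def muiV (p k : ℕ) : Coh p (k + 1) :=
  pol p _ _ (exactQuot (dicksonL p (id : Fin (k + 1) → Fin (k + 1)) (k + 1))
    (dicksonL p (Fin.castSucc : Fin k → Fin (k + 1)) k))

/-- `V_{k+1}^{p^s}` for `s ≥ 0`, and `V_{k+1}^{1/p} = U_{k+1}`. -/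
def muiVpow (p k : ℕ) (s : ℤ) : Coh p (k + 1) :=
  if s = -1 then muiU p k else muiV p k ^ p ^ s.toNat

/-- The monomial `M̃_S Q̃^H = M̃_{k,s_1} ⋯ M̃_{k,s_t} L̃_k^{h_0} Q_{k,1}^{h_1} ⋯ Q_{k,k-1}^{h_{k-1}}`,
for `S = {s_1 < ⋯ < s_t} ⊆ {0, …, k-1}` and `H = (h_0, …, h_{k-1})`. -/
def monom (p : ℕ) {k m : ℕ} (v : Fin k → Fin m) (S : Finset (Fin k)) (H : Fin k → ℕ) :
    Coh p m :=
  ((S.sort (· ≤ ·)).map fun s => muiMt p v ((s : ℕ) : ℤ)).prod *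
    pol p _ _ (∏ i : Fin k, (if (i : ℕ) = 0 then dicksonLt p v else dicksonQ p v i) ^ H i)

/-- The monomials `M̃_S Q̃^H` in `H^*(BE^n)`. -/
def monomFamily (p n : ℕ) (i : Finset (Fin n) × (Fin n → ℕ)) : Coh p n :=
  monom p (id : Fin n → Fin n) i.1 i.2

/-- The pairing `⟨m̃_S q̃_H, z⟩`: the coefficient of `M̃_S Q̃^H` in the expansion of `z` in the
basis of all such monomials. -/
def dualPairing (p n : ℕ) (S : Finset (Fin n)) (H : Fin n → ℕ) (z : Coh p n) : ZMod p :=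
  open scoped Classical in
  if h : LinearIndependent (ZMod p) (monomFamily p n) ∧
      z ∈ Submodule.span (ZMod p) (Set.range (monomFamily p n))
  then h.1.repr ⟨z, h.2⟩ (S, H) else 0

/-- `R_q^* = (q - 2(r_1 + ⋯ + r_m), r_1, …, r_{m-1})`; to be used when its first entry is
non-negative. -/
def star {m : ℕ} (q : ℤ) (R : Fin m → ℕ) : Fin m → ℕ := fun i =>
  if (i : ℕ) = 0 then (q - 2 * ∑ j, (R j : ℤ)).toNat else R ⟨i - 1, by omega⟩

/-- The finite set of all `R = (r_1, …, r_m)` with `q - 2(r_1 + ⋯ + r_m) ≥ 0`. -/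
def admissible (m : ℕ) (q : ℤ) : Finset (Fin m → ℕ) :=
  (Fintype.piFinset fun _ => Finset.range (q.toNat + 1)).filter
    fun R => 0 ≤ q - 2 * ∑ j, (R j : ℤ)

theorem mem_admissible {m : ℕ} {q : ℤ} {R : Fin m → ℕ} :
    R ∈ admissible m q ↔ 0 ≤ q - 2 * ∑ j, (R j : ℤ) := by
  simp only [admissible, Finset.mem_filter, Fintype.mem_piFinset, Finset.mem_range,
    and_iff_right_iff_imp]
  intro h i
  have : (R i : ℤ) ≤ ∑ j, (R j : ℤ) :=
    Finset.single_le_sum (f := fun j => (R j : ℤ)) (fun j _ => by positivity) (Finset.mem_univ i)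
  have h0 : (0 : ℤ) ≤ R i := by positivity
  omega

/-- `r(S,R) = t + s_1 + ⋯ + s_t + r_1 + 2 r_2 + ⋯ + m r_m`. -/
def rr {m : ℕ} (S : Finset (Fin m)) (R : Fin m → ℕ) : ℤ :=
  S.card + ∑ s ∈ S, ((s : ℕ) : ℤ) + ∑ i : Fin m, ((i : ℤ) + 1) * R i

/-- `[-2p^s]`, where `[a]` is the integral part (floor) of `a`. -/
def brk (p : ℕ) (s : ℤ) : ℤ := ⌊(-2 : ℚ) * (p : ℚ) ^ s⌋

/-- `M̃_{n,s}^δ Q_{n,s}^{1-δ}` in `H^*(BE^n)`. -/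
def invMQ (p n δ : ℕ) (s : ℤ) : Coh p n :=
  muiMt p (id : Fin n → Fin n) s ^ δ *
    pol p _ _ (dicksonQ p (id : Fin n → Fin n) s.toNat) ^ (1 - δ)

/-- `C_{s,S,R} = ⟨m̃_{S'} q̃_{R'^*_{(2-δ)p^k - t'}}, St^{S,R}(M̃_{n,s}^δ Q_{n,s}^{1-δ})⟩`; a dual
element with a divided power of negative index is zero. -/
def coeffC (p n k δ : ℕ) (S' : Finset (Fin n)) (R' : Fin n → ℕ)
    (s : ℤ) (S : Finset (Fin k)) (R : Fin k → ℕ) : ZMod p :=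
  let q : ℤ := (2 - δ) * p ^ k - S'.card
  if 0 ≤ q - 2 * ∑ j, (R' j : ℤ) then
    dualPairing p n S' (star q R') (St p S R (invMQ p n δ s))
  else 0

/-- The sign exponent
`σ = r(S,R) + r(S',R') + s + δ + (t + [-2p^s]) t' + nhkδ`. -/
def sigma (p n k δ : ℕ) (S' : Finset (Fin n)) (R' : Fin n → ℕ)
    (s : ℤ) (S : Finset (Fin k)) (R : Fin k → ℕ) : ℤ :=
  rr S R + rr S' R' + s + δ + (S.card + brk p s) * S'.card + n * hh p * k * δ

end

end MuiSteenrod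

set_option linter.unusedSectionVars false

namespace MuiSteenrod

/-! ### Moore determinants and `p`-polynomials -/

section Moore

variable (p : ℕ) {K : Type} [CommRing K]

/-! For a block `v` of `n` points and a block `w` of `k + 1` points, let `Pop` be the homomorphism
sending the generators at each `w_i` to the classes `U`, `V` formed over `v` with last point `w_i`.
The theorem comes from evaluating `Pop` on `U_{k+1}` or `V_{k+1}` in two ways.

The first way uses symmetry. The image of `V_{k+1}` is a composite of two additive polynomials,
namely the monic `p`-polynomial that vanishes at all points of `v` and at the first `k` points of
`w`. It does not depend on the order of the two blocks (`moore_append`, `fv_comm`), and for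
`U_{k+1}` the order matters only through the sign `(-1)^{nkh}` (`moore_comm`, `dx_comm`). All these
exchanges rest on one uniqueness principle, `IsPPoly.eq_zero`. Building the composite in the other
order writes the image as a sum of `V_{k+1}^{p^s}` with coefficients the images of `Q_{n,s}` or
`M̃_{n,s}` under the operation `Pop` of the opposite direction (`Pop_muiV`, `Pop_muiU`).

The second way is Mùi's formula `Pop_expand`: up to sign, `Pop z` is the sum over `S`, `R` of
`(-1)^{r(S,R)} M̃_S Q̃^{R^*} St^{S,R} z`. Indeed, after division by `L̃` on the exterior generators
and by `L̃^2` on the polynomial ones, `Pop` is Milnor's coaction with `τ_s` and `ξ_j` specialized to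
`± M̃_s / L̃` and `± Q_j / L̃^2` (`popX_eq`, `fv_eq`). Instability (`IsBi.St_eq_zero`) removes the
terms in which a negative power of `L̃` would remain.

Applying Mùi's formula on both sides of the symmetry gives an identity in `H^*(BE^n) ⊗
H^*(BE^{k+1})` (`tmul_expansions`): monomials tensor `St^{S',R'}` of `U` or `V` on one side,
`St^{S,R}` of `M̃` or `Q` tensor `M̃_S Q̃^H V^{p^s}` on the other. Both families of monomials are
linearly independent (`linearIndependent_monomFamily`, `linearIndependent_monomVFamily`), so the
common element has a single coefficient matrix (`exists_coeff_of_tmul_eq`). Its columns show that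
the `St^{S,R}` lie in the span and have coefficients `C_{s,S,R}`; its rows are the asserted formula.

As for signs, moving `M̃_S` past a class of the other block gives `(-1)^{t t'}`. The term `[-2p^s]
t'` has no effect: it is even for `s ≥ 0`, and for `s = -1` the class is polynomial, so the
coefficients with `t'` odd vanish. -/

/-- `det (u_i^{p^{e_j}})`. -/
def br {n : ℕ} (u : Fin n → K) (e : Fin n → ℕ) : K :=
  Matrix.det (Matrix.of fun i j : Fin n => u i ^ p ^ e j)

/-- The determinant with first column `a` and further columns `u^{p^{e_j}}`. -/
def brx {n : ℕ} (a u : Fin (n + 1) → K) (e : Fin n → ℕ) : K :=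
  ∑ i : Fin (n + 1), (-1) ^ (i : ℕ) * (a i * br p (fun j => u (i.succAbove j)) e)

/-- The Moore determinant. -/
def moore {n : ℕ} (u : Fin n → K) : K := br p u fun j => j

/-- `[a; u^{p^0}, …, omitting p^s, …]`. -/
def mu : {n : ℕ} → (Fin n → K) → (Fin n → K) → ℕ → K
  | 0, _, _, _ => 0
  | _ + 1, a, u, s => brx p a u fun j => skip s j

/-- Coefficients of the monic `p`-polynomial with roots the span of the `u_i`. -/
def cf : {n : ℕ} → (Fin n → K) → ℕ → K
  | 0, _, s => if s = 0 then 1 else 0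
  | n + 1, u, s =>
      (if s = 0 then 0 else cf (Fin.init u) (s - 1) ^ p) -
        (∑ i ∈ Finset.range (n + 1), cf (Fin.init u) i * u (Fin.last n) ^ p ^ i) ^ (p - 1) *
          cf (Fin.init u) s

/-- The monic `p`-polynomial with roots the span of the `u_i`. -/
def fv {n : ℕ} (u : Fin n → K) (w : K) : K :=
  ∑ s ∈ Finset.range (n + 1), cf p u s * w ^ p ^ s

/-- The determinant `[1; 0, …, n - 1]` with last point `(b, w)`, expanded along that point. -/
def dx {n : ℕ} (a u : Fin n → K) (b w : K) : K :=
  (-1) ^ n * (b * moore p u + ∑ s ∈ Finset.range n, (-1) ^ (s + 1) * (mu p a u s * w ^ p ^ s))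

/-- Additive polynomials of `p`-degree less than `N`. -/
def IsPPoly (N : ℕ) (g : K → K) : Prop :=
  ∃ c : ℕ → K, ∀ w, g w = ∑ s ∈ Finset.range N, c s * w ^ p ^ s

variable {p}

theorem brx_eq_det {n : ℕ} (a u : Fin (n + 1) → K) (e : Fin n → ℕ) :
    brx p a u e =
      Matrix.det (Matrix.of fun i j : Fin (n + 1) =>
        (Fin.cases (a i) (fun j => u i ^ p ^ e j) j : K)) := by
  rw [Matrix.det_succ_column_zero]
  simp only [brx, br, mul_assoc]
  rfl

theorem cf_eq_zero {n : ℕ} (u : Fin n → K) {s : ℕ} (hs : n < s) (hp : p ≠ 0) : cf p u s = 0 := by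
  induction n generalizing s with
  | zero => simp [cf, show s ≠ 0 by omega]
  | succ n ih =>
    rw [cf, if_neg (by omega), ih _ (by omega), ih _ (by omega), zero_pow hp]
    simp

theorem cf_top {n : ℕ} (u : Fin n → K) (hp : p ≠ 0) : cf p u n = 1 := by
  induction n with
  | zero => simp [cf]
  | succ n ih =>
    rw [cf, if_neg (by omega), cf_eq_zero (Fin.init u) (Nat.lt_succ_self n) hp]
    simp [ih]

theorem fv_zero (u : Fin 0 → K) (w : K) : fv p u w = w := by simp [fv, cf]

theorem map_br {L : Type} [CommRing L] (f : K →+* L) {n : ℕ} (u : Fin n → K) (e : Fin n → ℕ) :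
    f (br p u e) = br p (fun i => f (u i)) e := by
  rw [br, RingHom.map_det]
  congr 1
  ext i j
  simp

theorem map_moore {L : Type} [CommRing L] (f : K →+* L) {n : ℕ} (u : Fin n → K) :
    f (moore p u) = moore p (fun i => f (u i)) := map_br f u _

theorem map_brx {L : Type} [CommRing L] (f : K →+* L) {n : ℕ} (a u : Fin (n + 1) → K)
    (e : Fin n → ℕ) :
    f (brx p a u e) = brx p (fun i => f (a i)) (fun i => f (u i)) e := by
  simp [brx, map_sum, map_br]

theorem map_mu {L : Type} [CommRing L] (f : K →+* L) {n : ℕ} (a u : Fin n → K) (s : ℕ) :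
    f (mu p a u s) = mu p (fun i => f (a i)) (fun i => f (u i)) s := by
  cases n with
  | zero => simp [mu]
  | succ n => exact map_brx f a u _

theorem map_cf {L : Type} [CommRing L] (f : K →+* L) {n : ℕ} (u : Fin n → K) (s : ℕ) :
    f (cf p u s) = cf p (fun i => f (u i)) s := by
  induction n generalizing s with
  | zero => simp only [cf]; split_ifs <;> simp
  | succ n ih =>
    simp only [cf, map_sub, map_mul, map_pow, map_sum, apply_ite f, map_zero, ih]
    rfl

theorem map_fv {L : Type} [CommRing L] (f : K →+* L) {n : ℕ} (u : Fin n → K) (w : K) :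
    f (fv p u w) = fv p (fun i => f (u i)) (f w) := by
  simp [fv, map_cf]

theorem skip_eq_succAbove {n : ℕ} (s : Fin (n + 1)) (j : Fin n) :
    skip s j = (s.succAbove j : ℕ) := by
  simp only [skip, Fin.succAbove, Fin.lt_def, Fin.val_castSucc]
  split_ifs <;> simp

theorem moore_expand {n : ℕ} (u : Fin (n + 1) → K) :
    moore p u = ∑ s ∈ Finset.range (n + 1),
      (-1) ^ (n + s) * (u (Fin.last n) ^ p ^ s * br p (Fin.init u) fun j => skip s j) := by
  rw [moore, br, Matrix.det_succ_row _ (Fin.last n), Finset.sum_range]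
  refine Finset.sum_congr rfl fun s _ => ?_
  rw [mul_assoc]
  congr 2
  rw [br]
  congr 1
  ext i j
  simp [skip_eq_succAbove, Fin.init]

theorem brx_expand {n : ℕ} (a u : Fin (n + 1) → K) :
    brx p a u (fun j => j) =
      dx p (Fin.init a) (Fin.init u) (a (Fin.last n)) (u (Fin.last n)) := by
  rw [brx_eq_det, Matrix.det_succ_row _ (Fin.last n), Fin.sum_univ_succ, dx, mul_add]
  congr 1
  · simp only [Fin.val_last, Fin.val_zero, add_zero, mul_assoc]
    congr 1
    simp only [Matrix.of_apply, Fin.cases_zero]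
    congr 1
    rw [moore, br]
    congr 1
    ext i j
    simp [Fin.init]
  · rw [Finset.mul_sum, Finset.sum_range]
    refine Finset.sum_congr rfl fun s _ => ?_
    rw [Fin.val_last, Fin.val_succ, pow_add, mul_assoc, mul_assoc]
    congr 2
    rw [Matrix.of_apply, Fin.cases_succ, mul_comm]
    congr 1
    cases n with
    | zero => exact s.elim0
    | succ n =>
      rw [mu, brx_eq_det]
      congr 1
      ext i j
      refine Fin.cases ?_ (fun j => ?_) j
      · simp [Fin.init]
      · simp [skip_eq_succAbove, Fin.init]

theorem dx_eq_brx {n : ℕ} (a u : Fin n → K) (b w : K) :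
    dx p a u b w = brx p (Fin.snoc a b : Fin (n + 1) → K) (Fin.snoc u w : Fin (n + 1) → K)
      (fun j => j) := by
  rw [brx_expand]; simp

/-- The last row of the determinant then repeats row `i`. -/
theorem dx_root {n : ℕ} (a u : Fin n → K) (i : Fin n) : dx p a u (a i) (u i) = 0 := by
  rw [dx_eq_brx, brx_eq_det]
  refine Matrix.det_zero_of_row_eq (i := i.castSucc) (j := Fin.last n)
    (Fin.castSucc_lt_last i).ne ?_
  ext j
  refine Fin.cases ?_ (fun j => ?_) j <;> simp

/-- The coefficients of `g` solve a homogeneous linear system whose matrix is the Moore matrix of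
`u`. This uniqueness principle yields `fv_comm` and `dx_comm`. -/
theorem IsPPoly.eq_zero [IsDomain K] {N : ℕ} {g : K → K} (hg : IsPPoly p N g) (u : Fin N → K)
    (hu : moore p u ≠ 0) (h : ∀ i, g (u i) = 0) (w : K) : g w = 0 := by
  obtain ⟨c, hc⟩ := hg
  have : (fun j : Fin N => c j) = 0 := by
    refine Matrix.eq_zero_of_mulVec_eq_zero (M := Matrix.of fun i j : Fin N => u i ^ p ^ (j : ℕ))
      hu ?_
    ext i
    have := h i
    rw [hc, Finset.sum_range] at this
    simpa [Matrix.mulVec, dotProduct, mul_comm] using this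
  rw [hc, Finset.sum_range]
  exact Finset.sum_eq_zero fun j _ => by
    have := congrFun this j
    simp only [Pi.zero_apply] at this
    simp [this]

theorem IsPPoly.mono {N M : ℕ} {g : K → K} (hg : IsPPoly p N g) (h : N ≤ M) : IsPPoly p M g := by
  obtain ⟨c, hc⟩ := hg
  refine ⟨fun s => if s < N then c s else 0, fun w => ?_⟩
  rw [hc]
  simp only [ite_mul, zero_mul]
  rw [← Finset.sum_filter]
  refine Finset.sum_congr ?_ fun _ _ => rfl
  ext i; simp; omega

theorem IsPPoly.add {N : ℕ} {g g' : K → K} (hg : IsPPoly p N g) (hg' : IsPPoly p N g') :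
    IsPPoly p N (fun w => g w + g' w) := by
  obtain ⟨c, hc⟩ := hg
  obtain ⟨c', hc'⟩ := hg'
  exact ⟨fun s => c s + c' s, fun w => by simp [hc, hc', add_mul, Finset.sum_add_distrib]⟩

theorem IsPPoly.smul {N : ℕ} {g : K → K} (hg : IsPPoly p N g) (a : K) :
    IsPPoly p N (fun w => a * g w) := by
  obtain ⟨c, hc⟩ := hg
  exact ⟨fun s => a * c s, fun w => by simp [hc, Finset.mul_sum, mul_assoc]⟩

theorem IsPPoly.zero (N : ℕ) : IsPPoly p N (fun _ : K => 0) := ⟨fun _ => 0, fun _ => by simp⟩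

theorem IsPPoly.sum {ι : Type} {N : ℕ} (t : Finset ι) (g : ι → K → K)
    (hg : ∀ i ∈ t, IsPPoly p N (g i)) : IsPPoly p N (fun w => ∑ i ∈ t, g i w) := by
  classical
  induction t using Finset.induction_on with
  | empty => simpa using IsPPoly.zero N
  | insert i t hi ih =>
    simp only [Finset.sum_insert hi]
    exact (hg _ (Finset.mem_insert_self _ _)).add (ih fun j hj => hg _ (Finset.mem_insert_of_mem hj))

theorem one_lt_p [Fact p.Prime] : 1 < p := (Fact.out : p.Prime).one_lt

theorem p_ne_zero [Fact p.Prime] : p ≠ 0 := (Fact.out : p.Prime).ne_zero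

theorem fv_map_zero [Fact p.Prime] {n : ℕ} (u : Fin n → K) : fv p u 0 = 0 := by
  simp [fv, p_ne_zero]

/-! ### Consequences of the additivity of Frobenius. -/

section CharP

variable [CharP K p] [Fact p.Prime]

/-- Frobenius is additive, so the `p`-th power of a `p`-polynomial has the `p`-th powers of its
coefficients, shifted by one place; this is the recursion defining `cf`. -/
theorem fv_succ {n : ℕ} (u : Fin (n + 1) → K) (w : K) :
    fv p u w = fv p (Fin.init u) w ^ p -
      fv p (Fin.init u) (u (Fin.last n)) ^ (p - 1) * fv p (Fin.init u) w := by
  have h1 : fv p (Fin.init u) w ^ p =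
      ∑ s ∈ Finset.range (n + 1 + 1),
        (if s = 0 then 0 else cf p (Fin.init u) (s - 1) ^ p) * w ^ p ^ s := by
    rw [Finset.sum_range_succ', fv, sum_pow_char]
    simp [mul_pow, ← pow_mul, pow_succ]
  have h2 : fv p (Fin.init u) w =
      ∑ s ∈ Finset.range (n + 1 + 1), cf p (Fin.init u) s * w ^ p ^ s := by
    rw [Finset.sum_range_succ, cf_eq_zero _ (Nat.lt_succ_self n) p_ne_zero, fv]; simp
  rw [h1]
  rw [h2]
  rw [Finset.mul_sum, ← Finset.sum_sub_distrib, fv]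
  refine Finset.sum_congr rfl fun s _ => ?_
  rw [cf, sub_mul, mul_assoc]
  rfl

theorem fv_root {n : ℕ} (u : Fin n → K) (i : Fin n) : fv p u (u i) = 0 := by
  induction n with
  | zero => exact i.elim0
  | succ n ih =>
    rw [fv_succ]
    refine Fin.lastCases ?_ (fun i => ?_) i
    · have : p = p - 1 + 1 := by have := one_lt_p (p := p); omega
      nth_rw 2 [this]
      rw [pow_succ, sub_self]
    · have := ih (Fin.init u) i
      rw [Fin.init] at this
      rw [this, zero_pow p_ne_zero]; simp

/-- A column operation: the last column may be replaced by the combination of all columns with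
coefficients `cf`, because the top coefficient is `1`. The new column holds the values of `fv` at
the points, which vanish in every row but the last. -/
theorem moore_succ {n : ℕ} (u : Fin (n + 1) → K) :
    moore p u = moore p (Fin.init u) * fv p (Fin.init u) (u (Fin.last n)) := by
  set A : Matrix (Fin (n + 1)) (Fin (n + 1)) K := Matrix.of fun i j => u i ^ p ^ (j : ℕ) with hA
  have h := Matrix.det_updateCol_sum A (Fin.last n) (fun j => cf p (Fin.init u) j)
  rw [Fin.val_last, cf_top _ p_ne_zero, one_smul] at h
  change A.det = _
  rw [← h, Matrix.det_succ_column _ (Fin.last n), Finset.sum_eq_single (Fin.last n)]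
  · simp only [Fin.val_last, Matrix.updateCol_self, Fin.succAbove_last]
    rw [← two_mul, pow_mul]
    simp only [even_two, Even.neg_pow, one_pow, one_mul]
    rw [mul_comm]
    congr 1
    · rw [moore, br]
      congr 1
      ext i j
      simp [A, Fin.init]
    · simp [A, fv, Finset.sum_range]
  · intro i _ hi
    obtain ⟨i, rfl⟩ := Fin.exists_castSucc_eq.2 hi
    have : ∑ j : Fin (n + 1), cf p (Fin.init u) j * u i.castSucc ^ p ^ (j : ℕ) = 0 := by
      have := fv_root (Fin.init u) i
      rw [fv, Finset.sum_range] at this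
      exact this
    simp [A, this]
  · simp

/-- `L_{n,s} = (-1)^{n-s} c_s L_n`. -/
theorem br_skip {n : ℕ} (u : Fin n → K) {s : ℕ} (hs : s ≤ n) :
    br p u (fun j => skip s j) = (-1) ^ (n + s) * (cf p u s * moore p u) := by
  -- With an indeterminate as extra point, the Moore determinant has two expansions, by minors and
  -- by `moore_succ`; the claim compares their coefficients at `X ^ p ^ s`.
  let U : Fin (n + 1) → Polynomial K :=
    Fin.snoc (α := fun _ => Polynomial K) (fun i => Polynomial.C (u i)) Polynomial.X
  have h1 := moore_expand (p := p) U
  rw [moore_succ] at h1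
  have hi : (Fin.init U : Fin n → Polynomial K) = fun i => Polynomial.C (u i) := by
    simp [U]
  have hl : U (Fin.last n) = Polynomial.X := by simp [U]
  rw [hi, hl, ← map_moore, fv] at h1
  simp only [← map_br, ← map_cf] at h1
  have h2 := congrArg (fun q => Polynomial.coeff q (p ^ s)) h1
  have key : ∀ f : ℕ → K, (∑ x ∈ Finset.range (n + 1),
      if p ^ s = p ^ x then f x else 0) = f s := by
    intro f
    have : ∀ x, (p ^ s = p ^ x) ↔ (s = x) := fun x =>
      (Nat.pow_right_injective (one_lt_p (p := p))).eq_iff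
    simp only [this]
    rw [Finset.sum_ite_eq, if_pos (by simp; omega)]
  have e1 : ∀ x, ((-1 : Polynomial K) ^ (n + x) *
      (Polynomial.X ^ p ^ x * Polynomial.C (br p u fun j => skip x j))) =
      Polynomial.C ((-1) ^ (n + x) * br p u fun j => skip x j) * Polynomial.X ^ p ^ x := by
    intro x
    simp only [map_mul, map_pow, map_neg, map_one]
    ring
  simp only [e1, Polynomial.finsetSum_coeff, Polynomial.coeff_C_mul, Polynomial.coeff_X_pow,
    mul_ite, mul_one, mul_zero, key] at h2
  have h3 : ((-1 : K) ^ (n + s)) * (-1) ^ (n + s) = 1 := by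
    rw [← mul_pow]; simp
  rw [mul_comm (cf p u s), h2, ← mul_assoc, h3, one_mul]

/-- Omitting exponent `0` raises every exponent by one, which is Frobenius applied to each entry. -/
theorem br_skip_zero {n : ℕ} (u : Fin n → K) :
    br p u (fun j => skip 0 j) = moore p u ^ p := by
  have := map_moore (p := p) (frobenius K p) u
  rw [frobenius_def] at this
  rw [this, moore, br, br]
  congr 1
  ext i j
  simp [skip, frobenius_def, ← pow_mul, pow_succ']

theorem cf_zero_mul {n : ℕ} (u : Fin n → K) :
    (-1) ^ n * (cf p u 0 * moore p u) = moore p u ^ p := by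
  rw [← br_skip_zero, br_skip u (Nat.zero_le n), add_zero]

theorem IsPPoly.comp_fv {N n : ℕ} {g : K → K} (hg : IsPPoly p N g) (u : Fin n → K) :
    IsPPoly p (n + N) (fun w => g (fv p u w)) := by
  obtain ⟨c, hc⟩ := hg
  simp only [hc]
  refine IsPPoly.sum _ _ fun s hs => IsPPoly.smul ?_ _
  have : (fun w => fv p u w ^ p ^ s) = fun w => ∑ i ∈ Finset.range (n + 1),
      (cf p u i ^ p ^ s) * w ^ p ^ (i + s) := by
    ext w
    rw [fv, sum_pow_char_pow]
    simp [mul_pow, ← pow_mul, pow_add]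
  rw [this]
  refine IsPPoly.sum _ _ fun i hi => IsPPoly.smul ?_ _
  refine ⟨fun j => if j = i + s then 1 else 0, fun w => ?_⟩
  simp only [Finset.mem_range] at hs hi
  simp only [ite_mul, one_mul, zero_mul]
  rw [Finset.sum_ite_eq', if_pos (by simp; omega)]

/-- Points may be adjoined in two stages: after applying `fv p u`, the remaining points play the
role of a fresh block. Both parts go together by induction on `k`, through `moore_succ` and
`fv_succ`. -/
theorem moore_append {n k : ℕ} (u : Fin n → K) (y : Fin k → K) :
    moore p (Fin.append u y) = moore p u * moore p (fun i => fv p u (y i)) ∧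
    ∀ w, fv p (Fin.append u y) w = fv p (fun i => fv p u (y i)) (fv p u w) := by
  induction k with
  | zero =>
    have : Fin.append u y = u := by
      ext i; exact Fin.append_left u y i
    rw [this]
    refine ⟨?_, fun w => by rw [fv_zero]⟩
    simp [moore, br]
  | succ k ih =>
    obtain ⟨h1, h2⟩ := ih (Fin.init y)
    have hi : Fin.init (Fin.append (m := n) (n := k + 1) u y : Fin (n + k + 1) → K) = Fin.append u (Fin.init y) := by
      ext i
      refine Fin.addCases (fun i => ?_) (fun i => ?_) i
      · rw [Fin.append_left]
        exact Fin.append_left u y i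
      · rw [Fin.append_right]
        exact Fin.append_right u y i.castSucc
    have hl : (Fin.append (m := n) (n := k + 1) u y : Fin (n + k + 1) → K) (Fin.last (n + k)) = y (Fin.last k) :=
      Fin.append_right u y (Fin.last k)
    have hi' : Fin.init (fun i => fv p u (y i)) = fun i => fv p u (Fin.init y i) := rfl
    constructor
    · have := moore_succ (n := n + k) (p := p) (Fin.append (m := n) (n := k + 1) u y : Fin (n + k + 1) → K)
      rw [hi, hl, h1, h2] at this
      refine this.trans ?_
      rw [moore_succ (fun i => fv p u (y i)), hi', mul_assoc]
    · intro w
      have := fv_succ (n := n + k) (p := p) (Fin.append (m := n) (n := k + 1) u y : Fin (n + k + 1) → K) w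
      rw [hi, hl, h2, h2] at this
      refine this.trans ?_
      rw [fv_succ (fun i => fv p u (y i)), hi']

end CharP

end Moore

end MuiSteenrod

namespace MuiSteenrod

/-! ### Exchanging two blocks of points. -/

section MooreSwap

/-- Separates the variable `b` from a `p`-polynomial in `w`, so that `IsPPoly.eq_zero` can be used
on differences of such determinants. -/
theorem dx_eq_add {p : ℕ} {K : Type} [CommRing K] {n : ℕ} (a u : Fin n → K) :
    ∃ g, IsPPoly p n g ∧ ∀ b w, dx p a u b w = (-1) ^ n * moore p u * b + g w := by
  refine ⟨fun w => (-1) ^ n * ∑ s ∈ Finset.range n, ((-1) ^ (s + 1) * mu p a u s) * w ^ p ^ s,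
    IsPPoly.smul ⟨_, fun w => rfl⟩ _, fun b w => ?_⟩
  simp only [dx, mul_assoc]
  ring

theorem dx_zero_zero {p : ℕ} [Fact p.Prime] {K : Type} [CommRing K] {n : ℕ}
    (a u : Fin n → K) : dx p a u 0 0 = 0 := by
  simp [dx, p_ne_zero]

variable {p : ℕ} {K : Type} [CommRing K] [CharP K p] [Fact p.Prime]

/-- Both sides are Moore determinants of the points `u` together with `b`, placed last or first; the
two orders differ by a cyclic rotation of sign `(-1)^n`. -/
theorem moore_cons {n : ℕ} (u : Fin n → K) (b : K) :
    moore p u * fv p u b = (-1) ^ n * (b * moore p (fun i => fv p (fun _ : Fin 1 => b) (u i))) := by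
  have h1 : moore p u * fv p u b = moore p (Fin.snoc u b : Fin (n + 1) → K) := by
    rw [moore_succ]; simp
  have h2 : b * moore p (fun i => fv p (fun _ : Fin 1 => b) (u i)) =
      moore p (Fin.cons b u : Fin (n + 1) → K) := by
    have h := (moore_append (p := p) (fun _ : Fin 1 => b) u).1
    have hb : moore p (fun _ : Fin 1 => b) = b := by simp [moore, br]
    rw [hb] at h
    rw [← h, Fin.append_left_eq_cons]
    simp only [moore, br]
    rw [← Matrix.det_submatrix_equiv_self (finCongr (Nat.add_comm n 1))]
    congr 1
  rw [h1, h2, moore, br, moore, br]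
  have h3 := Matrix.det_permute (finRotate (n + 1))
    (Matrix.of fun i j : Fin (n + 1) => (Fin.snoc (α := fun _ => K) u b : Fin (n + 1) → K) i ^ p ^ (j : ℕ))
  have h4 : ((Matrix.of fun i j : Fin (n + 1) =>
      (Fin.cons (α := fun _ => K) b u : Fin (n + 1) → K) i ^ p ^ (j : ℕ)).submatrix
      (finRotate (n + 1)) id) = Matrix.of fun i j : Fin (n + 1) =>
        (Fin.snoc (α := fun _ => K) u b : Fin (n + 1) → K) i ^ p ^ (j : ℕ) := by
    ext i j
    refine Fin.lastCases ?_ (fun i => ?_) i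
    · simp
    · have : finRotate (n + 1) i.castSucc = i.succ := by
        rw [finRotate_apply]; simp
      simp [this]
  rw [← h4, Matrix.det_permute, sign_finRotate]
  simp

/-- Both composites are monic of `p`-degree `n + k` and vanish at all the `u_i` and `y_j`. Their
leading terms cancel in the difference, which therefore vanishes by `IsPPoly.eq_zero`. -/
theorem fv_comm [IsDomain K] {n k : ℕ} (u : Fin n → K) (y : Fin k → K)
    (h : moore p (Fin.append u y) ≠ 0) (w : K) :
    fv p (fun i => fv p u (y i)) (fv p u w) = fv p (fun i => fv p y (u i)) (fv p y w) := by
  have key : ∀ {n : ℕ} (u : Fin n → K), ∃ g, IsPPoly p n g ∧ ∀ w, fv p u w = g w + w ^ p ^ n := by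
    intro n u
    refine ⟨fun w => ∑ s ∈ Finset.range n, cf p u s * w ^ p ^ s, ⟨_, fun w => rfl⟩, fun w => ?_⟩
    rw [fv, Finset.sum_range_succ, cf_top _ p_ne_zero, one_mul]
  obtain ⟨g1, hg1, h1⟩ := key (Fin.append u y)
  obtain ⟨g2, hg2, h2⟩ := key (Fin.append y u)
  simp only [(moore_append u y).2] at h1
  simp only [(moore_append y u).2] at h2
  rw [Nat.add_comm k n] at hg2 h2
  have := (hg1.add (hg2.smul (-1))).eq_zero _ h ?_ w
  · rw [h1, h2]
    linear_combination this
  · intro i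
    have e : ∀ z, g1 z + -1 * g2 z = fv p (fun i => fv p u (y i)) (fv p u z) -
      fv p (fun i => fv p y (u i)) (fv p y z) := by intro z; rw [h1, h2]; ring
    rw [e]
    refine Fin.addCases (fun i => ?_) (fun i => ?_) i
    · rw [Fin.append_left, fv_root u, fv_map_zero, fv_root (fun i => fv p y (u i)), sub_zero]
    · rw [Fin.append_right, fv_root y, fv_map_zero, fv_root (fun i => fv p u (y i)), sub_zero]

/-- By `moore_append` the two products are Moore determinants of the concatenations in the two
orders, whence the sign of a block exchange. The points of `y` are moved one at a time with
`moore_cons`, and `fv_comm` identifies the factor each one adds. -/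
theorem moore_comm [IsDomain K] {n k : ℕ} (u : Fin n → K) (y : Fin k → K)
    (h : moore p (Fin.append u y) ≠ 0) :
    moore p y * moore p (fun i => fv p y (u i)) =
      (-1) ^ (n * k) * (moore p u * moore p (fun i => fv p u (y i))) := by
  induction k with
  | zero =>
    simp [fv_zero, moore, br]
  | succ k ih =>
    have h' : moore p (Fin.append u (Fin.init y)) ≠ 0 := by
      rw [(moore_append u y).1, moore_succ (fun i => fv p u (y i))] at h
      rw [(moore_append u (Fin.init y)).1]
      exact fun h0 => h (by rw [← mul_assoc]; exact mul_eq_zero_of_left h0 _)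
    have h1 := ih (Fin.init y) h'
    have e1 : (fun i => fv p y (u i)) = fun i =>
        fv p (fun _ : Fin 1 => fv p (Fin.init y) (y (Fin.last k))) (fv p (Fin.init y) (u i)) := by
      ext i
      rw [fv_succ]
      rw [fv_succ]
      simp only [fv_zero]
    have h2 := moore_cons (p := p) (fun i => fv p (Fin.init y) (u i))
      (fv p (Fin.init y) (y (Fin.last k)))
    rw [e1, moore_succ y, moore_succ (fun i => fv p u (y i))]
    have h3 := fv_comm u (Fin.init y) h' (y (Fin.last k))
    have e2 : Fin.init (fun i => fv p u (y i)) = fun i => fv p u (Fin.init y i) := rfl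
    rw [e2, h3]
    have h4 : ((-1 : K) ^ n) * (-1) ^ n = 1 := by rw [← mul_pow]; simp
    rw [Nat.mul_succ, pow_add]
    linear_combination (-1) ^ n * fv p (fun i => fv p (Fin.init y) (u i)) (fv p (Fin.init y) (y (Fin.last k))) * h1
      - (-1) ^ n * moore p (Fin.init y) * h2
      - moore p (Fin.init y) * fv p (Fin.init y) (y (Fin.last k)) * moore p (fun i => fv p (fun _ : Fin 1 => fv p (Fin.init y) (y (Fin.last k))) (fv p (Fin.init y) (u i))) * h4

/-- The coefficients of `b` on the two sides agree by `moore_comm`. What is left of the difference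
is a `p`-polynomial in `w` of `p`-degree below `n + k`, which is killed by its zeros. -/
theorem dx_comm [IsDomain K] {n k : ℕ} (a u : Fin n → K) (a' y : Fin k → K)
    (h : moore p (Fin.append u y) ≠ 0) (b w : K) :
    dx p (fun i => dx p a' y (a i) (u i)) (fun i => fv p y (u i)) (dx p a' y b w) (fv p y w) =
      (-1) ^ (n * k) *
        dx p (fun i => dx p a u (a' i) (y i)) (fun i => fv p u (y i)) (dx p a u b w)
          (fv p u w) := by
  have key : ∀ {n k : ℕ} (a u : Fin n → K) (a' y : Fin k → K), ∃ g, IsPPoly p (n + k) g ∧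
      ∀ b w, dx p (fun i => dx p a u (a' i) (y i)) (fun i => fv p u (y i)) (dx p a u b w)
          (fv p u w) =
        (-1) ^ (n + k) * (moore p u * moore p (fun i => fv p u (y i))) * b + g w := by
    intro n k a u a' y
    obtain ⟨g1, hg1, h1⟩ := dx_eq_add (p := p) a u
    obtain ⟨g2, hg2, h2⟩ := dx_eq_add (p := p) (fun i => dx p a u (a' i) (y i))
      (fun i => fv p u (y i))
    refine ⟨_, ((hg1.mono (Nat.le_add_right n k)).smul
      ((-1) ^ k * moore p (fun i => fv p u (y i)))).add (hg2.comp_fv u), fun b w => ?_⟩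
    rw [h2, h1]
    ring
  obtain ⟨g1, hg1, h1⟩ := key a u a' y
  obtain ⟨g2, hg2, h2⟩ := key a' y a u
  rw [Nat.add_comm k n] at hg2 h2
  have hm := moore_comm u y h
  have := (hg2.add (hg1.smul (-(-1) ^ (n * k)))).eq_zero _ h ?_ w
  · rw [h1, h2, hm]
    linear_combination this
  · intro i
    -- The left side is free of `b`, so at each point `b` can be chosen to be the matching exterior
    -- coordinate; `dx_root` then annihilates both determinants.
    have e : ∀ b z, g2 z + -(-1) ^ (n * k) * g1 z =
      dx p (fun i => dx p a' y (a i) (u i)) (fun i => fv p y (u i)) (dx p a' y b z) (fv p y z) -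
      (-1) ^ (n * k) *
        dx p (fun i => dx p a u (a' i) (y i)) (fun i => fv p u (y i)) (dx p a u b z)
          (fv p u z) := by
      intro b z
      rw [h1, h2, hm]; ring
    refine Fin.addCases (fun i => ?_) (fun i => ?_) i
    · rw [Fin.append_left, e (a i), dx_root a u, fv_root u, dx_zero_zero,
        dx_root (fun i => dx p a' y (a i) (u i)) (fun i => fv p y (u i)) i]
      simp
    · rw [Fin.append_right, e (a' i), dx_root a' y, fv_root y, dx_zero_zero,
        dx_root (fun i => dx p a u (a' i) (y i)) (fun i => fv p u (y i)) i]
      simp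

end MooreSwap

open MvPolynomial in
-- The monomial of the diagonal term occurs for no other permutation, since the exponents `p ^ i`
-- are distinct.
theorem moore_X_ne_zero {p : ℕ} [Fact p.Prime] {J : Type} {n : ℕ} (v : Fin n → J)
    (hv : Function.Injective v) :
    moore p (fun i => (X (v i) : MvPolynomial J (ZMod p))) ≠ 0 := by
  classical
  intro h0
  have h1 := congrArg (coeff (∑ i : Fin n, Finsupp.single (v i) (p ^ (i : ℕ)))) h0
  rw [moore, br, Matrix.det_apply, coeff_sum, Finset.sum_eq_single 1] at h1
  · have : (∏ i : Fin n, Matrix.of (fun i j : Fin n =>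
        (X (v i) : MvPolynomial J (ZMod p)) ^ p ^ (j : ℕ)) ((1 : Equiv.Perm (Fin n)) i) i) =
        monomial (∑ i : Fin n, Finsupp.single (v i) (p ^ (i : ℕ))) 1 := by
      rw [monomial_sum_one]
      simp [X_pow_eq_monomial]
    rw [this] at h1
    simp at h1
  · intro σ _ hσ
    have : (∏ i : Fin n, Matrix.of (fun i j : Fin n =>
        (X (v i) : MvPolynomial J (ZMod p)) ^ p ^ (j : ℕ)) (σ i) i) =
        monomial (∑ i : Fin n, Finsupp.single (v (σ i)) (p ^ (i : ℕ))) 1 := by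
      rw [monomial_sum_one]
      simp [X_pow_eq_monomial]
    rw [this, coeff_smul, coeff_monomial, if_neg, smul_zero]
    intro h
    apply hσ
    ext j
    have h2 := DFunLike.congr_fun h (v (σ j))
    simp only [Finsupp.finsetSum_apply, Finsupp.single_apply, hv.eq_iff, σ.injective.eq_iff,
      Finset.sum_ite_eq', Finset.mem_univ, if_true] at h2
    exact (congrArg Fin.val (Fin.val_injective
      (Nat.pow_right_injective (one_lt_p (p := p)) h2))).symm
  · simp

end MuiSteenrod

namespace MuiSteenrod

noncomputable section

/-! ### Algebra homomorphisms out of `E(I) ⊗ P(J)` -/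

section Homs

/-- The exterior algebra over `𝔽_p` with scalars extended to `K`. -/
abbrev EK (p : ℕ) (J K : Type) [CommRing K] [Algebra (ZMod p) K] : Type :=
  Ext p J ⊗[ZMod p] K

variable {p : ℕ} {I I' J K : Type} [CommRing K] [Algebra (ZMod p) K]

/-- Scalars. -/
def cst (J : Type) : K →ₐ[ZMod p] EK p J K := Algebra.TensorProduct.includeRight

theorem cst_apply (c : K) : (cst J c : EK p J K) = 1 ⊗ₜ c := rfl

theorem pol_eq_cst (f : MvPolynomial I' (ZMod p)) : pol p I I' f = cst I f := rfl

theorem cst_commute (z : EK p J K) (c : K) : Commute z (cst J c) := by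
  induction z using TensorProduct.induction_on with
  | zero => exact Commute.zero_left _
  | add a b ha hb => exact ha.add_left hb
  | tmul a g =>
    simp only [Commute, SemiconjBy, cst_apply, Algebra.TensorProduct.tmul_mul_tmul, mul_one,
      one_mul, mul_comm]

theorem algHom_ext_EP [Finite I] [DecidableEq I] {B : Type} [Ring B] [Algebra (ZMod p) B]
    {F G : EP p I I' →ₐ[ZMod p] B}
    (h1 : ∀ i, F (extGen p i ⊗ₜ 1) = G (extGen p i ⊗ₜ 1))
    (h2 : ∀ i, F (cst I (MvPolynomial.X i)) = G (cst I (MvPolynomial.X i))) : F = G := by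
  refine Algebra.TensorProduct.ext ?_ ?_
  · refine ExteriorAlgebra.hom_ext ?_
    refine LinearMap.pi_ext' fun i => ?_
    ext
    exact h1 i
  · exact MvPolynomial.algHom_ext fun i => h2 i

/-- Extension of scalars. -/
def mapK {K' : Type} [CommRing K'] [Algebra (ZMod p) K'] (φ : K →ₐ[ZMod p] K') :
    EK p I K →ₐ[ZMod p] EK p I K' :=
  Algebra.TensorProduct.map (AlgHom.id _ _) φ

theorem mapK_cst {K' : Type} [CommRing K'] [Algebra (ZMod p) K'] (φ : K →ₐ[ZMod p] K') (c : K) :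
    mapK φ (cst I c) = cst I (φ c) := by
  simp [mapK, cst_apply]

theorem mapK_injective [Fact p.Prime] {K' : Type} [CommRing K'] [Algebra (ZMod p) K']
    (φ : K →ₐ[ZMod p] K') (h : Function.Injective φ) :
    Function.Injective (mapK (I := I) φ) :=
  Module.Flat.lTensor_preserves_injective_linearMap (M := Ext p I) φ.toLinearMap h

theorem extGen_anticomm [DecidableEq J] (i j : J) :
    extGen p i * extGen p j + extGen p j * extGen p i = 0 :=
  ExteriorAlgebra.ι_add_mul_swap _ _

variable [Fintype J] [DecidableEq J]

/-- `∑ x_j a_j`. -/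
def lin : (J → K) →ₗ[ZMod p] EK p J K :=
  ∑ j, (TensorProduct.mk (ZMod p) (Ext p J) K (extGen p j)) ∘ₗ LinearMap.proj j

theorem lin_apply (a : J → K) : (lin a : EK p J K) = ∑ j, extGen p j ⊗ₜ a j := by
  simp [lin]

theorem lin_single (j : J) (c : K) : (lin (Pi.single j c) : EK p J K) = extGen p j ⊗ₜ c := by
  rw [lin_apply, Finset.sum_eq_single j]
  · simp
  · intro i _ hi
    simp [hi]
  · simp

theorem cst_mul_lin (c : K) (a : J → K) : (cst J c * lin a : EK p J K) = lin (c • a) := by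
  simp [lin_apply, cst_apply, Finset.mul_sum]

theorem lin_mul_cst (c : K) (a : J → K) : (lin a * cst J c : EK p J K) = lin (c • a) := by
  rw [(cst_commute _ _).eq, cst_mul_lin]

theorem lin_anticomm (a b : J → K) : (lin a * lin b + lin b * lin a : EK p J K) = 0 := by
  simp only [lin_apply, Finset.sum_mul_sum, Algebra.TensorProduct.tmul_mul_tmul]
  rw [Finset.sum_comm, ← Finset.sum_add_distrib]
  refine Finset.sum_eq_zero fun i _ => ?_
  rw [← Finset.sum_add_distrib]
  refine Finset.sum_eq_zero fun j _ => ?_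
  rw [mul_comm (b i), ← TensorProduct.add_tmul, extGen_anticomm, TensorProduct.zero_tmul]

theorem lin_swap (a b : J → K) : (lin a * lin b : EK p J K) = -(lin b * lin a) :=
  eq_neg_of_add_eq_zero_left (lin_anticomm a b)

theorem lin_sq (a : J → K) : (lin a * lin a : EK p J K) = 0 := by
  have key : ∀ t : Finset J,
      (∑ j ∈ t, (extGen p j ⊗ₜ a j : EK p J K)) * ∑ j ∈ t, extGen p j ⊗ₜ a j = 0 := by
    intro t
    induction t using Finset.induction_on with
    | empty => simp
    | insert i t hi ih =>
      rw [Finset.sum_insert hi, add_mul, mul_add, mul_add, ih, add_zero]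
      have h1 : (extGen p i ⊗ₜ[ZMod p] a i : EK p J K) * extGen p i ⊗ₜ a i = 0 := by
        rw [Algebra.TensorProduct.tmul_mul_tmul, extGen, ExteriorAlgebra.ι_sq_zero,
          TensorProduct.zero_tmul]
      rw [h1, zero_add, Finset.mul_sum, Finset.sum_mul, ← Finset.sum_add_distrib]
      refine Finset.sum_eq_zero fun j _ => ?_
      rw [Algebra.TensorProduct.tmul_mul_tmul, Algebra.TensorProduct.tmul_mul_tmul,
        mul_comm (a j), ← TensorProduct.add_tmul, extGen_anticomm, TensorProduct.zero_tmul]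
  rw [lin_apply]
  exact key _

variable [Fintype I] [DecidableEq I]

/-- The homomorphism `x_i ↦ f i` on the exterior algebra. -/
def liftExt (f : I → J → K) : Ext p I →ₐ[ZMod p] EK p J K :=
  ExteriorAlgebra.lift (ZMod p)
    ⟨Fintype.linearCombination (ZMod p) fun i => lin (f i), fun v => by
      rw [Fintype.linearCombination_apply]
      simp only [← map_smul, ← map_sum]
      exact lin_sq _⟩

theorem liftExt_gen (f : I → J → K) (i : I) : liftExt (p := p) f (extGen p i) = lin (f i) := by
  rw [liftExt, extGen, ExteriorAlgebra.lift_ι_apply, Fintype.linearCombination_apply_single,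
    one_smul]

/-- The homomorphism `x_i ↦ f i`, `y_i ↦ g i`. -/
def liftEP (f : I → J → K) (g : I' → K) : EP p I I' →ₐ[ZMod p] EK p J K :=
  Algebra.TensorProduct.lift (liftExt f) ((cst J).comp (MvPolynomial.aeval g))
    (fun _ _ => cst_commute _ _)

theorem liftEP_apply (f : I → J → K) (g : I' → K) (a : Ext p I) (h : MvPolynomial I' (ZMod p)) :
    liftEP (p := p) f g (a ⊗ₜ h) = liftExt f a * cst J (MvPolynomial.aeval g h) :=
  Algebra.TensorProduct.lift_tmul (liftExt f) ((cst J).comp (MvPolynomial.aeval g))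
    (fun _ _ => cst_commute _ _) a h

theorem liftEP_tmul (f : I → J → K) (g : I' → K) (i : I) (h : MvPolynomial I' (ZMod p)) :
    liftEP (p := p) f g (extGen p i ⊗ₜ h) = lin (MvPolynomial.aeval g h • f i) := by
  rw [liftEP_apply, liftExt_gen, lin_mul_cst]

theorem liftEP_cst (f : I → J → K) (g : I' → K) (h : MvPolynomial I' (ZMod p)) :
    liftEP (p := p) f g (cst I h) = cst J (MvPolynomial.aeval g h) := by
  rw [cst_apply, liftEP_apply, map_one, one_mul]

theorem liftEP_lin (f : I → J → K) (g : I' → K) (a : I → MvPolynomial I' (ZMod p)) :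
    liftEP (p := p) f g (lin a) = lin (∑ i, MvPolynomial.aeval g (a i) • f i) := by
  rw [lin_apply, map_sum, map_sum]
  exact Finset.sum_congr rfl fun i _ => liftEP_tmul _ _ _ _

theorem mapK_lin {K' : Type} [CommRing K'] [Algebra (ZMod p) K'] (φ : K →ₐ[ZMod p] K')
    (a : I → K) : mapK φ (lin a) = lin (fun i => φ (a i)) := by
  simp [mapK, lin_apply]

end Homs

/-! ### Milnor's coaction on generators -/

section Coaction

variable {p N m : ℕ}

theorem linPart_single_tmul {I J : Type} [DecidableEq I] (i : I) (f : MvPolynomial J (ZMod p)) :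
    linPart (Pi.single i 1 ⊗ₜ f) = (extGen p i ⊗ₜ f : EP p I J) := by
  simp [linPart, extGen]

/-- The coaction on the exterior algebra. -/
def coactE (p N m : ℕ) : Ext p (Fin m) →ₐ[ZMod p] EP p (Fin N ⊕ Fin m) (Fin N ⊕ Fin m) :=
  ExteriorAlgebra.lift (ZMod p)
    ⟨linPart ∘ₗ coactX p N m, fun v => linPart_sq (coactX p N m v)⟩

theorem coaction_tmul (a : Ext p (Fin m)) (f : MvPolynomial (Fin m) (ZMod p)) :
    coaction p N m (a ⊗ₜ f) = coactE p N m a * cst _ (MvPolynomial.aeval (coactY p N m) f) :=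
  Algebra.TensorProduct.lift_tmul (coactE p N m)
    ((cst _).comp (MvPolynomial.aeval (coactY p N m))) (fun _ _ => cst_commute _ _) a f

theorem coaction_cst (f : MvPolynomial (Fin m) (ZMod p)) :
    coaction p N m (cst (Fin m) f) =
      cst (Fin N ⊕ Fin m) (MvPolynomial.aeval (coactY p N m) f) := by
  rw [cst_apply, coaction_tmul, map_one, one_mul]

theorem coactE_gen (i : Fin m) :
    coactE p N m (extGen p i) = extGen p (Sum.inr i) ⊗ₜ 1 +
      ∑ s : Fin N, extGen p (Sum.inl s) ⊗ₜ (MvPolynomial.X (Sum.inr i) ^ p ^ (s : ℕ)) := by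
  rw [coactE, extGen, ExteriorAlgebra.lift_ι_apply, LinearMap.comp_apply, coactX,
    Fintype.linearCombination_apply_single, one_smul, map_add, map_sum]
  simp only [linPart_single_tmul]

theorem coaction_gen (i : Fin m) :
    coaction p N m (extGen p i ⊗ₜ 1) = extGen p (Sum.inr i) ⊗ₜ 1 +
      ∑ s : Fin N, extGen p (Sum.inl s) ⊗ₜ (MvPolynomial.X (Sum.inr i) ^ p ^ (s : ℕ)) := by
  rw [coaction_tmul, map_one, map_one, mul_one, coactE_gen]

end Coaction

/-! ### Dickson and Mùi invariants in terms of `p`-polynomials -/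

section Invariants

open MvPolynomial

variable {p : ℕ}

/-- Coordinates of the exterior generators. -/
def ee {J : Type} [DecidableEq J] (K : Type) [CommRing K] (i j : J) : K :=
  (Pi.single i 1 : J → K) j

theorem bracket_eq_br {k m : ℕ} (v : Fin k → Fin m) (e : Fin k → ℕ) :
    bracket p v e = br p (fun i => (X (v i) : MvPolynomial (Fin m) (ZMod p))) e := rfl

theorem dicksonL_self {k m : ℕ} (v : Fin k → Fin m) :
    dicksonL p v k = moore p (fun i => (X (v i) : MvPolynomial (Fin m) (ZMod p))) := by
  rw [dicksonL, bracket_eq_br, moore]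
  congr 1
  ext j
  simp [skip]

/-- Determinants with a row of exterior generators become vectors of ordinary determinants, one for
each generator, so identities among them can be checked coordinatewise in a commutative ring. -/
theorem bracketX_eq_lin {k m : ℕ} (v : Fin (k + 1) → Fin m) (e : Fin k → ℕ) :
    bracketX p v e = lin (fun j => brx p (fun i => ee (MvPolynomial (Fin m) (ZMod p)) (v i) j)
      (fun i => X (v i)) e) := by
  have : (fun j => brx p (fun i => ee (MvPolynomial (Fin m) (ZMod p)) (v i) j)
      (fun i => X (v i)) e) =
      ∑ i : Fin (k + 1), ((-1 : ZMod p) ^ (i : ℕ)) •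
        (Pi.single (v i) (bracket p (fun j => v (i.succAbove j)) e) :
          Fin m → MvPolynomial (Fin m) (ZMod p)) := by
    ext1 j
    simp only [brx, ee, Finset.sum_apply, Pi.smul_apply]
    refine Finset.sum_congr rfl fun i _ => ?_
    rw [bracket_eq_br, Algebra.smul_def]
    simp only [map_pow, map_neg, map_one]
    congr 1
    by_cases h : v i = j
    · subst h; simp
    · rw [Pi.single_eq_of_ne (Ne.symm h), Pi.single_eq_of_ne (Ne.symm h), zero_mul]
  rw [this, map_sum, bracketX]
  simp only [map_smul, lin_single]

theorem muiM_eq_lin {k m : ℕ} (v : Fin k → Fin m) (s : ℕ) :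
    muiM p v s = lin (fun j => mu p (fun i => ee (MvPolynomial (Fin m) (ZMod p)) (v i) j)
      (fun i => X (v i)) s) := by
  cases k with
  | zero =>
    rw [muiM]
    simp only [mu]
    exact (map_zero _).symm
  | succ k => exact bracketX_eq_lin v _

theorem exactQuot_eq {A : Type} [CommRing A] [IsDomain A] {a b c : A} (hb : b ≠ 0)
    (h : a = b * c) : exactQuot a b = c := by
  have hd : b ∣ a := ⟨c, h⟩
  rw [exactQuot, dif_pos hd]
  exact mul_left_cancel₀ hb (hd.choose_spec.symm.trans h)

theorem muiU_eq (k : ℕ) :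
    muiU p k = lin (fun j =>
      moore p (fun i : Fin k => (X i.castSucc : MvPolynomial (Fin (k + 1)) (ZMod p))) ^ (hh p - 1) *
      dx p (fun i : Fin k => ee _ i.castSucc j) (fun i : Fin k => X i.castSucc)
        (ee _ (Fin.last k) j) (X (Fin.last k))) := by
  rw [muiU, muiM_eq_lin, pol_eq_cst, lin_mul_cst, dicksonL_self]
  congr 1
  ext1 j
  rw [Pi.smul_apply, smul_eq_mul]
  congr 1
  have := brx_expand (p := p) (fun i => ee (MvPolynomial (Fin (k + 1)) (ZMod p)) i j)
    (fun i => X i)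
  refine Eq.trans ?_ this
  rw [mu]
  congr 1
  ext i
  simp [skip]

theorem muiMt_natCast {k m : ℕ} (v : Fin k → Fin m) (s : ℕ) :
    muiMt p v s = lin (fun j =>
      moore p (fun i => (X (v i) : MvPolynomial (Fin m) (ZMod p))) ^ (hh p - 1) *
      mu p (fun i => ee (MvPolynomial (Fin m) (ZMod p)) (v i) j) (fun i => X (v i)) s) := by
  rw [muiMt, if_neg (by omega), Int.toNat_natCast, muiM_eq_lin, pol_eq_cst, lin_mul_cst,
    dicksonL_self]
  rfl

theorem muiMt_neg_one {k m : ℕ} (v : Fin k → Fin m) :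
    muiMt p v (-1) = cst _
      (moore p (fun i => (X (v i) : MvPolynomial (Fin m) (ZMod p))) ^ hh p) := by
  rw [muiMt, if_pos rfl, pol_eq_cst, dicksonLt, dicksonL_self]

variable [Fact p.Prime]

theorem dicksonQ_eq {k m : ℕ} (v : Fin k → Fin m) (hv : Function.Injective v) {s : ℕ}
    (hs : s ≤ k) :
    dicksonQ p v s =
      (-1) ^ (k + s) * cf p (fun i => (X (v i) : MvPolynomial (Fin m) (ZMod p))) s := by
  rw [dicksonQ, dicksonL_self]
  refine exactQuot_eq (moore_X_ne_zero v hv) ?_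
  rw [dicksonL, bracket_eq_br, br_skip _ hs]
  ring

theorem muiV_eq (k : ℕ) :
    muiV p k = cst _ (fv p (fun i : Fin k => (X i.castSucc : MvPolynomial (Fin (k + 1)) (ZMod p)))
      (X (Fin.last k))) := by
  rw [muiV, pol_eq_cst]
  congr 1
  rw [dicksonL_self, dicksonL_self]
  refine exactQuot_eq (moore_X_ne_zero _ (Fin.castSucc_injective k)) ?_
  exact moore_succ _

end Invariants

end

end MuiSteenrod

namespace MuiSteenrod

noncomputable section

/-! ### Linearity of the determinants in the exterior row -/

section Linear

variable {p : ℕ} {K : Type} [CommRing K]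

theorem brx_smul {n : ℕ} (c : K) (a u : Fin (n + 1) → K) (e : Fin n → ℕ) :
    brx p (fun i => c * a i) u e = c * brx p a u e := by
  simp only [brx, Finset.mul_sum]
  exact Finset.sum_congr rfl fun i _ => by ring

theorem mu_smul {n : ℕ} (c : K) (a u : Fin n → K) (s : ℕ) :
    mu p (fun i => c * a i) u s = c * mu p a u s := by
  cases n with
  | zero => simp [mu]
  | succ n => exact brx_smul c a u _

theorem dx_smul {n : ℕ} (c : K) (a u : Fin n → K) (b w : K) :
    dx p (fun i => c * a i) u (c * b) w = c * dx p a u b w := by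
  simp only [dx, mu_smul, mul_add, Finset.mul_sum]
  congr 1
  · ring
  · exact Finset.sum_congr rfl fun i _ => by ring

/-- Linearity in the first column. It evaluates a homomorphism on Mùi determinants once the images
of the exterior generators are given. -/
theorem brx_subst {n : ℕ} {I : Type} [Fintype I] [DecidableEq I] (v : Fin (n + 1) → I)
    (u : Fin (n + 1) → K) (e : Fin n → ℕ) (F : I → K) :
    ∑ i, brx p (fun l => ee K (v l) i) u e * F i = brx p (fun l => F (v l)) u e := by
  simp only [brx, Finset.sum_mul]
  rw [Finset.sum_comm]
  refine Finset.sum_congr rfl fun l _ => ?_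
  rw [Finset.sum_eq_single (v l)]
  · simp [ee]; ring
  · intro i _ hi
    simp [ee, hi]
  · simp

theorem mu_subst {n : ℕ} {I : Type} [Fintype I] [DecidableEq I] (v : Fin n → I)
    (u : Fin n → K) (s : ℕ) (F : I → K) :
    ∑ i, mu p (fun l => ee K (v l) i) u s * F i = mu p (fun l => F (v l)) u s := by
  cases n with
  | zero => simp [mu]
  | succ n => exact brx_subst v u _ F

theorem dx_subst {n : ℕ} {I : Type} [Fintype I] [DecidableEq I] (v : Fin n → I)
    (u : Fin n → K) (i₀ : I) (w : K) (F : I → K) :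
    ∑ i, dx p (fun l => ee K (v l) i) u (ee K i₀ i) w * F i =
      dx p (fun l => F (v l)) u (F i₀) w := by
  have hv : (Fin.snoc (α := fun _ => I) v i₀ : Fin (n + 1) → I) (Fin.last n) = i₀ := by simp
  have h : ∀ G : I → K, (Fin.snoc (α := fun _ => K) (fun l => G (v l)) (G i₀) : Fin (n + 1) → K) =
      fun l => G ((Fin.snoc (α := fun _ => I) v i₀ : Fin (n + 1) → I) l) := by
    intro G
    ext l
    refine Fin.lastCases ?_ (fun l => ?_) l <;> simp
  simp only [dx_eq_brx]
  rw [h F, ← brx_subst]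
  refine Finset.sum_congr rfl fun i _ => ?_
  rw [h (fun x => ee K x i)]

theorem map_ee {L J : Type} [CommRing L] [DecidableEq J] (f : K →+* L) (i j : J) :
    f (ee K i j) = ee L i j := by
  by_cases h : j = i
  · subst h; simp [ee]
  · simp [ee, h]

theorem map_dx {L : Type} [CommRing L] (f : K →+* L) {n : ℕ} (a u : Fin n → K) (b w : K) :
    f (dx p a u b w) = dx p (fun i => f (a i)) (fun i => f (u i)) (f b) (f w) := by
  simp [dx, map_moore, map_mu]

end Linear

/-! ### The operations `P` -/

section Pop

variable {p : ℕ} {J K : Type} [CommRing K] [Algebra (ZMod p) K] [Fintype J] [DecidableEq J]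
  {n k m N : ℕ}

/-- The inclusion along `w`. -/
def kap (p : ℕ) {J K : Type} [CommRing K] [Algebra (ZMod p) K] [Fintype J] [DecidableEq J]
    {m : ℕ} (y : J → K) (w : Fin m → J) : Coh p m →ₐ[ZMod p] EK p J K :=
  liftEP (fun i => ee K (w i)) (fun i => y (w i))

/-- The exterior part of the image of an exterior generator under `P`. -/
def popX (p : ℕ) (y : J → K) (v : Fin N → J) (i j : J) : K :=
  moore p (fun l => y (v l)) ^ (hh p - 1) *
    dx p (fun l => ee K (v l) j) (fun l => y (v l)) (ee K i j) (y i)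

/-- The homomorphism sending `x_i` to `U(v; w_i)` and `y_i` to `V(v; w_i)`. -/
def Pop (p : ℕ) {J K : Type} [CommRing K] [Algebra (ZMod p) K] [Fintype J] [DecidableEq J]
    {N m : ℕ} (y : J → K) (v : Fin N → J) (w : Fin m → J) : Coh p m →ₐ[ZMod p] EK p J K :=
  liftEP (fun i => popX p y v (w i)) (fun i => fv p (fun l => y (v l)) (y (w i)))

theorem liftEP_muiMt (f : Fin m → J → K) (g : Fin m → K) (w : Fin n → Fin m) (s : ℕ) :
    liftEP (p := p) f g (muiMt p w s) = lin (fun j => moore p (fun l => g (w l)) ^ (hh p - 1) *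
      mu p (fun l => f (w l) j) (fun l => g (w l)) s) := by
  rw [muiMt_natCast, liftEP_lin]
  congr 1
  ext j
  rw [← mu_subst w _ s (fun i => f i j)]
  simp only [Finset.sum_apply, Pi.smul_apply, smul_eq_mul, Finset.mul_sum]
  refine Finset.sum_congr rfl fun i _ => ?_
  rw [map_mul, map_pow, ← AlgHom.coe_toRingHom, map_moore, map_mu]
  simp [map_ee, mul_assoc]

theorem liftEP_muiMt_neg_one (f : Fin m → J → K) (g : Fin m → K) (w : Fin n → Fin m) :
    liftEP (p := p) f g (muiMt p w (-1)) = cst J (moore p (fun l => g (w l)) ^ hh p) := by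
  rw [muiMt_neg_one, liftEP_cst]
  congr 1
  rw [map_pow, ← AlgHom.coe_toRingHom, map_moore]
  simp

theorem liftEP_muiU (f : Fin (k + 1) → J → K) (g : Fin (k + 1) → K) :
    liftEP (p := p) f g (muiU p k) = lin (fun j =>
      moore p (fun l : Fin k => g l.castSucc) ^ (hh p - 1) *
        dx p (fun l : Fin k => f l.castSucc j) (fun l => g l.castSucc) (f (Fin.last k) j)
          (g (Fin.last k))) := by
  rw [muiU_eq, liftEP_lin]
  congr 1
  ext j
  rw [← dx_subst Fin.castSucc _ (Fin.last k) _ (fun i => f i j)]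
  simp only [Finset.sum_apply, Pi.smul_apply, smul_eq_mul, Finset.mul_sum]
  refine Finset.sum_congr rfl fun i _ => ?_
  rw [map_mul, map_pow, ← AlgHom.coe_toRingHom, map_moore, map_dx]
  simp [map_ee, mul_assoc]

variable [Fact p.Prime]

theorem liftEP_muiV (f : Fin (k + 1) → J → K) (g : Fin (k + 1) → K) :
    liftEP (p := p) f g (muiV p k) =
      cst J (fv p (fun l : Fin k => g l.castSucc) (g (Fin.last k))) := by
  rw [muiV_eq, liftEP_cst]
  congr 1
  rw [← AlgHom.coe_toRingHom, map_fv]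
  simp

theorem liftEP_dicksonQ (f : Fin m → J → K) (g : Fin m → K) (w : Fin n → Fin m)
    (hw : Function.Injective w) {s : ℕ} (hs : s ≤ n) :
    liftEP (p := p) f g (pol p _ _ (dicksonQ p w s)) =
      cst J ((-1) ^ (n + s) * cf p (fun l => g (w l)) s) := by
  rw [dicksonQ_eq w hw hs, pol_eq_cst, liftEP_cst]
  congr 1
  rw [← AlgHom.coe_toRingHom, map_mul, map_cf]
  simp

variable [IsDomain K] [CharP K p]

/-- Both orders of forming `V_{n+k+1}` agree. -/
theorem Pop_muiV (y : J → K) (v : Fin n → J) (w : Fin (k + 1) → J)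
    (h : moore p (Fin.append (fun i => y (v i)) fun i : Fin k => y (w i.castSucc)) ≠ 0) :
    Pop p y v w (muiV p k) = ∑ s ∈ Finset.range (n + 1), (-1) ^ (n + s) *
      (Pop p y (fun i => w i.castSucc) v (pol p _ _ (dicksonQ p (id : Fin n → Fin n) s)) *
        kap p y w (muiV p k) ^ p ^ s) := by
  -- After the exchange, the outer `p`-polynomial has as coefficients the images of `± Q_{n,s}`, and
  -- its argument is `V_{k+1}` in the variables `w`.
  rw [Pop, liftEP_muiV, fv_comm _ _ h, kap, liftEP_muiV, fv, map_sum]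
  refine Finset.sum_congr rfl fun s hs => ?_
  rw [Finset.mem_range] at hs
  rw [Pop, liftEP_dicksonQ _ _ _ Function.injective_id (by omega)]
  simp only [map_mul, map_pow, map_neg, map_one, id]
  rw [← mul_assoc, ← mul_assoc, ← pow_add, Even.neg_one_pow ⟨_, rfl⟩, one_mul]

/-- Both orders of forming `U_{n+k+1}` agree up to sign. -/
theorem Pop_muiU (y : J → K) (v : Fin n → J) (w : Fin (k + 1) → J)
    (h : moore p (Fin.append (fun i => y (v i)) fun i : Fin k => y (w i.castSucc)) ≠ 0)
    (hp : 1 ≤ hh p) :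
    Pop p y v w (muiU p k) = (-1) ^ (n * k * hh p + n) *
      (Pop p y (fun i => w i.castSucc) v (muiMt p (id : Fin n → Fin n) (-1)) * kap p y w (muiU p k) +
        ∑ s ∈ Finset.range n, (-1) ^ (s + 1) *
      (Pop p y (fun i => w i.castSucc) v (muiMt p (id : Fin n → Fin n) s) *
        kap p y w (muiV p k) ^ p ^ s)) := by
  have hz : ∀ r, ((-1 : EK p J K) ^ r) = cst J ((-1) ^ r) := by intro r; simp
  simp only [kap, Pop, liftEP_muiU, liftEP_muiV, liftEP_muiMt, liftEP_muiMt_neg_one, ← map_pow,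
    cst_mul_lin, lin_mul_cst, hz, ← map_sum, ← map_add]
  congr 1
  ext j
  simp only [Pi.smul_apply, Pi.add_apply, Finset.sum_apply, smul_eq_mul, id]
  simp only [popX, dx_smul, mu_smul]
  set u := fun i => y (v i) with hu
  set u' := fun i : Fin k => y (w i.castSucc) with hu'
  have h1 := moore_comm u u' h
  have h2 := dx_comm (fun i => ee K (v i) j) u (fun i => ee K (w i.castSucc) j) u' h
    (ee K (w (Fin.last k)) j) (y (w (Fin.last k)))
  have hs : ((-1 : K) ^ (n * k)) * (-1) ^ (n * k) = 1 := by rw [← mul_pow]; simp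
  have h2' : dx p (fun l : Fin k => dx p (fun i => ee K (v i) j) u (ee K (w l.castSucc) j) (u' l))
      (fun i => fv p u (u' i)) (dx p (fun i => ee K (v i) j) u (ee K (w (Fin.last k)) j)
        (y (w (Fin.last k)))) (fv p u (y (w (Fin.last k)))) = (-1) ^ (n * k) *
      dx p (fun i => dx p (fun i => ee K (w i.castSucc) j) u' (ee K (v i) j) (u i))
        (fun i => fv p u' (u i))
        (dx p (fun i => ee K (w i.castSucc) j) u' (ee K (w (Fin.last k)) j)
          (y (w (Fin.last k)))) (fv p u' (y (w (Fin.last k)))) := by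
    rw [h2, ← mul_assoc, hs, one_mul]
  have h3 : moore p u * moore p (fun i => fv p u (u' i)) =
      (-1) ^ (n * k) * (moore p u' * moore p (fun i => fv p u' (u i))) := by
    rw [h1, ← mul_assoc, hs, one_mul]
  obtain ⟨q, hq⟩ : ∃ q, hh p = q + 1 := ⟨hh p - 1, by omega⟩
  rw [h2']
  rw [hq, Nat.add_sub_cancel]
  -- The power `h - 1` of the Moore determinants gives `(-1)^{nk(h-1)}`, and `dx_comm` gives one
  -- more `(-1)^{nk}`. The remaining `(-1)^n` is the sign in the definition of `dx`.
  have h4 : moore p u ^ q * moore p (fun i => fv p u (u' i)) ^ q =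
      (-1) ^ (n * k * q) * (moore p u' ^ q * moore p (fun i => fv p u' (u i)) ^ q) := by
    rw [← mul_pow, h3, mul_pow, mul_pow, pow_mul (-1) (n * k) q]
  rw [dx]
  rw [pow_add, mul_add (n * k), mul_one, pow_add]
  simp only [hu', hu] at h4 ⊢
  trans (moore p (fun i => y (v i)) ^ q * moore p (fun i : Fin k =>
    fv p (fun i => y (v i)) (y (w i.castSucc))) ^ q) * ((-1) ^ (n * k) *
      ((-1) ^ n * ((dx p (fun i : Fin k => ee K (w i.castSucc) j) (fun i => y (w i.castSucc))
        (ee K (w (Fin.last k)) j) (y (w (Fin.last k)))) *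
        moore p (fun i => fv p (fun i : Fin k => y (w i.castSucc)) (y (v i))) +
        ∑ s ∈ Finset.range n, (-1) ^ (s + 1) * (mu p
          (fun i => dx p (fun i : Fin k => ee K (w i.castSucc) j) (fun i => y (w i.castSucc))
            (ee K (v i) j) (y (v i)))
          (fun i => fv p (fun i : Fin k => y (w i.castSucc)) (y (v i))) s *
            fv p (fun i : Fin k => y (w i.castSucc)) (y (w (Fin.last k))) ^ p ^ s))))
  · ring
  · rw [h4]
    simp only [mul_add, Finset.mul_sum]
    congr 1
    · ring
    · exact Finset.sum_congr rfl fun s _ => by ring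

end Pop

end

end MuiSteenrod

namespace MuiSteenrod

noncomputable section

/-! ### Monomials in the exterior algebra -/

section Exterior

variable {p : ℕ} {I J : Type} [Fintype I] [DecidableEq I] [DecidableEq J]

/-- Renaming of exterior generators. -/
def mapE (p : ℕ) {I J : Type} [Fintype I] [DecidableEq I] [DecidableEq J] (w : I → J) :
    Ext p I →ₐ[ZMod p] Ext p J :=
  ExteriorAlgebra.map (Fintype.linearCombination (ZMod p) fun i => Pi.single (w i) 1)

theorem mapE_gen (w : I → J) (i : I) : mapE p w (extGen p i) = extGen p (w i) := by
  rw [mapE, extGen, ExteriorAlgebra.map_apply_ι, Fintype.linearCombination_apply_single, one_smul,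
    extGen]

/-- The parity automorphism of the exterior algebra. -/
def parE (p : ℕ) (I : Type) : Ext p I →ₐ[ZMod p] Ext p I := ExteriorAlgebra.map (-LinearMap.id)

theorem parE_gen (i : I) : parE p I (extGen p i) = -extGen p i := by
  rw [parE, extGen, ExteriorAlgebra.map_apply_ι]; simp

theorem ext_left_induction {P : Ext p I → Prop} (h1 : P 1) (hadd : ∀ a b, P a → P b → P (a + b))
    (hsmul : ∀ (c : ZMod p) a, P a → P (c • a)) (hmul : ∀ i a, P a → P (extGen p i * a))
    (a : Ext p I) : P a := by
  induction a using CliffordAlgebra.left_induction with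
  | algebraMap r =>
    rw [Algebra.algebraMap_eq_smul_one]
    exact hsmul _ _ h1
  | add a b ha hb => exact hadd _ _ ha hb
  | ι_mul a v ha =>
    have hv : v = ∑ i, v i • (Pi.single i 1 : I → ZMod p) := by
      ext j; simp [Pi.single_apply]
    have h0 : P 0 := by simpa using hsmul 0 1 h1
    have key : ∀ t : Finset I, P ((∑ i ∈ t, v i • extGen p i) * a) := by
      intro t
      induction t using Finset.induction_on with
      | empty => simpa using h0
      | insert i t hi ih =>
        rw [Finset.sum_insert hi, add_mul, smul_mul_assoc]
        exact hadd _ _ (hsmul _ _ (hmul _ _ ha)) ih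
    rw [hv, map_sum]
    simp only [map_smul]
    exact key Finset.univ

/-- `x_{s_1} ⋯ x_{s_t}`. -/
def extList (p : ℕ) {I : Type} [DecidableEq I] (l : List I) : Ext p I :=
  (l.map (extGen p)).prod

theorem extList_cons (i : I) (l : List I) : extList p (i :: l) = extGen p i * extList p l := by
  simp [extList]

theorem extGen_sq (i : I) : extGen p i * extGen p i = 0 := ExteriorAlgebra.ι_sq_zero _

theorem extList_perm {l l' : List I} (h : l.Perm l') :
    ∃ c : ZMod p, extList p l = c • extList p l' := by
  induction h with
  | nil => exact ⟨1, by simp⟩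
  | cons i _ ih =>
    obtain ⟨c, hc⟩ := ih
    exact ⟨c, by rw [extList_cons, extList_cons, hc, mul_smul_comm]⟩
  | swap i j l =>
    refine ⟨-1, ?_⟩
    simp only [extList_cons, ← mul_assoc]
    rw [eq_neg_of_add_eq_zero_left (extGen_anticomm (p := p) j i)]
    simp
  | trans _ _ ih ih' =>
    obtain ⟨c, hc⟩ := ih
    obtain ⟨c', hc'⟩ := ih'
    exact ⟨c * c', by rw [hc, hc', mul_smul]⟩

variable {N : ℕ}

/-- `x_{s_1} ⋯ x_{s_t}` for `S = {s_1 < ⋯ < s_t}`. -/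
def extMonom (p : ℕ) {N : ℕ} (S : Finset (Fin N)) : Ext p (Fin N) :=
  extList p (S.sort (· ≤ ·))

theorem extList_mem_span (l : List (Fin N)) :
    extList p l ∈ Submodule.span (ZMod p) (Set.range (extMonom p (N := N))) := by
  by_cases h : l.Nodup
  · obtain ⟨c, hc⟩ := extList_perm (p := p) (l := l) (l' := l.toFinset.sort (· ≤ ·)) (by
      refine (List.perm_ext_iff_of_nodup h (Finset.sort_nodup _ _)).2 fun a => ?_
      simp)
    rw [hc]
    exact Submodule.smul_mem _ _ (Submodule.subset_span ⟨_, rfl⟩)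
  · have : extList p l = 0 := by
      rw [List.nodup_iff_sublist] at h
      push Not at h
      obtain ⟨a, ha⟩ := h
      obtain ⟨l', hl'⟩ := ha.exists_perm_append
      obtain ⟨c, hc⟩ := extList_perm (p := p) hl'
      rw [hc]
      simp only [List.cons_append, List.nil_append, extList_cons]
      rw [← mul_assoc, extGen_sq, zero_mul, smul_zero]
    rw [this]
    exact zero_mem _

theorem span_extMonom :
    Submodule.span (ZMod p) (Set.range (extMonom p (N := N))) = ⊤ := by
  rw [eq_top_iff]
  intro a _
  suffices h : a ∈ Submodule.span (ZMod p) (Set.range (extList p (I := Fin N))) by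
    refine Submodule.span_le.2 ?_ h
    rintro _ ⟨l, rfl⟩
    exact extList_mem_span l
  induction a using ext_left_induction with
  | h1 => exact Submodule.subset_span ⟨[], by simp [extList]⟩
  | hadd a b ha hb => exact add_mem (ha trivial) (hb trivial)
  | hsmul c a ha => exact Submodule.smul_mem _ _ (ha trivial)
  | hmul i a ha =>
    refine Submodule.span_induction (p := fun a _ => extGen p i * a ∈ _) ?_ ?_ ?_ ?_ (ha trivial)
    · rintro _ ⟨l, rfl⟩
      exact Submodule.subset_span ⟨i :: l, extList_cons i l⟩
    · simp
    · intro a b _ _ ha hb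
      rw [mul_add]; exact add_mem ha hb
    · intro c a _ ha
      rw [mul_smul_comm]; exact Submodule.smul_mem _ _ ha

/-! ### Coefficients of monomials -/

variable {m : ℕ}

/-- The left derivation `∂/∂τ_s`. -/
def der (p : ℕ) {N m : ℕ} (s : Fin N) : Ext p (Fin N ⊕ Fin m) →ₗ[ZMod p] Ext p (Fin N ⊕ Fin m) :=
  CliffordAlgebra.contractLeft (LinearMap.proj (Sum.inl s))

/-- Setting `τ` to zero. -/
def proE (p N m : ℕ) : Ext p (Fin N ⊕ Fin m) →ₐ[ZMod p] Ext p (Fin m) :=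
  ExteriorAlgebra.map (LinearMap.funLeft (ZMod p) (ZMod p) (Sum.inr : Fin m → Fin N ⊕ Fin m))

theorem der_inl_mul (s t : Fin N) (b : Ext p (Fin N ⊕ Fin m)) :
    der p s (extGen p (Sum.inl t) * b) =
      (if s = t then b else 0) - extGen p (Sum.inl t) * der p s b := by
  rw [der, extGen]
  refine (CliffordAlgebra.contractLeft_ι_mul _ _ _).trans ?_
  congr 1
  by_cases h : s = t
  · simp [h]
  · simp [h]

theorem der_inr_mul (s : Fin N) (i : Fin m) (b : Ext p (Fin N ⊕ Fin m)) :
    der p s (extGen p (Sum.inr i) * b) = -(extGen p (Sum.inr i) * der p s b) := by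
  rw [der, extGen]
  refine (CliffordAlgebra.contractLeft_ι_mul _ _ _).trans ?_
  simp

theorem der_one (s : Fin N) : der p s (1 : Ext p (Fin N ⊕ Fin m)) = 0 :=
  CliffordAlgebra.contractLeft_one _ _

theorem der_inr (s : Fin N) (z : Ext p (Fin m)) : der p s (mapE p Sum.inr z) = 0 := by
  induction z using ext_left_induction with
  | h1 => rw [map_one, der_one]
  | hadd a b ha hb => rw [map_add, map_add, ha, hb, add_zero]
  | hsmul c a ha => rw [map_smul, map_smul, ha, smul_zero]
  | hmul i a ha => rw [map_mul, mapE_gen, der_inr_mul, ha, mul_zero, neg_zero]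

theorem proE_inl (s : Fin N) : proE p N m (extGen p (Sum.inl s)) = 0 := by
  rw [proE, extGen, ExteriorAlgebra.map_apply_ι]
  have : LinearMap.funLeft (ZMod p) (ZMod p) (Sum.inr : Fin m → Fin N ⊕ Fin m)
      (Pi.single (Sum.inl s) 1) = 0 := by
    ext i
    simp [LinearMap.funLeft_apply]
  rw [this, map_zero]

theorem proE_inr_gen (i : Fin m) : proE p N m (extGen p (Sum.inr i)) = extGen p i := by
  rw [proE, extGen, ExteriorAlgebra.map_apply_ι, extGen]
  congr 1
  ext j
  by_cases h : i = j
  · simp [h, LinearMap.funLeft_apply]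
  · simp [LinearMap.funLeft_apply, Pi.single_apply]

theorem proE_inr (z : Ext p (Fin m)) : proE p N m (mapE p Sum.inr z) = z := by
  induction z using ext_left_induction with
  | h1 => rw [map_one, map_one]
  | hadd a b ha hb => rw [map_add, map_add, ha, hb]
  | hsmul c a ha => rw [map_smul, map_smul, ha]
  | hmul i a ha => rw [map_mul, map_mul, ha, mapE_gen, proE_inr_gen]

/-- Iterated derivations. -/
def derList (p : ℕ) {N m : ℕ} (l : List (Fin N)) (a : Ext p (Fin N ⊕ Fin m)) :
    Ext p (Fin N ⊕ Fin m) :=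
  l.foldl (fun x s => der p s x) a

theorem extCoeff_apply (S : Finset (Fin N)) (a : Ext p (Fin N ⊕ Fin m)) :
    extCoeff p S a = proE p N m (derList p (S.sort (· ≤ ·)) a) := by
  have key : ∀ (l : List (Fin N)) (f : Ext p (Fin N ⊕ Fin m) →ₗ[ZMod p] Ext p (Fin N ⊕ Fin m)),
      l.foldl (fun f s => der p s ∘ₗ f) f a = derList p l (f a) := by
    intro l
    induction l with
    | nil => intro f; rfl
    | cons s l ih => intro f; exact ih _
  exact congrArg (proE p N m) (key (S.sort (· ≤ ·)) LinearMap.id)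

theorem derList_cons (s : Fin N) (l : List (Fin N)) (a : Ext p (Fin N ⊕ Fin m)) :
    derList p (s :: l) a = derList p l (der p s a) := rfl

theorem derList_zero (l : List (Fin N)) : derList p l (0 : Ext p (Fin N ⊕ Fin m)) = 0 := by
  induction l with
  | nil => rfl
  | cons s l ih => rw [derList_cons, map_zero, ih]

theorem der_inl_list {s : Fin N} {l : List (Fin N)} (h : s ∉ l) (z : Ext p (Fin m)) :
    der p s (mapE p Sum.inl (extList p l) * mapE p Sum.inr z) = 0 := by
  induction l with
  | nil => simp [extList, der_inr]
  | cons t l ih =>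
    rw [List.mem_cons, not_or] at h
    rw [extList_cons, map_mul (mapE p _), mapE_gen, mul_assoc, der_inl_mul, if_neg h.1, ih h.2]
    simp

theorem proE_derList_inl {t : Fin N} {l : List (Fin N)} (h : t ∉ l)
    (b : Ext p (Fin N ⊕ Fin m)) : proE p N m (derList p l (extGen p (Sum.inl t) * b)) = 0 := by
  induction l generalizing b with
  | nil =>
    change proE p N m (extGen p (Sum.inl t) * b) = 0
    rw [map_mul, proE_inl, zero_mul]
  | cons s l ih =>
    rw [List.mem_cons, not_or] at h
    rw [derList_cons, der_inl_mul, if_neg (Ne.symm h.1), zero_sub, ← mul_neg, ih h.2]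

/-- Compare the heads `s` and `t`. If they are equal, the derivation strips the leftmost factor
without a sign. If `s < t`, then `τ_s` does not occur and the derivation gives zero; if `s > t`, no
derivation removes `τ_t`, and the final projection kills it. -/
theorem proE_derList {l l' : List (Fin N)} (hl : l.Pairwise (· < ·)) (hl' : l'.Pairwise (· < ·))
    (z : Ext p (Fin m)) :
    proE p N m (derList p l (mapE p Sum.inl (extList p l') * mapE p Sum.inr z)) =
      if l = l' then z else 0 := by
  induction l' generalizing l with
  | nil =>
    cases l with
    | nil => simp [derList, extList, proE_inr]
    | cons s l =>
      rw [derList_cons, der_inl_list (by simp), derList_zero, map_zero, if_neg (by simp)]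
  | cons t l' ih =>
    cases l with
    | nil =>
      rw [if_neg (by simp), extList_cons, map_mul, mapE_gen, mul_assoc]
      exact proE_derList_inl (by simp) _
    | cons s l =>
      rw [List.pairwise_cons] at hl hl'
      rcases lt_trichotomy s t with h | h | h
      · rw [derList_cons, der_inl_list, derList_zero, map_zero, if_neg]
        · simp [h.ne]
        · intro h'
          rcases List.mem_cons.1 h' with h' | h'
          · exact h.ne h'
          · exact (h.trans (hl'.1 _ h')).false
      · subst h
        have hs : s ∉ l' := fun h' => (hl'.1 _ h').false
        rw [derList_cons, extList_cons, map_mul (mapE p _), mapE_gen, mul_assoc, der_inl_mul, if_pos rfl,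
          der_inl_list hs, mul_zero, sub_zero, ih hl.2 hl'.2]
        simp
      · rw [if_neg (by simp [h.ne'])]
        rw [extList_cons, map_mul, mapE_gen, mul_assoc]
        refine proE_derList_inl ?_ _
        intro h'
        rcases List.mem_cons.1 h' with h' | h'
        · exact h.ne h'
        · exact (h.trans (hl.1 _ h')).false

theorem extCoeff_extMonom (S T : Finset (Fin N)) (z : Ext p (Fin m)) :
    extCoeff p S (mapE p Sum.inl (extMonom p T) * mapE p Sum.inr z) = if S = T then z else 0 := by
  rw [extCoeff_apply, extMonom, proE_derList (Finset.sortedLT_sort S).pairwise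
    (Finset.sortedLT_sort T).pairwise]
  have : S.sort (· ≤ ·) = T.sort (· ≤ ·) ↔ S = T := by
    refine ⟨fun h => ?_, fun h => by rw [h]⟩
    rw [← Finset.sort_toFinset S (· ≤ ·), h, Finset.sort_toFinset]
  simp only [this]

/-- The coefficient of `x_S`. -/
def epsE (p : ℕ) {N : ℕ} (S : Finset (Fin N)) : Ext p (Fin N) →ₗ[ZMod p] ZMod p :=
  ExteriorAlgebra.algebraMapInv.toLinearMap ∘ₗ extCoeff p (m := 0) S ∘ₗ
    (mapE p (Sum.inl : Fin N → Fin N ⊕ Fin 0)).toLinearMap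

theorem epsE_extMonom (S T : Finset (Fin N)) :
    epsE p S (extMonom p T) = if S = T then 1 else 0 := by
  have := extCoeff_extMonom (p := p) (m := 0) S T 1
  rw [map_one, mul_one] at this
  simp only [epsE, LinearMap.comp_apply, AlgHom.toLinearMap_apply, this]
  split_ifs <;> simp

theorem extCoeff_mul (S : Finset (Fin N)) (b : Ext p (Fin N)) (z : Ext p (Fin m)) :
    extCoeff p S (mapE p Sum.inl b * mapE p Sum.inr z) = epsE p S b • z := by
  have hb : b ∈ Submodule.span (ZMod p) (Set.range (extMonom p (N := N))) := by
    rw [span_extMonom]; trivial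
  induction hb using Submodule.span_induction with
  | mem b hb =>
    obtain ⟨T, rfl⟩ := hb
    rw [extCoeff_extMonom, epsE_extMonom]
    split_ifs <;> simp
  | zero => simp
  | add a b _ _ ha hb => rw [map_add, add_mul, map_add, ha, hb, map_add, add_smul]
  | smul c a _ ha => rw [map_smul, smul_mul_assoc, map_smul, ha, map_smul, smul_eq_mul, mul_smul]

theorem gen_inr_mul_inl (i : Fin m) (b : Ext p (Fin N)) :
    extGen p (Sum.inr i) * mapE p Sum.inl b =
      mapE p Sum.inl (parE p (Fin N) b) * extGen p (Sum.inr i) := by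
  induction b using ext_left_induction with
  | h1 => simp
  | hadd a b ha hb => simp only [map_add, mul_add, add_mul, ha, hb]
  | hsmul c a ha => simp only [map_smul, mul_smul_comm, smul_mul_assoc, ha]
  | hmul s a ha =>
    rw [map_mul, mapE_gen, ← mul_assoc, eq_neg_of_add_eq_zero_left (extGen_anticomm _ _), map_mul,
      parE_gen, map_mul, map_neg, mapE_gen, neg_mul, neg_mul, neg_mul, mul_assoc, ha, mul_assoc]

/-- Every product can be reordered with the `τ` on the left, at the cost of the parity automorphism
(`gen_inr_mul_inl`). -/
theorem ext_sum_induction {P : Ext p (Fin N ⊕ Fin m) → Prop}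
    (hmon : ∀ T z, P (mapE p Sum.inl (extMonom p T) * mapE p Sum.inr z))
    (hadd : ∀ a b, P a → P b → P (a + b))
    (hsmul : ∀ (c : ZMod p) a, P a → P (c • a)) (a : Ext p (Fin N ⊕ Fin m)) : P a := by
  have h0 : P 0 := by simpa using hsmul 0 _ (hmon ∅ 0)
  have hP : ∀ (b : Ext p (Fin N)) (z : Ext p (Fin m)),
      P (mapE p Sum.inl b * mapE p Sum.inr z) := by
    intro b z
    have hb : b ∈ Submodule.span (ZMod p) (Set.range (extMonom p (N := N))) := by
      rw [span_extMonom]; trivial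
    induction hb using Submodule.span_induction with
    | mem b hb =>
      obtain ⟨T, rfl⟩ := hb
      exact hmon _ _
    | zero => simpa using h0
    | add a b _ _ ha hb => rw [map_add, add_mul]; exact hadd _ _ ha hb
    | smul c a _ ha => rw [map_smul, smul_mul_assoc]; exact hsmul _ _ ha
  have ha : a ∈ Submodule.span (ZMod p) (Set.range fun q : Ext p (Fin N) × Ext p (Fin m) =>
      mapE p Sum.inl q.1 * mapE p Sum.inr q.2) := by
    induction a using ext_left_induction with
    | h1 => exact Submodule.subset_span ⟨(1, 1), by simp⟩
    | hadd a b ha hb => exact add_mem ha hb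
    | hsmul c a ha => exact Submodule.smul_mem _ _ ha
    | hmul i a ha =>
      induction ha using Submodule.span_induction with
      | mem a ha =>
        obtain ⟨⟨b, z⟩, rfl⟩ := ha
        refine Submodule.subset_span ?_
        rcases i with s | i
        · exact ⟨(extGen p s * b, z), by simp only [map_mul, mapE_gen, mul_assoc]⟩
        · refine ⟨(parE p _ b, extGen p i * z), ?_⟩
          simp only [map_mul, mapE_gen]
          rw [← mul_assoc, ← mul_assoc, gen_inr_mul_inl]
      | zero => simp
      | add a b _ _ ha hb => rw [mul_add]; exact add_mem ha hb
      | smul c a _ ha => rw [mul_smul_comm]; exact Submodule.smul_mem _ _ ha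
  induction ha using Submodule.span_induction with
  | mem a ha =>
    obtain ⟨⟨b, z⟩, rfl⟩ := ha
    exact hP _ _
  | zero => exact h0
  | add a b _ _ ha hb => exact hadd _ _ ha hb
  | smul c a _ ha => exact hsmul _ _ ha

theorem ext_expand (a : Ext p (Fin N ⊕ Fin m)) :
    a = ∑ S : Finset (Fin N), mapE p Sum.inl (extMonom p S) * mapE p Sum.inr (extCoeff p S a) := by
  induction a using ext_sum_induction with
  | hmon T z =>
    rw [Finset.sum_eq_single T]
    · rw [extCoeff_extMonom, if_pos rfl]
    · intro S _ hS
      rw [extCoeff_extMonom, if_neg hS, map_zero, mul_zero]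
    · simp
  | hadd a b ha hb =>
    simp only [map_add, mul_add, Finset.sum_add_distrib]
    rw [← ha, ← hb]
  | hsmul c a ha =>
    simp only [map_smul, mul_smul_comm]
    rw [← Finset.smul_sum, ← ha]

end Exterior

/-! ### Coefficients of polynomials -/

section Poly

open MvPolynomial

variable {p N m : ℕ}

theorem coeff_mul_const {σ R : Type} [CommSemiring R] (f : MvPolynomial σ R) (a : R) (d : σ →₀ ℕ) :
    coeff d (f * C a) = coeff d f * a := by
  rw [mul_comm, coeff_C_mul, mul_comm]

theorem polCoeff_apply (R : Fin N → ℕ) (f : MvPolynomial (Fin N ⊕ Fin m) (ZMod p)) :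
    polCoeff p R f = coeff (Finsupp.equivFunOnFinite.symm R)
      (sumAlgEquiv (ZMod p) (Fin N) (Fin m) f) := rfl

theorem sumAlgEquiv_rename_inl (f : MvPolynomial (Fin N) (ZMod p)) :
    sumAlgEquiv (ZMod p) (Fin N) (Fin m) (rename Sum.inl f) = map C f := by
  have := DFunLike.congr_fun (sumAlgEquiv_comp_rename_inl (R := ZMod p) (S₁ := Fin N)
    (S₂ := Fin m)) f
  exact this

theorem sumAlgEquiv_rename_inr (f : MvPolynomial (Fin m) (ZMod p)) :
    sumAlgEquiv (ZMod p) (Fin N) (Fin m) (rename Sum.inr f) = C f := by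
  have := DFunLike.congr_fun (sumAlgEquiv_comp_rename_inr (R := ZMod p) (S₁ := Fin N)
    (S₂ := Fin m)) f
  exact this

theorem polCoeff_mul (R : Fin N → ℕ) (f : MvPolynomial (Fin N) (ZMod p))
    (g : MvPolynomial (Fin m) (ZMod p)) :
    polCoeff p R (rename Sum.inl f * rename Sum.inr g) =
      coeff (Finsupp.equivFunOnFinite.symm R) f • g := by
  rw [polCoeff_apply, map_mul, sumAlgEquiv_rename_inl, sumAlgEquiv_rename_inr, coeff_mul_const,
    coeff_map, smul_eq_C_mul]

theorem polCoeff_mul_inr (R : Fin N → ℕ) (f : MvPolynomial (Fin N ⊕ Fin m) (ZMod p))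
    (g : MvPolynomial (Fin m) (ZMod p)) :
    polCoeff p R (f * rename Sum.inr g) = polCoeff p R f * g := by
  rw [polCoeff_apply, map_mul, sumAlgEquiv_rename_inr, coeff_mul_const, polCoeff_apply]

/-- `ξ^R`. -/
def polMonom (p : ℕ) {N : ℕ} (R : Fin N → ℕ) : MvPolynomial (Fin N) (ZMod p) :=
  monomial (Finsupp.equivFunOnFinite.symm R) 1

theorem polMonom_eq (R : Fin N → ℕ) : polMonom p R = ∏ j, X j ^ R j := by
  rw [polMonom, monomial_eq, map_one, one_mul, Finsupp.prod_fintype _ _ (by simp)]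
  rfl

theorem pol_expand (f : MvPolynomial (Fin N ⊕ Fin m) (ZMod p)) (B : Finset (Fin N → ℕ))
    (hB : ∀ R, polCoeff p R f ≠ 0 → R ∈ B) :
    f = ∑ R ∈ B, rename Sum.inl (polMonom p R) * rename Sum.inr (polCoeff p R f) := by
  apply (sumAlgEquiv (ZMod p) (Fin N) (Fin m)).injective
  simp only [map_sum, map_mul, sumAlgEquiv_rename_inl, sumAlgEquiv_rename_inr]
  ext1 R
  obtain ⟨R, rfl⟩ := Finsupp.equivFunOnFinite.symm.surjective R
  rw [coeff_sum]
  simp only [coeff_mul_const, coeff_map, polMonom, coeff_monomial, EmbeddingLike.apply_eq_iff_eq]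
  rw [← polCoeff_apply]
  by_cases h : R ∈ B
  · rw [Finset.sum_eq_single R]
    · simp
    · intro R' _ h'
      simp [h']
    · exact fun h' => absurd h h'
  · rw [Finset.sum_eq_zero]
    · by_contra h'
      exact h (hB R h')
    · intro R' hR'
      rw [if_neg (by rintro rfl; exact h hR')]
      simp

end Poly

end

noncomputable section

open MvPolynomial

/-! ### Expansion in the monomials `τ_S ξ^R` -/

section Expand

variable {p N m : ℕ}

theorem liftExt_ee_eq {I J K : Type} [Fintype I] [DecidableEq I] [Fintype J] [DecidableEq J]
    [CommRing K] [Algebra (ZMod p) K] (w : I → J) (a : Ext p I) :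
    liftExt (fun i => (ee K (w i) : J → K)) a = mapE p w a ⊗ₜ 1 := by
  induction a using ext_left_induction with
  | h1 => rw [map_one, map_one]; rfl
  | hadd a b ha hb => rw [map_add, map_add, ha, hb, TensorProduct.add_tmul]
  | hsmul c a ha => rw [map_smul, map_smul, ha, TensorProduct.smul_tmul']
  | hmul i a ha =>
    rw [map_mul, ha, liftExt_gen, map_mul, mapE_gen]
    have : (lin (ee K (w i)) : EK p J K) = extGen p (w i) ⊗ₜ 1 := lin_single (w i) 1
    rw [this, Algebra.TensorProduct.tmul_mul_tmul, one_mul]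

theorem kap_X_tmul {J : Type} [Fintype J] [DecidableEq J] (w : Fin m → J) (a : Ext p (Fin m))
    (f : MvPolynomial (Fin m) (ZMod p)) :
    kap p (X : J → MvPolynomial J (ZMod p)) w (a ⊗ₜ f) = mapE p w a ⊗ₜ rename w f := by
  rw [kap, liftEP_apply, liftExt_ee_eq, cst_apply, Algebra.TensorProduct.tmul_mul_tmul, one_mul,
    mul_one]
  have : aeval (fun i => (X (w i) : MvPolynomial J (ZMod p))) = rename w :=
    algHom_ext fun i => by simp
  rw [this]

/-- The coefficient of `τ_S ξ^R`. -/
def cSR (p : ℕ) {N m : ℕ} (S : Finset (Fin N)) (R : Fin N → ℕ) :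
    EP p (Fin N ⊕ Fin m) (Fin N ⊕ Fin m) →ₗ[ZMod p] Coh p m :=
  TensorProduct.map (extCoeff p S) (polCoeff p R)

theorem St_apply (S : Finset (Fin N)) (R : Fin N → ℕ) (z : Coh p m) :
    St p S R z = cSR p S R (coaction p N m z) := rfl

/-- `τ_S ξ^R`. -/
def monEP (p : ℕ) {N : ℕ} (S : Finset (Fin N)) (R : Fin N → ℕ) : Coh p N :=
  extMonom p S ⊗ₜ polMonom p R

/-- The coordinate functionals for the basis `τ_S ξ^R`. -/
def epsSR (p : ℕ) {N : ℕ} (S : Finset (Fin N)) (R : Fin N → ℕ) : Coh p N →ₗ[ZMod p] ZMod p :=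
  (TensorProduct.lid (ZMod p) (ZMod p)).toLinearMap ∘ₗ
    TensorProduct.map (epsE p S) (lcoeff (ZMod p) (Finsupp.equivFunOnFinite.symm R))

theorem epsSR_tmul (S : Finset (Fin N)) (R : Fin N → ℕ) (a : Ext p (Fin N))
    (f : MvPolynomial (Fin N) (ZMod p)) :
    epsSR p S R (a ⊗ₜ f) = epsE p S a * coeff (Finsupp.equivFunOnFinite.symm R) f := rfl

/-- The inclusion of the first block of variables. -/
abbrev inlH (p N m : ℕ) : Coh p N →ₐ[ZMod p] EP p (Fin N ⊕ Fin m) (Fin N ⊕ Fin m) :=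
  kap p (X : Fin N ⊕ Fin m → MvPolynomial (Fin N ⊕ Fin m) (ZMod p)) Sum.inl

/-- The inclusion of the second block of variables. -/
abbrev inrH (p N m : ℕ) : Coh p m →ₐ[ZMod p] EP p (Fin N ⊕ Fin m) (Fin N ⊕ Fin m) :=
  kap p (X : Fin N ⊕ Fin m → MvPolynomial (Fin N ⊕ Fin m) (ZMod p)) Sum.inr

theorem cSR_mul (S : Finset (Fin N)) (R : Fin N → ℕ) (b : Coh p N) (z : Coh p m) :
    cSR p S R (inlH p N m b * inrH p N m z) = epsSR p S R b • z := by
  induction b using TensorProduct.induction_on with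
  | zero => simp
  | add a b ha hb => rw [map_add, add_mul, map_add, ha, hb, map_add, add_smul]
  | tmul a f =>
    induction z using TensorProduct.induction_on with
    | zero => simp
    | add y z hy hz => rw [map_add, mul_add, map_add, hy, hz, smul_add]
    | tmul c g =>
      rw [kap_X_tmul, kap_X_tmul, Algebra.TensorProduct.tmul_mul_tmul, cSR,
        TensorProduct.map_tmul, extCoeff_mul, polCoeff_mul, epsSR_tmul,
        TensorProduct.smul_tmul_smul]

/-- The finite range of `R` depends on `w`; allowing every larger range makes the statement additive
in `w`. -/
theorem EP_expand_exists (w : EP p (Fin N ⊕ Fin m) (Fin N ⊕ Fin m)) :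
    ∃ B₀ : Finset (Fin N → ℕ), ∀ B, B₀ ⊆ B →
      w = ∑ S : Finset (Fin N), ∑ R ∈ B, inlH p N m (monEP p S R) * inrH p N m (cSR p S R w) := by
  induction w using TensorProduct.induction_on with
  | zero => exact ⟨∅, fun B _ => by simp⟩
  | add a b ha hb =>
    obtain ⟨B₁, h₁⟩ := ha
    obtain ⟨B₂, h₂⟩ := hb
    refine ⟨B₁ ∪ B₂, fun B hB => ?_⟩
    simp only [map_add, mul_add, Finset.sum_add_distrib]
    rw [← h₁ B (Finset.union_subset_left hB), ← h₂ B (Finset.union_subset_right hB)]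
  | tmul a f =>
    refine ⟨(sumAlgEquiv (ZMod p) (Fin N) (Fin m) f).support.image Finsupp.equivFunOnFinite,
      fun B hB => ?_⟩
    have hf := pol_expand f B fun R hR => hB (Finset.mem_image.2
      ⟨Finsupp.equivFunOnFinite.symm R, by rw [mem_support_iff]; exact hR, by simp⟩)
    conv_lhs => rw [ext_expand a, hf, TensorProduct.sum_tmul]
    refine Finset.sum_congr rfl fun S _ => ?_
    rw [TensorProduct.tmul_sum]
    refine Finset.sum_congr rfl fun R _ => ?_
    rw [monEP, cSR, TensorProduct.map_tmul, kap_X_tmul, kap_X_tmul,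
      Algebra.TensorProduct.tmul_mul_tmul]

theorem EP_expand (w : EP p (Fin N ⊕ Fin m) (Fin N ⊕ Fin m)) (B : Finset (Fin N → ℕ))
    (hB : ∀ S R, cSR p S R w ≠ 0 → R ∈ B) :
    w = ∑ S : Finset (Fin N), ∑ R ∈ B, inlH p N m (monEP p S R) * inrH p N m (cSR p S R w) := by
  obtain ⟨B₀, h⟩ := EP_expand_exists w
  refine (h (B ∪ B₀) Finset.subset_union_right).trans ?_
  refine Finset.sum_congr rfl fun S _ => ?_
  refine (Finset.sum_subset Finset.subset_union_left fun R _ hR => ?_).symm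
  have : cSR p S R w = 0 := by
    by_contra h'
    exact hR (hB S R h')
  rw [this, map_zero, mul_zero]

theorem epsSR_separating (b : Coh p N) (h : ∀ S R, epsSR p S R b = 0) : b = 0 := by
  have h1 : ∀ S R, cSR (m := 0) p S R (inlH p N 0 b) = 0 := by
    intro S R
    have := cSR_mul (m := 0) S R b 1
    rwa [map_one, mul_one, h, zero_smul] at this
  have h2 : inlH p N 0 b = 0 := by
    rw [EP_expand (inlH p N 0 b) ∅ fun S R h' => absurd (h1 S R) h']
    simp
  -- With an empty second block the inclusion has this retraction, so `b` is recovered from its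
  -- image, and the image is zero because all its coefficients are.
  let r : EP p (Fin N ⊕ Fin 0) (Fin N ⊕ Fin 0) →ₐ[ZMod p] EK p (Fin N) (MvPolynomial (Fin N) (ZMod p)) :=
    liftEP (Sum.elim (fun i => ee _ i) fun i => i.elim0) (Sum.elim X fun i => i.elim0)
  have h3 : (r.comp (inlH p N 0)) = AlgHom.id _ _ := by
    refine algHom_ext_EP (fun i => ?_) fun i => ?_
    · simp only [AlgHom.comp_apply, inlH, kap, r, liftEP_tmul, map_one, one_smul]
      have e : (lin (ee _ (Sum.inl i)) : EP p (Fin N ⊕ Fin 0) (Fin N ⊕ Fin 0)) =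
        extGen p (Sum.inl i) ⊗ₜ 1 := lin_single _ _
      rw [e, liftEP_tmul, map_one, one_smul]
      exact lin_single _ _
    · simp only [AlgHom.comp_apply, inlH, kap, r, liftEP_cst, aeval_X]
      rfl
  have h4 := DFunLike.congr_fun h3 b
  rw [AlgHom.comp_apply, h2, map_zero] at h4
  exact h4.symm

/-- The product of the two blocks of variables is injective on the tensor product. -/
theorem block_mul_injective [Fact p.Prime] (t : Coh p N ⊗[ZMod p] Coh p m)
    (h : LinearMap.mul' (ZMod p) _
      (TensorProduct.map (inlH p N m).toLinearMap (inrH p N m).toLinearMap t) = 0) : t = 0 := by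
  let b := Module.Basis.ofVectorSpace (ZMod p) (Coh p m)
  obtain ⟨c, rfl⟩ : ∃ c : _ →₀ Coh p N, t = c.sum fun i a => a ⊗ₜ b i := by
    obtain ⟨c, hc⟩ := TensorProduct.eq_repr_basis_right b t
    exact ⟨c, hc.symm⟩
  have hc : c = 0 := by
    ext1 i
    refine epsSR_separating _ fun S R => ?_
    -- Extracting the coefficient of `τ_S ξ^R` leaves a linear relation among the basis vectors `b
    -- i`, with coefficients the coordinates of the `c i`.
    have h1 := congrArg (cSR p S R) h
    simp only [Finsupp.sum, map_sum, TensorProduct.map_tmul, LinearMap.mul'_apply,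
      AlgHom.toLinearMap_apply, cSR_mul, map_zero] at h1
    have h2 := linearIndependent_iff'.1 b.linearIndependent c.support
      (fun i => epsSR p S R (c i)) h1
    by_cases hi : i ∈ c.support
    · exact h2 i hi
    · rw [Finsupp.notMem_support_iff.1 hi, map_zero]
  simp [hc]

end Expand

/-! ### Bihomogeneous elements and instability -/

section Unstable

variable {p N m : ℕ}

/-- Elements of exterior degree `e ≤ 1` and polynomial degree `d`. -/
def IsBi (z : Coh p m) (e d : ℕ) : Prop :=
  (e = 0 ∧ ∃ f : MvPolynomial (Fin m) (ZMod p), f.IsHomogeneous d ∧ z = cst (Fin m) f) ∨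
    (e = 1 ∧ ∃ a : Fin m → MvPolynomial (Fin m) (ZMod p), (∀ i, (a i).IsHomogeneous d) ∧ z = lin a)

theorem extCoeff_one {S : Finset (Fin N)} (hS : S ≠ ∅) :
    extCoeff p S (1 : Ext p (Fin N ⊕ Fin m)) = 0 := by
  have := extCoeff_extMonom (p := p) (m := m) S ∅ 1
  rw [if_neg hS] at this
  simpa [extMonom, extList] using this

theorem extCoeff_extGen {S : Finset (Fin N)} (hS : 1 < S.card) (i : Fin N ⊕ Fin m) :
    extCoeff p S (extGen p i) = 0 := by
  rcases i with s | i
  · have := extCoeff_extMonom (p := p) (m := m) S {s} 1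
    rw [if_neg (by rintro rfl; simp at hS)] at this
    simpa [extMonom, extList, mapE_gen] using this
  · have := extCoeff_extMonom (p := p) (m := m) S ∅ (extGen p i)
    rw [if_neg (by rintro rfl; simp at hS)] at this
    simpa [extMonom, extList, mapE_gen] using this

/-- The coaction on each `y_i` has degree at most one in the `ξ`, so a form of degree `d` acquires
degree at most `d` in them. -/
theorem polCoeff_aeval_coactY {d : ℕ} {f : MvPolynomial (Fin m) (ZMod p)} (hf : f.IsHomogeneous d)
    {R : Fin N → ℕ} (hR : d < ∑ j, R j) : polCoeff p R (aeval (coactY p N m) f) = 0 := by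
  rw [polCoeff_apply]
  refine coeff_eq_zero_of_totalDegree_lt (lt_of_le_of_lt ?_ (lt_of_lt_of_eq hR ?_))
  · have h1 : ∀ i, (sumAlgEquiv (ZMod p) (Fin N) (Fin m) (coactY p N m i)).totalDegree ≤ 1 := by
      intro i
      rw [coactY, map_add, map_sum, sumAlgEquiv_X_inr]
      refine (totalDegree_add _ _).trans (max_le (by simp) ?_)
      refine totalDegree_finsetSum_le fun j _ => ?_
      rw [map_mul, map_pow, sumAlgEquiv_X_inr, sumAlgEquiv_X_inl, ← map_pow]
      refine (totalDegree_mul _ _).trans ?_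
      rw [totalDegree_C, add_zero]
      exact (isHomogeneous_X _ j).totalDegree_le
    rw [aeval_def, eval₂_eq, map_sum]
    refine totalDegree_finsetSum_le fun D hD => ?_
    rw [map_mul, map_prod]
    refine (totalDegree_mul _ _).trans ?_
    have e1 : (sumAlgEquiv (ZMod p) (Fin N) (Fin m)) (algebraMap (ZMod p) _ (coeff D f)) =
        C (C (coeff D f)) := by
      rw [AlgEquiv.commutes]; rfl
    rw [e1, totalDegree_C, zero_add]
    refine (totalDegree_finsetProd _ _).trans ?_
    have hd : d = ∑ i ∈ D.support, D i := by
      have := hf (mem_support_iff.1 hD)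
      rw [← this, Finsupp.weight_apply, Finsupp.sum]
      simp
    rw [hd]
    refine Finset.sum_le_sum fun i _ => ?_
    rw [map_pow]
    refine (totalDegree_pow _ _).trans ?_
    calc D i * _ ≤ D i * 1 := Nat.mul_le_mul_left _ (h1 i)
      _ = D i := mul_one _
  · rw [← Finset.sum_subset (Finset.subset_univ _)]
    · exact Finset.sum_congr rfl fun i _ => rfl
    · intro i _ hi
      simpa using hi

theorem St_cst (S : Finset (Fin N)) (R : Fin N → ℕ) (f : MvPolynomial (Fin m) (ZMod p)) :
    St p S R (cst (Fin m) f) = extCoeff p S 1 ⊗ₜ polCoeff p R (aeval (coactY p N m) f) := by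
  rw [St_apply, coaction_cst, cst_apply, cSR, TensorProduct.map_tmul]

theorem St_extGen (S : Finset (Fin N)) (R : Fin N → ℕ) (i : Fin m)
    (f : MvPolynomial (Fin m) (ZMod p)) :
    St p S R (extGen p i ⊗ₜ f) =
      extCoeff p S (extGen p (Sum.inr i)) ⊗ₜ polCoeff p R (aeval (coactY p N m) f) +
      ∑ s : Fin N, extCoeff p S (extGen p (Sum.inl s)) ⊗ₜ
        (polCoeff p R (aeval (coactY p N m) f) * X i ^ p ^ (s : ℕ)) := by
  rw [St_apply, coaction_tmul, coactE_gen, add_mul, Finset.sum_mul, map_add, map_sum, cst_apply]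
  simp only [Algebra.TensorProduct.tmul_mul_tmul, one_mul, mul_one, cSR, TensorProduct.map_tmul]
  congr 1
  refine Finset.sum_congr rfl fun s _ => ?_
  rw [mul_comm (X _ ^ _), ← polCoeff_mul_inr, map_pow, rename_X]

/-- Instability: an exterior generator contributes at most one `τ` and no `ξ`, a polynomial
generator at most one `ξ` and no `τ`. -/
theorem IsBi.St_eq_zero {z : Coh p m} {e d : ℕ} (hz : IsBi z e d) {S : Finset (Fin N)}
    {R : Fin N → ℕ} (h : e < S.card ∨ d < ∑ j, R j) : St p S R z = 0 := by
  rcases hz with ⟨rfl, f, hf, rfl⟩ | ⟨rfl, a, ha, rfl⟩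
  · rw [St_cst]
    rcases h with h | h
    · rw [extCoeff_one (Finset.card_pos.1 h).ne_empty, TensorProduct.zero_tmul]
    · rw [polCoeff_aeval_coactY hf h, TensorProduct.tmul_zero]
  · rw [lin_apply, map_sum]
    refine Finset.sum_eq_zero fun i _ => ?_
    rw [St_extGen]
    rcases h with h | h
    · simp [extCoeff_extGen h]
    · simp only [polCoeff_aeval_coactY (ha i) h, zero_mul, TensorProduct.tmul_zero,
        Finset.sum_const_zero, add_zero]

end Unstable

end

noncomputable section

open MvPolynomial

/-! ### Mùi's expansion of `P` in terms of `St^{S,R}` -/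

section Mui

theorem aeval_mul_of_isHomogeneous {p : ℕ} {σ K : Type} [CommRing K] [Algebra (ZMod p) K] {d : ℕ}
    {f : MvPolynomial σ (ZMod p)} (hf : f.IsHomogeneous d) (c : K) (g : σ → K) :
    aeval (fun i => c * g i) f = c ^ d * aeval g f := by
  rw [aeval_def, aeval_def, eval₂_eq, eval₂_eq, Finset.mul_sum]
  refine Finset.sum_congr rfl fun D hD => ?_
  have hd : d = ∑ i ∈ D.support, D i := by
    have := hf (mem_support_iff.1 hD)
    rw [← this, Finsupp.weight_apply, Finsupp.sum]
    simp
  simp only [mul_pow, Finset.prod_mul_distrib]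
  rw [Finset.prod_pow_eq_pow_sum, ← hd]
  ring

theorem prod_map_sort {N : ℕ} {K : Type} [CommRing K] (S : Finset (Fin N)) (c : Fin N → K) :
    ((S.sort (· ≤ ·)).map c).prod = ∏ s ∈ S, c s := by
  rw [← Multiset.prod_coe, ← Multiset.map_coe, Finset.sort_eq]
  rfl

section

variable {p : ℕ} {J K : Type} [CommRing K] [Algebra (ZMod p) K] [Fintype J] [DecidableEq J] {N : ℕ}

theorem prod_map_lin_smul (l : List (Fin N)) (c : Fin N → K) (M : Fin N → J → K) :
    (l.map fun s => (lin (c s • M s) : EK p J K)).prod =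
      cst J (l.map c).prod * (l.map fun s => (lin (M s) : EK p J K)).prod := by
  induction l with
  | nil => simp
  | cons s l ih =>
    simp only [List.map_cons, List.prod_cons]
    rw [ih, ← cst_mul_lin, map_mul, mul_assoc, mul_assoc, ← mul_assoc (lin _),
      (cst_commute (lin (M s)) _).eq, mul_assoc]

theorem liftExt_mapE_extList {I I' : Type} [Fintype I] [DecidableEq I] [Fintype I']
    [DecidableEq I'] (f : I' → J → K) (w : I → I') (l : List I) :
    liftExt (p := p) f (mapE p w (extList p l)) = (l.map fun i => lin (f (w i))).prod := by
  induction l with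
  | nil => simp [extList]
  | cons i l ih => rw [extList_cons, map_mul, map_mul, mapE_gen, liftExt_gen, ih]; simp

/-- Cancelling the Moore determinant `L` in `cf_zero_mul` leaves `L^{p-1}`, the square of `L^h`. -/
theorem cf_zero_eq [IsDomain K] [CharP K p] [Fact p.Prime] (hp : 2 * hh p + 1 = p) (u : Fin N → K)
    (hu : moore p u ≠ 0) : cf p u 0 = (-1) ^ N * (moore p u ^ hh p) ^ 2 := by
  have h := cf_zero_mul (p := p) u
  have h2 : moore p u ^ p = (moore p u ^ hh p) ^ 2 * moore p u := by
    rw [← pow_mul, ← pow_succ, mul_comm (hh p), hp]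
  rw [h2, ← mul_assoc] at h
  have h3 := mul_right_cancel₀ hu h
  rw [← h3, ← mul_assoc, ← pow_add, Even.neg_one_pow ⟨_, rfl⟩, one_mul]

end

variable {p : ℕ} {J K : Type} [Field K] [Algebra (ZMod p) K] [Fintype J] [DecidableEq J] {N m : ℕ}

/-- The exterior part of the image of `M̃_{N,s}`. -/
def mtV (p : ℕ) {J K : Type} [Field K] [DecidableEq J] {N : ℕ} (y : J → K) (v : Fin N → J)
    (s : ℕ) (j : J) : K :=
  moore p (fun l => y (v l)) ^ (hh p - 1) * mu p (fun l => ee K (v l) j) (fun l => y (v l)) s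

/-- The image of `L̃_N`. -/
def thV (p : ℕ) {J K : Type} [Field K] {N : ℕ} (y : J → K) (v : Fin N → J) : K :=
  moore p (fun l => y (v l)) ^ hh p

/-- The image of `Q_{N,s}`. -/
def qV (p : ℕ) {J K : Type} [Field K] {N : ℕ} (y : J → K) (v : Fin N → J) (s : ℕ) : K :=
  (-1) ^ (N + s) * cf p (fun l => y (v l)) s

/-- The substitution for the exterior generators turning the coaction into `P`. -/
def psiF (p : ℕ) {J K : Type} [Field K] [DecidableEq J] {N m : ℕ} (y : J → K) (v : Fin N → J)
    (w : Fin m → J) : Fin N ⊕ Fin m → J → K :=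
  Sum.elim (fun s => ((-1) ^ ((s : ℕ) + 1) * (thV p y v)⁻¹) • mtV p y v s) fun i => ee K (w i)

/-- The substitution for the polynomial generators turning the coaction into `P`. -/
def psiG (p : ℕ) {J K : Type} [Field K] {N m : ℕ} (y : J → K) (v : Fin N → J)
    (w : Fin m → J) : Fin N ⊕ Fin m → K :=
  Sum.elim (fun j => ((-1) ^ ((j : ℕ) + 1) * (thV p y v ^ 2)⁻¹) * qV p y v (j + 1))
    fun i => y (w i)

/-- The substitution turning the coaction into `P`. -/
def psi (p : ℕ) {J K : Type} [Field K] [Algebra (ZMod p) K] [Fintype J] [DecidableEq J]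
    {N m : ℕ} (y : J → K) (v : Fin N → J) (w : Fin m → J) :
    EP p (Fin N ⊕ Fin m) (Fin N ⊕ Fin m) →ₐ[ZMod p] EK p J K :=
  liftEP (psiF p y v w) (psiG p y v w)

variable (y : J → K) (v : Fin N → J) (w : Fin m → J)

theorem psi_inrH (z : Coh p m) : psi p y v w (inrH p N m z) = kap p y w z := by
  have : (psi p y v w).comp (inrH p N m) = kap p y w := by
    refine algHom_ext_EP (fun i => ?_) fun i => ?_
    · simp only [AlgHom.comp_apply, inrH, kap, psi, liftEP_tmul, map_one, one_smul]
      have e : (lin (ee _ (Sum.inr i)) : EP p (Fin N ⊕ Fin m) (Fin N ⊕ Fin m)) =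
        extGen p (Sum.inr i) ⊗ₜ 1 := lin_single _ _
      rw [e, liftEP_tmul, map_one, one_smul]
      rfl
    · simp only [AlgHom.comp_apply, inrH, kap, psi, liftEP_cst, aeval_X]
      rfl
  rw [← this]; rfl

theorem thV_ne_zero (hu : moore p (fun l => y (v l)) ≠ 0) : thV p y v ≠ 0 := pow_ne_zero _ hu

/-- Dividing `U` by its coefficient `(-1)^N L̃` of `x_i` leaves Milnor's formula for `x_i` with
`τ_s` replaced by `(-1)^{s+1} M̃_s / L̃`. In the same way `fv_eq` divides `V` by its linear
coefficient `(-1)^N L̃^2` and leaves the formula for `y_i`. This explains `psiF` and `psiG`, and why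
`K` is a field. -/
theorem popX_eq (hu : moore p (fun l => y (v l)) ≠ 0) (hp : 1 ≤ hh p) (i j : J) :
    popX p y v i j = (-1) ^ N * thV p y v * (ee K i j +
      ∑ s : Fin N, ((-1) ^ ((s : ℕ) + 1) * (thV p y v)⁻¹) * mtV p y v s j * y i ^ p ^ (s : ℕ)) := by
  have h0 := thV_ne_zero y v hu
  have h1 : thV p y v = moore p (fun l => y (v l)) ^ (hh p - 1) * moore p (fun l => y (v l)) := by
    rw [← pow_succ, Nat.sub_add_cancel hp, thV]
  rw [popX, dx, Finset.sum_range]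
  simp only [mul_add, Finset.mul_sum]
  congr 1
  · rw [h1]; ring
  · refine Finset.sum_congr rfl fun s _ => ?_
    rw [mtV]
    field_simp

variable [Fact p.Prime] [CharP K p]

theorem thV_sq (hp : 2 * hh p + 1 = p) (hu : moore p (fun l => y (v l)) ≠ 0) :
    cf p (fun l => y (v l)) 0 = (-1) ^ N * thV p y v ^ 2 :=
  cf_zero_eq hp _ hu

theorem fv_eq (hp : 2 * hh p + 1 = p) (hu : moore p (fun l => y (v l)) ≠ 0) (x : K) :
    fv p (fun l => y (v l)) x = (-1) ^ N * thV p y v ^ 2 * (x +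
      ∑ j : Fin N, ((-1) ^ ((j : ℕ) + 1) * (thV p y v ^ 2)⁻¹) * qV p y v (j + 1) *
        x ^ p ^ ((j : ℕ) + 1)) := by
  have h0 := thV_ne_zero y v hu
  rw [fv, Finset.sum_range_succ', thV_sq y v hp hu, pow_zero, pow_one, add_comm, mul_add,
    Finset.sum_range, Finset.mul_sum]
  congr 1
  refine Finset.sum_congr rfl fun j _ => ?_
  rw [qV]
  field_simp
  have e : ((-1 : K) ^ N) * (-1) ^ ((j : ℕ) + 1) * (-1) ^ (N + ((j : ℕ) + 1)) = 1 := by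
    rw [← pow_add, ← pow_add, Even.neg_one_pow ⟨_, rfl⟩]
  linear_combination -(cf p (fun l => y (v l)) ((j : ℕ) + 1) * x ^ p ^ ((j : ℕ) + 1)) * e

theorem Pop_cst (hp : 2 * hh p + 1 = p) (hu : moore p (fun l => y (v l)) ≠ 0) {d : ℕ}
    {f : MvPolynomial (Fin m) (ZMod p)} (hf : f.IsHomogeneous d) :
    Pop p y v w (cst (Fin m) f) =
      cst J (((-1) ^ N * thV p y v ^ 2) ^ d) * psi p y v w (coaction p N m (cst (Fin m) f)) := by
  rw [Pop, liftEP_cst, coaction_cst, psi, liftEP_cst, ← map_mul]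
  congr 1
  simp only [fv_eq y v hp hu]
  rw [aeval_mul_of_isHomogeneous hf]
  congr 1
  rw [← AlgHom.comp_apply, comp_aeval]
  congr 2
  ext i
  simp [coactY, psiG]

/-- Each exterior generator contributes the normalizing factor `(-1)^N L̃` and each polynomial
generator `(-1)^N L̃^2`, so on a bihomogeneous element the factors collect into a single scalar. -/
theorem Pop_eq_psi (hp : 2 * hh p + 1 = p) (hu : moore p (fun l => y (v l)) ≠ 0)
    {z : Coh p m} {e d : ℕ} (hz : IsBi z e d) :
    Pop p y v w z = cst J ((-1) ^ (N * (e + d)) * thV p y v ^ (e + 2 * d)) *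
      psi p y v w (coaction p N m z) := by
  have h1 : 1 ≤ hh p := by
    have := (Fact.out : p.Prime).two_le
    omega
  rcases hz with ⟨rfl, f, hf, rfl⟩ | ⟨rfl, a, ha, rfl⟩
  · rw [Pop_cst y v w hp hu hf]
    congr 2
    rw [mul_pow, ← pow_mul, ← pow_mul, zero_add, zero_add]
  · rw [lin_apply]
    simp only [map_sum, Finset.mul_sum]
    refine Finset.sum_congr rfl fun i _ => ?_
    have e1 : (extGen p i ⊗ₜ a i : Coh p m) = extGen p i ⊗ₜ 1 * cst (Fin m) (a i) := by
      rw [cst_apply, Algebra.TensorProduct.tmul_mul_tmul, mul_one, one_mul]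
    rw [e1]
    simp only [map_mul]
    rw [Pop_cst y v w hp hu (ha i)]
    have e2 : Pop p y v w (extGen p i ⊗ₜ 1) =
        cst J ((-1) ^ N * thV p y v) * psi p y v w (coaction p N m (extGen p i ⊗ₜ 1)) := by
      rw [coaction_gen, map_add, map_sum, Pop, liftEP_tmul, psi, liftEP_tmul]
      simp only [liftEP_tmul, map_one, one_smul]
      rw [← map_sum, ← map_add, cst_mul_lin]
      congr 1
      ext j
      rw [popX_eq y v hu h1]
      simp only [Pi.smul_apply, Pi.add_apply, Finset.sum_apply, smul_eq_mul, map_pow, aeval_X,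
        psiF, psiG, Sum.elim_inl, Sum.elim_inr]
      congr 2
      exact Finset.sum_congr rfl fun s _ => by ring
    rw [e2]
    rw [mul_assoc, ← mul_assoc (psi p y v w _), (cst_commute (psi p y v w _) _).eq, mul_assoc,
      ← mul_assoc, ← mul_assoc, ← mul_assoc, ← map_mul, ← map_mul]
    congr 3
    rw [mul_pow, ← pow_mul, ← pow_mul]
    ring

/-- The exponent `r(S,R)` as a natural number. -/
def rrNat {N : ℕ} (S : Finset (Fin N)) (R : Fin N → ℕ) : ℕ :=
  S.card + ∑ s ∈ S, (s : ℕ) + ∑ i : Fin N, ((i : ℕ) + 1) * R i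

theorem rr_eq {N : ℕ} (S : Finset (Fin N)) (R : Fin N → ℕ) : rr S R = rrNat S R := by
  simp [rr, rrNat]

/-- Since `Q_{N,N} = 1`, the exponent `r_N` does not matter and `r_1, …, r_{N-1}` fit in the slots
after the power of `L̃`. -/
theorem prod_star (hu : moore p (fun l => y (v l)) ≠ 0) (q : ℤ) (R : Fin N → ℕ) :
    ∏ i : Fin N, (if (i : ℕ) = 0 then thV p y v else qV p y v i) ^ star q R i =
      thV p y v ^ (q - 2 * ∑ j, (R j : ℤ)).toNat * ∏ j : Fin N, qV p y v (j + 1) ^ R j := by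
  cases N with
  -- Here `star` has no entry at all, but the empty Moore determinant is `1`, so no power of `L̃` is
  -- lost.
  | zero => simp [thV, moore, br]
  | succ N =>
    rw [Fin.prod_univ_succ, Fin.prod_univ_castSucc (n := N)]
    have : qV p y v (N + 1) = 1 := by
      rw [qV, cf_top _ p_ne_zero, mul_one, Even.neg_one_pow ⟨_, rfl⟩]
    simp only [Fin.val_last, this, one_pow, mul_one, Fin.val_zero, if_true, Fin.val_succ,
      Fin.val_castSucc, star]
    congr 1

/-- In `monom` the sorted list is coerced to a list of naturals; here its entries stay in `Fin k`.
-/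
theorem monom_eq {k m : ℕ} (x : Fin k → Fin m) (S : Finset (Fin k)) (H : Fin k → ℕ) :
    monom p x S H = ((S.sort (· ≤ ·)).map fun s : Fin k => muiMt p x ((s : ℕ) : ℤ)).prod *
      pol p _ _ (∏ i : Fin k, (if (i : ℕ) = 0 then dicksonLt p x else dicksonQ p x i) ^ H i) := by
  have h : ∀ l : List (Fin k), (do let a ← l; pure (a : ℕ)) = l.map Fin.val := by
    intro l
    induction l with
    | nil => rfl
    | cons a l ih => simpa using ih
  rw [monom, h, List.map_map]
  rfl

theorem kap_monom (S : Finset (Fin N)) (H : Fin N → ℕ) :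
    kap p y v (monom p (id : Fin N → Fin N) S H) =
      ((S.sort (· ≤ ·)).map fun s : Fin N => (lin (mtV p y v s) : EK p J K)).prod *
        cst J (∏ i : Fin N, (if (i : ℕ) = 0 then thV p y v else qV p y v i) ^ H i) := by
  rw [monom_eq, map_mul, map_list_prod, List.map_map]
  congr 1
  · congr 1
    refine List.map_congr_left fun s _ => ?_
    rw [Function.comp_apply, kap, liftEP_muiMt]
    rfl
  · have h1 : kap p y v (pol p _ _ (dicksonLt p (id : Fin N → Fin N))) = cst J (thV p y v) := by
      have := liftEP_muiMt_neg_one (p := p) (fun i => ee K (v i)) (fun i => y (v i))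
        (id : Fin N → Fin N)
      rw [muiMt, if_pos rfl] at this
      exact this
    have h2 : ∀ s ≤ N, kap p y v (pol p _ _ (dicksonQ p (id : Fin N → Fin N) s)) =
        cst J (qV p y v s) := fun s hs =>
      liftEP_dicksonQ (p := p) (fun i => ee K (v i)) (fun i => y (v i)) (id : Fin N → Fin N)
        Function.injective_id hs
    have hprod : ∀ t : Finset (Fin N), kap p y v (pol p _ _ (∏ i ∈ t,
        (if (i : ℕ) = 0 then dicksonLt p (id : Fin N → Fin N) else
          dicksonQ p (id : Fin N → Fin N) i) ^ H i)) =
        cst J (∏ i ∈ t, (if (i : ℕ) = 0 then thV p y v else qV p y v i) ^ H i) := by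
      intro t
      induction t using Finset.induction_on with
      | empty => simp
      | insert i t hi ih =>
        rw [Finset.prod_insert hi, Finset.prod_insert hi, map_mul, map_mul, ih, map_mul, map_pow,
          map_pow, map_pow]
        congr 2
        split_ifs
        · exact h1
        · exact h2 i i.2.le
    exact hprod Finset.univ

/-- The image of `τ_S ξ^R` has denominator `L̃^{t + 2 ∑ r_i}`. Clearing it with `L̃^q` leaves the
first entry of `R^*` as exponent, and the signs `(-1)^{s+1}` of `τ_s` and `(-1)^j` of `ξ_j` multiply
to `(-1)^{r(S,R)}`. -/
theorem psi_monEP (hu : moore p (fun l => y (v l)) ≠ 0) (S : Finset (Fin N)) (R : Fin N → ℕ)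
    {q : ℕ} (hq : 0 ≤ (q : ℤ) - S.card - 2 * ∑ j, (R j : ℤ)) :
    cst J (thV p y v ^ q) * psi p y v w (inlH p N m (monEP p S R)) =
      (-1) ^ rrNat S R * kap p y v (monom p (id : Fin N → Fin N) S (star (q - S.card) R)) := by
  have h0 := thV_ne_zero y v hu
  rw [monEP, kap_X_tmul, psi, liftEP_apply, extMonom, liftExt_mapE_extList]
  simp only [psiF, Sum.elim_inl]
  rw [prod_map_lin_smul, prod_map_sort, kap_monom, aeval_rename, polMonom_eq, prod_star y v hu,
    map_prod (aeval (R := ZMod p) (psiG p y v w ∘ Sum.inl))]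
  simp only [map_pow (aeval _), aeval_X, Function.comp_apply, psiG, Sum.elim_inl]
  have hz : ∀ r, ((-1 : EK p J K) ^ r) = cst J ((-1) ^ r) := by intro r; simp
  have hc : ∀ (L : EK p J K) (c₁ c₂ c₃ : K), cst J c₁ * (cst J c₂ * L * cst J c₃) =
      cst J (c₁ * c₂ * c₃) * L := by
    intro L c₁ c₂ c₃
    rw [mul_assoc (cst J c₂), (cst_commute L _).eq, map_mul, map_mul]
    simp only [mul_assoc]
  have hc' : ∀ (L : EK p J K) (c₁ c₂ : K), cst J c₁ * (L * cst J c₂) = cst J (c₁ * c₂) * L := by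
    intro L c₁ c₂
    rw [(cst_commute L _).eq, map_mul, mul_assoc]
  rw [hz, hc, hc']
  congr 2
  obtain ⟨a, ha⟩ : ∃ a : ℕ, q = a + S.card + 2 * ∑ j, R j := by
    refine ⟨((q : ℤ) - S.card - 2 * ∑ j, (R j : ℤ)).toNat, ?_⟩
    zify
    rw [Int.toNat_of_nonneg hq]
    ring
  have ha' : ((q : ℤ) - S.card - 2 * ∑ j, (R j : ℤ)).toNat = a := by
    rw [ha]; push_cast; omega
  rw [ha', ha]
  simp only [mul_pow, Finset.prod_mul_distrib, Finset.prod_pow_eq_pow_sum, Finset.prod_const]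
  simp only [← pow_mul, Finset.prod_pow_eq_pow_sum, ← inv_pow]
  rw [rrNat, Finset.sum_add_distrib, Finset.sum_const, smul_eq_mul, mul_one]
  simp only [pow_add, inv_pow]
  field_simp

/-- Mùi's formula for `P` in terms of the operations `St^{S,R}`. -/
theorem Pop_expand (hp : 2 * hh p + 1 = p) (hu : moore p (fun l => y (v l)) ≠ 0)
    {z : Coh p m} {e d : ℕ} (hz : IsBi z e d) :
    Pop p y v w z = (-1) ^ (N * (e + d)) *
      ∑ S : Finset (Fin N), ∑ R ∈ admissible N ((e + 2 * d : ℕ) - S.card),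
        (-1) ^ rrNat S R * (kap p y v (monom p (id : Fin N → Fin N) S
          (star ((e + 2 * d : ℕ) - S.card) R)) * kap p y w (St p S R z)) := by
  have hz' : ((-1 : EK p J K) ^ (N * (e + d))) = cst J ((-1) ^ (N * (e + d))) := by simp
  rw [Pop_eq_psi y v w hp hu hz, map_mul, mul_assoc, hz']
  congr 1
  -- A range independent of `S` is used first. It is then cut down for each `S`: if `t + 2 ∑ r_i > e
  -- + 2d`, then `t > e` or `∑ r_i > d`, and instability applies.
  have h1 := EP_expand (coaction p N m z) (admissible N (e + 2 * d : ℕ)) fun S R h => by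
    rw [mem_admissible]
    by_contra h'
    refine h (hz.St_eq_zero (Or.inr ?_))
    rw [← Nat.cast_sum] at h'
    omega
  simp only [← St_apply] at h1
  conv_lhs => rw [h1]
  simp only [map_sum, Finset.mul_sum, map_mul, psi_inrH]
  refine Finset.sum_congr rfl fun S _ => ?_
  have hsub : admissible N (((e + 2 * d : ℕ) : ℤ) - S.card) ⊆ admissible N ((e + 2 * d : ℕ) : ℤ) := by
    intro R hR
    rw [mem_admissible] at hR ⊢
    omega
  rw [← Finset.sum_subset hsub]
  · refine Finset.sum_congr rfl fun R hR => ?_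
    rw [mem_admissible] at hR
    rw [← mul_assoc, psi_monEP y v w hu S R hR, mul_assoc]
  · intro R _ hR
    rw [mem_admissible] at hR
    rw [hz.St_eq_zero, map_zero, mul_zero, mul_zero]
    rw [← Nat.cast_sum] at hR
    omega

end Mui

end

noncomputable section

open MvPolynomial

/-! ### Images of the monomials and the parity automorphism -/

section Monom

variable {p : ℕ} {J K : Type} [CommRing K] [Algebra (ZMod p) K] [Fintype J] [DecidableEq J]
  {k m N : ℕ}

theorem liftEP_monom [Fact p.Prime] (f : Fin m → J → K) (g : Fin m → K) (x : Fin k → Fin m)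
    (hx : Function.Injective x) (S : Finset (Fin k)) (H : Fin k → ℕ) :
    liftEP (p := p) f g (monom p x S H) =
      ((S.sort (· ≤ ·)).map fun s : Fin k => (lin (fun j =>
        moore p (fun l => g (x l)) ^ (hh p - 1) *
          mu p (fun l => f (x l) j) (fun l => g (x l)) s) : EK p J K)).prod *
        cst J (∏ i : Fin k, (if (i : ℕ) = 0 then moore p (fun l => g (x l)) ^ hh p else
          (-1) ^ (k + (i : ℕ)) * cf p (fun l => g (x l)) i) ^ H i) := by
  rw [monom_eq, map_mul, map_list_prod, List.map_map]
  congr 1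
  · congr 1
    refine List.map_congr_left fun s _ => ?_
    rw [Function.comp_apply, liftEP_muiMt]
  · have h1 : liftEP (p := p) f g (pol p _ _ (dicksonLt p x)) =
        cst J (moore p (fun l => g (x l)) ^ hh p) := by
      have := liftEP_muiMt_neg_one (p := p) f g x
      rw [muiMt, if_pos rfl] at this
      exact this
    have hprod : ∀ t : Finset (Fin k), liftEP (p := p) f g (pol p _ _ (∏ i ∈ t,
        (if (i : ℕ) = 0 then dicksonLt p x else dicksonQ p x i) ^ H i)) =
        cst J (∏ i ∈ t, (if (i : ℕ) = 0 then moore p (fun l => g (x l)) ^ hh p else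
          (-1) ^ (k + (i : ℕ)) * cf p (fun l => g (x l)) i) ^ H i) := by
      intro t
      induction t using Finset.induction_on with
      | empty => simp
      | insert i t hi ih =>
        rw [Finset.prod_insert hi, Finset.prod_insert hi, map_mul, map_mul, ih, map_mul, map_pow,
          map_pow, map_pow]
        congr 2
        split_ifs
        · exact h1
        · exact liftEP_dicksonQ f g x hx i.2.le
    exact hprod Finset.univ

theorem kap_monom_comp [Fact p.Prime] (y : J → K) (w : Fin m → J) (x : Fin k → Fin m)
    (hx : Function.Injective x) (S : Finset (Fin k)) (H : Fin k → ℕ) :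
    kap p y w (monom p x S H) =
      kap p y (fun i => w (x i)) (monom p (id : Fin k → Fin k) S H) := by
  rw [kap, liftEP_monom _ _ _ hx, kap, liftEP_monom _ _ _ Function.injective_id]
  rfl

/-- The parity automorphism `x_i ↦ -x_i`, `y_i ↦ y_i`. -/
def par (p m : ℕ) : Coh p m →ₐ[ZMod p] EK p (Fin m) (MvPolynomial (Fin m) (ZMod p)) :=
  liftEP (fun i j => -1 * ee _ i j) X

theorem par_gen (i : Fin m) (f : MvPolynomial (Fin m) (ZMod p)) :
    par p m (extGen p i ⊗ₜ f) = -(extGen p i ⊗ₜ f) := by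
  rw [par, liftEP_tmul, aeval_X_left_apply]
  have : (fun j => -1 * ee (MvPolynomial (Fin m) (ZMod p)) i j) = -Pi.single i 1 := by
    ext1 j; simp [ee]
  rw [this, ← lin_mul_cst, map_neg, lin_single, cst_apply, neg_mul,
    Algebra.TensorProduct.tmul_mul_tmul, mul_one, one_mul]

theorem par_cst (f : MvPolynomial (Fin m) (ZMod p)) : par p m (cst _ f) = cst _ f := by
  rw [par, liftEP_cst, aeval_X_left_apply]

theorem par_monom [Fact p.Prime] (S : Finset (Fin m)) (H : Fin m → ℕ) :
    par p m (monom p (id : Fin m → Fin m) S H) =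
      ((-1 : ZMod p) ^ S.card) • monom p (id : Fin m → Fin m) S H := by
  have hid : monom p (id : Fin m → Fin m) S H =
      liftEP (p := p) (fun i => ee (MvPolynomial (Fin m) (ZMod p)) i) X
        (monom p (id : Fin m → Fin m) S H) := by
    have : liftEP (p := p) (fun i => ee (MvPolynomial (Fin m) (ZMod p)) i) X =
        AlgHom.id (ZMod p) (Coh p m) := by
      refine algHom_ext_EP (fun i => ?_) fun i => ?_
      · rw [liftEP_tmul, map_one, one_smul]
        exact lin_single _ _
      · rw [liftEP_cst, aeval_X]; rfl
    rw [this]; rfl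
  conv_rhs => rw [hid]
  rw [par, liftEP_monom _ _ _ Function.injective_id, liftEP_monom _ _ _ Function.injective_id,
    ← smul_mul_assoc]
  congr 1
  rw [← Finset.length_sort (s := S) (· ≤ ·)]
  generalize S.sort (· ≤ ·) = l
  induction l with
  | nil => simp
  | cons s l ih =>
    simp only [List.map_cons, List.prod_cons, List.length_cons, mu_smul]
    simp only [mu_smul] at ih
    have hneg : (lin (fun j => moore p (fun l => X (id l)) ^ (hh p - 1) *
        (-1 * mu p (fun i => ee (MvPolynomial (Fin m) (ZMod p)) (id i) j) (fun l => X (id l)) s)) :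
        EK p (Fin m) (MvPolynomial (Fin m) (ZMod p))) =
        -lin (fun j => moore p (fun l => X (id l)) ^ (hh p - 1) *
        mu p (fun i => ee (MvPolynomial (Fin m) (ZMod p)) (id i) j) (fun l => X (id l)) s) := by
      rw [← map_neg]
      congr 1
      ext1 j
      simp
    rw [ih, pow_succ', mul_smul, neg_one_smul, mul_smul_comm, hneg, neg_mul, smul_neg]

theorem lin_mul_kap (y : J → K) (v : Fin m → J) (a : J → K) (z : Coh p m) :
    lin a * kap p y v z = kap p y v (par p m z) * lin a := by
  induction z using TensorProduct.induction_on with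
  | zero => simp
  | add b c hb hc => simp only [map_add, mul_add, add_mul, hb, hc]
  | tmul b f =>
    have hf : lin a * kap p y v (cst _ f) = kap p y v (cst _ f) * lin a := by
      rw [kap, liftEP_cst]
      exact (cst_commute _ _).eq
    have hb : (b ⊗ₜ f : Coh p m) = (b ⊗ₜ 1) * cst _ f := by
      rw [cst_apply, Algebra.TensorProduct.tmul_mul_tmul, mul_one, one_mul]
    rw [hb]
    simp only [map_mul, par_cst]
    suffices h : lin a * kap p y v (b ⊗ₜ 1) = kap p y v (par p m (b ⊗ₜ 1)) * lin a by
      rw [← mul_assoc, h, mul_assoc, hf, mul_assoc]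
    clear hb
    induction b using ext_left_induction with
    | h1 => simp [← Algebra.TensorProduct.one_def]
    | hadd b c hb hc => simp only [TensorProduct.add_tmul, map_add, mul_add, add_mul, hb, hc]
    | hsmul c b hb =>
      rw [← TensorProduct.smul_tmul', map_smul, map_smul, map_smul, mul_smul_comm, smul_mul_assoc,
        hb]
    | hmul i b hb =>
      have e : ((extGen p i * b) ⊗ₜ 1 : Coh p m) = extGen p i ⊗ₜ 1 * b ⊗ₜ 1 := by
        rw [Algebra.TensorProduct.tmul_mul_tmul, mul_one]
      have hk : kap p y v (extGen p i ⊗ₜ 1) = lin (ee K (v i)) := by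
        rw [kap, liftEP_tmul, map_one, one_smul]
      rw [e, map_mul, map_mul, map_mul, par_gen, map_neg, hk, ← mul_assoc, lin_swap, neg_mul,
        neg_mul, neg_mul, mul_assoc, hb, mul_assoc]

/-- Each factor `M̃_s` is linear in the exterior generators, so passing `z` across it applies the
parity automorphism once; the polynomial factors are central. The sign `(-1)^{t t'}` originates
here. -/
theorem kap_monom_mul_kap [Fact p.Prime] (y : J → K) (v : Fin m → J) (w : Fin N → J)
    (S : Finset (Fin N)) (H : Fin N → ℕ) (z : Coh p m) :
    kap p y w (monom p (id : Fin N → Fin N) S H) * kap p y v z =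
      kap p y v ((par p m)^[S.card] z) * kap p y w (monom p (id : Fin N → Fin N) S H) := by
  have hk := liftEP_monom (p := p) (fun i => ee K (w i)) (fun i => y (w i)) (id : Fin N → Fin N)
    Function.injective_id S H
  change kap p y w _ = _ at hk
  rw [hk, mul_assoc,
    ← (cst_commute (kap p y v z) _).eq, ← mul_assoc, ← mul_assoc]
  congr 1
  rw [← Finset.length_sort (s := S) (· ≤ ·)]
  generalize S.sort (· ≤ ·) = l
  induction l generalizing z with
  | nil => simp
  | cons s l ih =>
    simp only [List.map_cons, List.prod_cons, List.length_cons]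
    rw [mul_assoc, ih, ← mul_assoc, lin_mul_kap, mul_assoc, Function.iterate_succ_apply']

end Monom

/-! ### Linear independence of the monomials `M̃_S Q̃^H` -/

section Independence

variable {p : ℕ} [Fact p.Prime] {n : ℕ}

/-- For `j ≠ s` the column of exponent `j` is repeated. For `j = s` the sum is the expansion of the
Moore determinant along column `s`, up to `(-1)^s`. -/
theorem mu_pow {K : Type} [CommRing K] (u : Fin n → K) (j s : Fin n) :
    mu p (fun l => u l ^ p ^ (j : ℕ)) u s = if j = s then (-1) ^ (s : ℕ) * moore p u else 0 := by
  cases n with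
  | zero => exact j.elim0
  | succ n =>
    rw [mu]
    split_ifs with h
    · subst h
      rw [brx, moore, br, Matrix.det_succ_column _ j, Finset.mul_sum]
      refine Finset.sum_congr rfl fun i _ => ?_
      have e : br p (fun l => u (i.succAbove l)) (fun l => skip j l) =
          ((Matrix.of fun i j : Fin (n + 1) => u i ^ p ^ (j : ℕ)).submatrix i.succAbove
            j.succAbove).det := by
        rw [br]
        congr 1
        ext a b
        simp [skip_eq_succAbove]
      have e2 : ((-1 : K) ^ (j : ℕ)) * (-1) ^ (j : ℕ) = 1 := by rw [← mul_pow]; simp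
      rw [← e, pow_add, Matrix.of_apply]
      linear_combination -((-1) ^ (i : ℕ) * u i ^ p ^ (j : ℕ) *
        br p (fun l => u (i.succAbove l)) (fun l => skip j l)) * e2
    · obtain ⟨j', rfl⟩ := Fin.exists_succAbove_eq h
      rw [brx_eq_det]
      refine Matrix.det_zero_of_column_eq (Fin.succ_ne_zero j').symm fun i => ?_
      simp [skip_eq_succAbove]

/-- The basic invariants `L̃_n, Q_{n,1}, …, Q_{n,n-1}`. -/
def basicInv (p n : ℕ) (i : Fin n) : MvPolynomial (Fin n) (ZMod p) :=
  if (i : ℕ) = 0 then moore p (X : Fin n → MvPolynomial (Fin n) (ZMod p)) ^ hh p else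
    (-1) ^ (n + (i : ℕ)) * cf p (X : Fin n → MvPolynomial (Fin n) (ZMod p)) i

/-- Each variable is a root of the monic `p`-polynomial `fv`, whose coefficients lie in the
subalgebra generated by the `n` invariants. The polynomial ring, of transcendence degree `n`, is
thus algebraic over that subalgebra, so its `n` generators form a transcendence basis. -/
theorem algebraicIndependent_basicInv (hp : 2 * hh p + 1 = p) :
    AlgebraicIndependent (ZMod p) (basicInv p n) := by
  set B := Algebra.adjoin (ZMod p) (Set.range (basicInv p n)) with hB
  have hmem : ∀ i, basicInv p n i ∈ B := fun i => Algebra.subset_adjoin ⟨i, rfl⟩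
  have hX : moore p (X : Fin n → MvPolynomial (Fin n) (ZMod p)) ≠ 0 :=
    moore_X_ne_zero (p := p) (id : Fin n → Fin n) Function.injective_id
  have hcf : ∀ s ≤ n, cf p (X : Fin n → MvPolynomial (Fin n) (ZMod p)) s ∈ B := by
    intro s hs
    have hneg : ∀ r : ℕ, ((-1 : MvPolynomial (Fin n) (ZMod p)) ^ r) ∈ B := fun r =>
      pow_mem (neg_mem (one_mem _)) _
    rcases hs.eq_or_lt with rfl | hs
    · rw [cf_top _ p_ne_zero]; exact one_mem _
    · have h1 := hmem ⟨s, hs⟩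
      rw [basicInv] at h1
      by_cases h0 : s = 0
      · subst h0
        rw [if_pos rfl] at h1
        -- The constant coefficient is not among the generators, but it is `± L̃^2`.
        rw [cf_zero_eq hp _ hX]
        exact mul_mem (hneg _) (pow_mem h1 2)
      · rw [if_neg h0] at h1
        have h2 := mul_mem (hneg (n + s)) h1
        simp only at h2
        rwa [← mul_assoc, ← pow_add, Even.neg_one_pow ⟨_, rfl⟩, one_mul] at h2
  have hint : ∀ i : Fin n, IsIntegral B (X i : MvPolynomial (Fin n) (ZMod p)) := by
    intro i
    have hdeg : ∀ s : Fin n, (Polynomial.C (⟨_, hcf s s.2.le⟩ : B) * Polynomial.X ^ p ^ (s : ℕ)).degree <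
        ((p ^ n : ℕ) : WithBot ℕ) := fun s =>
      (Polynomial.degree_C_mul_X_pow_le _ _).trans_lt
        (by exact_mod_cast Nat.pow_lt_pow_right one_lt_p s.2)
    refine ⟨Polynomial.X ^ p ^ n + ∑ s : Fin n, Polynomial.C (⟨_, hcf s s.2.le⟩ : B) *
      Polynomial.X ^ p ^ (s : ℕ), Polynomial.monic_X_pow_add ?_, ?_⟩
    · refine (Polynomial.degree_sum_le _ _).trans_lt ?_
      rw [Finset.sup_lt_iff (WithBot.bot_lt_coe _)]
      exact fun s _ => hdeg s
    · have h := fv_root (p := p) (X : Fin n → MvPolynomial (Fin n) (ZMod p)) i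
      rw [fv, Finset.sum_range_succ, cf_top _ p_ne_zero, one_mul, Finset.sum_range] at h
      rw [Polynomial.eval₂_add, Polynomial.eval₂_finsetSum]
      simp only [Polynomial.eval₂_mul, Polynomial.eval₂_C, Polynomial.eval₂_pow,
        Polynomial.eval₂_X]
      rw [add_comm]
      exact h
  have hall : Algebra.IsIntegral B (MvPolynomial (Fin n) (ZMod p)) := by
    constructor
    intro f
    induction f using MvPolynomial.induction_on with
    | C a => exact (isIntegral_algebraMap (R := B) (x := algebraMap (ZMod p) B a))
    | add f g hf hg => exact hf.add hg
    | mul_X f i hf => exact hf.mul (hint i)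
  have : Algebra.IsAlgebraic B (MvPolynomial (Fin n) (ZMod p)) := inferInstance
  refine (Algebra.IsAlgebraic.isTranscendenceBasis_of_le_trdeg_of_finite (ZMod p) (basicInv p n) ?_).1
  rw [MvPolynomial.trdeg_of_isDomain]
  simp

theorem linearIndependent_basicInv_monomials (hp : 2 * hh p + 1 = p) :
    LinearIndependent (ZMod p) fun H : Fin n → ℕ => ∏ i, basicInv p n i ^ H i := by
  have h := algebraicIndependent_basicInv (n := n) hp
  have h1 := (basisMonomials (Fin n) (ZMod p)).linearIndependent.map'
    (aeval (basicInv p n)).toLinearMap (LinearMap.ker_eq_bot.2 h)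
  have h2 := h1.comp (Finsupp.equivFunOnFinite.symm : (Fin n → ℕ) → _)
    Finsupp.equivFunOnFinite.symm.injective
  have e : (fun H : Fin n → ℕ => ∏ i, basicInv p n i ^ H i) =
      ((aeval (basicInv p n)).toLinearMap ∘ basisMonomials (Fin n) (ZMod p)) ∘
        (Finsupp.equivFunOnFinite.symm : (Fin n → ℕ) → _) := ?_
  · rw [e]; exact h2
  ext1 H
  simp only [Function.comp_apply, coe_basisMonomials, AlgHom.toLinearMap_apply, aeval_monomial,
    map_one, one_mul]
  rw [Finsupp.prod_fintype _ _ (by simp)]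
  rfl

/-- The coefficient of `x_S` isolates the terms with exterior part `S`, so the second factors may
depend on `S` and need only be independent for each `S`. -/
theorem linearIndependent_extMonom_tmul {K : Type} [CommRing K] [Algebra (ZMod p) K] {ι : Type}
    (G : Finset (Fin n) → ι → K) (hG : ∀ S, LinearIndependent (ZMod p) (G S)) :
    LinearIndependent (ZMod p) fun i : Finset (Fin n) × ι => (extMonom p i.1 ⊗ₜ G i.1 i.2 :
      EK p (Fin n) K) := by
  classical
  rw [linearIndependent_iff']
  rintro t c hc ⟨S, H⟩ hi
  let Λ : EK p (Fin n) K →ₗ[ZMod p] K :=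
    (TensorProduct.lid (ZMod p) K).toLinearMap ∘ₗ LinearMap.rTensor K (epsE p S)
  have h1 := congrArg Λ hc
  have hΛ : ∀ T a, Λ (extMonom p T ⊗ₜ a) = if S = T then a else 0 := by
    intro T a
    simp only [Λ, LinearMap.comp_apply, LinearMap.rTensor_tmul, epsE_extMonom]
    split_ifs <;> simp
  simp only [map_sum, map_smul, hΛ, smul_ite, smul_zero, map_zero] at h1
  rw [← Finset.sum_filter] at h1
  have h2 : ∑ x ∈ (t.filter fun i => S = i.1).image Prod.snd, c (S, x) • G S x = 0 := by
    rw [← h1, Finset.sum_image]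
    · refine Finset.sum_congr rfl fun i hi => ?_
      obtain ⟨-, hi⟩ := Finset.mem_filter.1 hi
      rw [hi]
    · intro a ha b hb hab
      obtain ⟨-, ha⟩ := Finset.mem_filter.1 (Finset.mem_coe.1 ha)
      obtain ⟨-, hb⟩ := Finset.mem_filter.1 (Finset.mem_coe.1 hb)
      exact Prod.ext (ha.symm.trans hb) hab
  exact linearIndependent_iff'.1 (hG S) _ (fun x => c (S, x)) h2 H
    (Finset.mem_image.2 ⟨(S, H), Finset.mem_filter.2 ⟨hi, rfl⟩, rfl⟩)

/-- The homomorphism `x_i ↦ ∑_s x_s y_i^{p^s}`, which diagonalizes the `M̃_s`. -/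
def diag (p n : ℕ) : Coh p n →ₐ[ZMod p] EK p (Fin n) (MvPolynomial (Fin n) (ZMod p)) :=
  liftEP (fun i j => (X i : MvPolynomial (Fin n) (ZMod p)) ^ p ^ (j : ℕ)) X

theorem prod_map_lin_single {K : Type} [CommRing K] [Algebra (ZMod p) K] (l : List (Fin n)) :
    (l.map fun s => (lin (Pi.single s 1) : EK p (Fin n) K)).prod = extList p l ⊗ₜ 1 := by
  induction l with
  | nil => rfl
  | cons s l ih =>
    rw [List.map_cons, List.prod_cons, ih, lin_single, extList_cons,
      Algebra.TensorProduct.tmul_mul_tmul, mul_one]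

theorem diag_monom (h1 : 1 ≤ hh p) (S : Finset (Fin n)) (H : Fin n → ℕ) :
    diag p n (monom p (id : Fin n → Fin n) S H) =
      extMonom p S ⊗ₜ ((∏ s ∈ S, ((-1) ^ (s : ℕ) *
        moore p (X : Fin n → MvPolynomial (Fin n) (ZMod p)) ^ hh p)) *
        ∏ j, basicInv p n j ^ H j) := by
  rw [diag, liftEP_monom _ _ _ Function.injective_id]
  simp only [id, mu_pow]
  have e1 : ∀ s : Fin n, (fun j => moore p (fun l => (X l : MvPolynomial (Fin n) (ZMod p))) ^
      (hh p - 1) * if j = s then (-1) ^ (s : ℕ) * moore p (fun l : Fin n =>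
        (X l : MvPolynomial (Fin n) (ZMod p))) else 0) =
      ((-1) ^ (s : ℕ) * moore p (fun l : Fin n =>
        (X l : MvPolynomial (Fin n) (ZMod p))) ^ hh p) •
          (Pi.single s 1 : Fin n → MvPolynomial (Fin n) (ZMod p)) := by
    intro s
    ext1 j
    rw [Pi.smul_apply, smul_eq_mul, Pi.single_apply]
    generalize moore p (fun l : Fin n => (X l : MvPolynomial (Fin n) (ZMod p))) = M
    split_ifs
    · have : M ^ hh p = M ^ (hh p - 1) * M := by rw [← pow_succ, Nat.sub_add_cancel h1]
      rw [this]
      ring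
    · simp
  simp only [e1]
  rw [prod_map_lin_smul, prod_map_sort, prod_map_lin_single, ← (cst_commute _ _).eq, mul_assoc,
    ← map_mul, cst_apply, Algebra.TensorProduct.tmul_mul_tmul, mul_one, one_mul]
  rfl

/-- Under `diag`, `M̃_s` becomes `± L̃ x_s`, so a monomial goes to `x_S` tensor a nonzero polynomial
depending only on `S` times a monomial in the basic invariants. -/
theorem linearIndependent_monomFamily (hp : 2 * hh p + 1 = p) :
    LinearIndependent (ZMod p) (monomFamily p n) := by
  have h1 : 1 ≤ hh p := by
    have := (Fact.out : p.Prime).two_le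
    omega
  have hX : moore p (X : Fin n → MvPolynomial (Fin n) (ZMod p)) ≠ 0 :=
    moore_X_ne_zero (p := p) (id : Fin n → Fin n) Function.injective_id
  set G : Finset (Fin n) → (Fin n → ℕ) → MvPolynomial (Fin n) (ZMod p) := fun S H =>
    (∏ s ∈ S, ((-1) ^ (s : ℕ) *
      moore p (X : Fin n → MvPolynomial (Fin n) (ZMod p)) ^ hh p)) *
        ∏ j, basicInv p n j ^ H j with hG
  have hGS : ∀ S, LinearIndependent (ZMod p) (G S) := fun S =>
    (linearIndependent_basicInv_monomials (n := n) hp).map' (LinearMap.mulLeft (ZMod p)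
      (∏ s ∈ S, ((-1) ^ (s : ℕ) * moore p (X : Fin n → MvPolynomial (Fin n) (ZMod p)) ^ hh p)))
      (LinearMap.ker_eq_bot.2 (mul_right_injective₀ (Finset.prod_ne_zero_iff.2 fun s _ =>
      mul_ne_zero (pow_ne_zero _ (neg_ne_zero.2 one_ne_zero)) (pow_ne_zero _ hX))))
  have key : ∀ i : Finset (Fin n) × (Fin n → ℕ), diag p n (monomFamily p n i) =
      extMonom p i.1 ⊗ₜ G i.1 i.2 := fun i => diag_monom h1 i.1 i.2
  clear_value G
  have hfin := linearIndependent_extMonom_tmul G hGS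
  have key' := funext key
  rw [← key'] at hfin
  exact LinearIndependent.of_comp (diag p n).toLinearMap hfin

end Independence

end

noncomputable section

open MvPolynomial

/-! ### Linear independence of the elements `M̃_S Q̃^H V^{p^s}` -/

section IndependenceV

variable {p : ℕ} [Fact p.Prime] {k : ℕ}

theorem dx_pow {K : Type} [CommRing K] (u : Fin k → K) (w : K) (j : Fin k) :
    dx p (fun l => u l ^ p ^ (j : ℕ)) u (w ^ p ^ (j : ℕ)) w = 0 := by
  rw [dx_eq_brx, brx_eq_det]
  refine Matrix.det_zero_of_column_eq (Fin.succ_ne_zero j).symm fun i => ?_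
  refine Fin.lastCases ?_ (fun i => ?_) i <;> simp

theorem dx_zero {K : Type} [CommRing K] (u : Fin k → K) (w : K) :
    dx p (fun _ => 0) u 1 w = (-1) ^ k * moore p u := by
  have : ∀ s, mu p (fun _ : Fin k => (0 : K)) u s = 0 := by
    intro s
    have := mu_smul (p := p) (0 : K) (fun _ : Fin k => (0 : K)) u s
    simpa using this
  simp [dx, this]

/-- The new index is the largest, so the factor from `U_{k+1}`, which stands on the right, is
already in place and no sign appears. -/
theorem sort_snoc (S : Finset (Fin k)) :
    (insert (Fin.last k) (S.map Fin.castSuccEmb)).sort (· ≤ ·) =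
      (S.sort (· ≤ ·)).map Fin.castSucc ++ [Fin.last k] := by
  refine List.Perm.eq_of_pairwise (le := (· ≤ ·)) (fun a b _ _ => le_antisymm)
    (Finset.pairwise_sort _ _) ?_ ?_
  · rw [List.pairwise_append]
    refine ⟨?_, List.pairwise_singleton _ _, fun a _ b hb => ?_⟩
    · rw [List.pairwise_map]
      exact (Finset.pairwise_sort S (· ≤ ·)).imp fun h => h
    · rw [List.mem_singleton.1 hb]
      exact Fin.le_last a
  · refine (List.perm_ext_iff_of_nodup (Finset.sort_nodup _ _) ?_).2 fun a => ?_
    · rw [List.nodup_append]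
      refine ⟨(Finset.sort_nodup _ _).map (Fin.castSucc_injective k), List.nodup_singleton _, ?_⟩
      rintro a ha b hb rfl
      obtain ⟨c, -, hc⟩ := List.mem_map.1 ha
      rw [List.mem_singleton] at hb
      exact (Fin.castSucc_lt_last c).ne (hc.trans hb)
    · simp only [Finset.mem_sort, Finset.mem_insert, Finset.mem_map, Fin.castSuccEmb_apply,
        List.mem_append, List.mem_map, List.mem_singleton]
      exact or_comm

theorem sort_castSucc (S : Finset (Fin k)) :
    (S.map Fin.castSuccEmb).sort (· ≤ ·) = (S.sort (· ≤ ·)).map Fin.castSucc := by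
  symm
  refine List.Perm.eq_of_pairwise (le := (· ≤ ·)) (fun a b _ _ => le_antisymm) ?_
    (Finset.pairwise_sort _ _) ?_
  · rw [List.pairwise_map]
    exact (Finset.pairwise_sort S (· ≤ ·)).imp fun h => h
  · refine (List.perm_ext_iff_of_nodup ((Finset.sort_nodup _ _).map (Fin.castSucc_injective k))
      (Finset.sort_nodup _ _)).2 fun a => ?_
    simp

/-- The points `y_1, …, y_k` of `𝔽_p[y_1, …, y_k][Y]`. -/
def genC (p k : ℕ) (i : Fin k) : Polynomial (MvPolynomial (Fin k) (ZMod p)) :=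
  Polynomial.C (X i)

/-- The polynomial `V_{k+1}` in the last variable. -/
def polyV (p k : ℕ) : Polynomial (MvPolynomial (Fin k) (ZMod p)) :=
  fv p (genC p k) Polynomial.X

theorem natDegree_polyV : (polyV p k).natDegree = p ^ k := by
  have hcf : ∀ s, cf p (genC p k) s = Polynomial.C (cf p X s) := fun s =>
    (map_cf (Polynomial.C : MvPolynomial (Fin k) (ZMod p) →+* _) X s).symm
  rw [polyV, fv, Finset.sum_range_succ, cf_top _ p_ne_zero, one_mul]
  simp only [hcf]
  rw [Polynomial.natDegree_add_eq_right_of_natDegree_lt, Polynomial.natDegree_X_pow]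
  rw [Polynomial.natDegree_X_pow]
  refine lt_of_le_of_lt (Polynomial.natDegree_sum_le_of_forall_le (n := p ^ k - 1) _ _ fun s hs => ?_)
    (Nat.sub_lt (pow_pos (Fact.out : p.Prime).pos _) one_pos)
  refine (Polynomial.natDegree_C_mul_X_pow_le _ _).trans ?_
  exact Nat.le_sub_one_of_lt (Nat.pow_lt_pow_right one_lt_p (Finset.mem_range.1 hs))

/-- A nonconstant polynomial over a domain is transcendental over the coefficient ring. -/
theorem linearIndependent_polyV_pow :
    LinearIndependent (MvPolynomial (Fin k) (ZMod p)) fun e : ℕ => polyV p k ^ e := by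
  have htr : Transcendental (MvPolynomial (Fin k) (ZMod p)) (polyV p k) := by
    refine Polynomial.transcendental _ ?_ ?_
    · rw [natDegree_polyV]; exact (pow_pos (Fact.out : p.Prime).pos _).ne'
    · exact mem_nonZeroDivisors_of_ne_zero (Polynomial.leadingCoeff_ne_zero.2 fun h => by
        have := natDegree_polyV (p := p) (k := k)
        rw [h, Polynomial.natDegree_zero] at this
        exact (pow_pos (Fact.out : p.Prime).pos k).ne this)
  have h := (Polynomial.basisMonomials (MvPolynomial (Fin k) (ZMod p))).linearIndependent.map'
    (Polynomial.aeval (polyV p k)).toLinearMap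
    (LinearMap.ker_eq_bot.2 (transcendental_iff_injective.1 htr))
  have e : (fun e : ℕ => polyV p k ^ e) =
      ((Polynomial.aeval (R := MvPolynomial (Fin k) (ZMod p)) (polyV p k)).toLinearMap ∘
      (Polynomial.basisMonomials (MvPolynomial (Fin k) (ZMod p)))) := by
    ext1 e
    simp
  rw [e]
  exact h

/-! ### Values of the invariants under the diagonalizing homomorphism. -/

section Diag

variable {K : Type} [CommRing K] [Algebra (ZMod p) K]

/-- The values of the basic invariants `L̃_k, Q_{k,1}, …, Q_{k,k-1}` at `u`. -/
def basicVal (p : ℕ) (u : Fin k → K) (i : Fin k) : K :=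
  if (i : ℕ) = 0 then moore p u ^ hh p else (-1) ^ (k + (i : ℕ)) * cf p u i

/-- The factor coming from the exterior generators. -/
def extFactor (p : ℕ) (u : Fin k → K) (T : Finset (Fin (k + 1))) : K :=
  ∏ t ∈ T, ((-1) ^ (t : ℕ) * moore p u ^ hh p)

/-- A homomorphism diagonalizing the `M̃_s` and `U_{k+1}`. -/
def diagV (p : ℕ) {k : ℕ} {K : Type} [CommRing K] [Algebra (ZMod p) K] (u : Fin k → K) (Y : K) :
    Coh p (k + 1) →ₐ[ZMod p] EK p (Fin (k + 1)) K :=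
  liftEP (fun i j => Fin.lastCases (motive := fun _ => K)
      (Fin.lastCases (motive := fun _ => K) 1 (fun _ => 0) i)
      (fun j => (Fin.snoc (α := fun _ => K) u Y : Fin (k + 1) → K) i ^ p ^ (j : ℕ)) j)
    (Fin.snoc (α := fun _ => K) u Y)

variable (u : Fin k → K) (Y : K)

theorem diagV_muiV : diagV p u Y (muiV p k) = cst _ (fv p u Y) := by
  rw [diagV, liftEP_muiV]
  simp

/-- In the first `k` coordinates the determinant has a repeated column. In the last one only the
last point has a nonzero exterior entry, so a single Moore determinant survives. -/
theorem diagV_muiU (h1 : 1 ≤ hh p) : diagV p u Y (muiU p k) =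
    lin (((-1) ^ k * moore p u ^ hh p) • Pi.single (Fin.last k) 1) := by
  rw [diagV, liftEP_muiU]
  congr 1
  ext1 j
  have hM : moore p u ^ hh p = moore p u ^ (hh p - 1) * moore p u := by
    rw [← pow_succ, Nat.sub_add_cancel h1]
  refine Fin.lastCases ?_ (fun j => ?_) j
  · simp only [Fin.lastCases_last, Fin.lastCases_castSucc, Fin.snoc_castSucc, Fin.snoc_last,
      dx_zero, Pi.smul_apply, Pi.single_eq_same, smul_eq_mul, mul_one]
    rw [hM]
    ring
  · simp only [Fin.lastCases_castSucc, Fin.snoc_castSucc, Fin.snoc_last, dx_pow, mul_zero,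
      Pi.smul_apply, smul_eq_mul]
    rw [Pi.single_eq_of_ne (Fin.castSucc_lt_last j).ne, mul_zero]

theorem diagV_monom (h1 : 1 ≤ hh p) (S : Finset (Fin k)) (H : Fin k → ℕ) :
    diagV p u Y (monom p Fin.castSucc S H) =
      extMonom p (S.map Fin.castSuccEmb) ⊗ₜ (extFactor p u (S.map Fin.castSuccEmb) *
        ∏ j, basicVal p u j ^ H j) := by
  rw [diagV, liftEP_monom _ _ _ (Fin.castSucc_injective k)]
  simp only [Fin.snoc_castSucc, Fin.lastCases_castSucc]
  have hM : moore p u ^ hh p = moore p u ^ (hh p - 1) * moore p u := by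
    rw [← pow_succ, Nat.sub_add_cancel h1]
  have e1 : ∀ s : Fin k, (fun j : Fin (k + 1) => moore p (fun l => u l) ^ (hh p - 1) *
      mu p (fun l => Fin.lastCases (motive := fun _ => K)
        0 (fun j => u l ^ p ^ (j : ℕ)) j) (fun l => u l) s) =
      ((-1) ^ (s : ℕ) * moore p u ^ hh p) • (Pi.single s.castSucc 1 : Fin (k + 1) → K) := by
    intro s
    ext1 j
    rw [Pi.smul_apply, smul_eq_mul]
    refine Fin.lastCases ?_ (fun j => ?_) j
    · simp only [Fin.lastCases_last]
      rw [Pi.single_eq_of_ne (Fin.castSucc_lt_last s).ne', mul_zero]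
      have := mu_smul (p := p) (0 : K) (fun _ => 0) u s
      simp only [zero_mul] at this
      rw [this, mul_zero]
    · simp only [Fin.lastCases_castSucc]
      rw [mu_pow, Pi.single_apply, hM]
      simp only [Fin.castSucc_inj]
      split_ifs
      · ring
      · simp
  simp only [e1]
  have e2 : (S.sort (· ≤ ·)).map (fun s : Fin k => (lin (Pi.single s.castSucc 1) :
      EK p (Fin (k + 1)) K)) =
      ((S.sort (· ≤ ·)).map Fin.castSucc).map fun s => lin (Pi.single s 1) := by
    rw [List.map_map]; rfl
  rw [prod_map_lin_smul, prod_map_sort, e2, prod_map_lin_single, ← (cst_commute _ _).eq, mul_assoc,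
    ← map_mul, cst_apply, Algebra.TensorProduct.tmul_mul_tmul, mul_one, one_mul, extMonom,
    sort_castSucc, extFactor, Finset.prod_map]
  rfl

end Diag

/-- The family `M̃_S Q̃^H V^{p^{s-1}}`. -/
def monomVFamily (p k : ℕ) (i : ℕ × Finset (Fin k) × (Fin k → ℕ)) : Coh p (k + 1) :=
  monom p Fin.castSucc i.2.1 i.2.2 * muiVpow p k ((i.1 : ℤ) - 1)

/-- The indices of the images of the family under `diagV`. -/
def monomVIndex (p k : ℕ) :
    ℕ × Finset (Fin k) × (Fin k → ℕ) → Finset (Fin (k + 1)) × (Fin k → ℕ) × ℕ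
  | (0, S, H) => (insert (Fin.last k) (S.map Fin.castSuccEmb), H, 0)
  | (s + 1, S, H) => (S.map Fin.castSuccEmb, H, p ^ s)

theorem last_notMem (S : Finset (Fin k)) : Fin.last k ∉ S.map Fin.castSuccEmb := by
  simp [Fin.castSucc_ne_last]

theorem monomVIndex_injective : Function.Injective (monomVIndex p k) := by
  rintro ⟨s, S, H⟩ ⟨s', S', H'⟩ h
  have hn := fun S : Finset (Fin k) => last_notMem S
  rcases s with - | s <;> rcases s' with - | s' <;> simp only [monomVIndex, Prod.mk.injEq] at h
  · obtain ⟨h1, h2, -⟩ := h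
    have h3 := congrArg (fun T => T.erase (Fin.last k)) h1
    simp only [Finset.erase_insert (hn _)] at h3
    rw [Finset.map_injective _ h3, h2]
  · exact absurd h.2.2.symm (pow_pos (Fact.out : p.Prime).pos _).ne'
  · exact absurd h.2.2 (pow_pos (Fact.out : p.Prime).pos _).ne'
  · obtain ⟨h1, h2, h3⟩ := h
    rw [Finset.map_injective _ h1, h2, Nat.pow_right_injective (Fact.out : p.Prime).two_le h3]

theorem diagV_monomVFamily {K : Type} [CommRing K] [Algebra (ZMod p) K] (u : Fin k → K) (Y : K)
    (h1 : 1 ≤ hh p) (i : ℕ × Finset (Fin k) × (Fin k → ℕ)) :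
    diagV p u Y (monomVFamily p k i) = extMonom p (monomVIndex p k i).1 ⊗ₜ
      (extFactor p u (monomVIndex p k i).1 *
        ((∏ j, basicVal p u j ^ (monomVIndex p k i).2.1 j) *
          fv p u Y ^ (monomVIndex p k i).2.2)) := by
  obtain ⟨s, S, H⟩ := i
  rcases s with - | s
  · simp only [monomVFamily, monomVIndex]
    rw [map_mul, diagV_monom u Y h1, muiVpow, if_pos (by simp), diagV_muiU u Y h1, ← lin_mul_cst,
      lin_single, cst_apply, Algebra.TensorProduct.tmul_mul_tmul,
      Algebra.TensorProduct.tmul_mul_tmul, mul_one, one_mul]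
    congr 1
    · rw [extMonom, extMonom, sort_castSucc, sort_snoc, extList, extList, List.map_append,
        List.prod_append]
      simp
    · rw [extFactor, extFactor, Finset.prod_insert (last_notMem S), pow_zero, mul_one,
        Fin.val_last]
      ring
  · simp only [monomVFamily, monomVIndex]
    have e : ((s + 1 : ℕ) : ℤ) - 1 = s := by push_cast; ring
    rw [map_mul, diagV_monom u Y h1, e, muiVpow, if_neg (by omega), Int.toNat_natCast, map_pow,
      diagV_muiV, ← map_pow, cst_apply, Algebra.TensorProduct.tmul_mul_tmul, mul_one, mul_assoc]

theorem basicVal_genC (j : Fin k) :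
    basicVal p (genC p k) j = Polynomial.C (basicInv p k j) := by
  rw [basicVal, basicInv]
  split_ifs
  · rw [map_pow]
    exact congrArg (· ^ hh p)
      (map_moore (Polynomial.C : MvPolynomial (Fin k) (ZMod p) →+* _) X).symm
  · rw [map_mul, map_pow, map_neg, map_one]
    exact congrArg ((-1) ^ (k + (j : ℕ)) * ·)
      (map_cf (Polynomial.C : MvPolynomial (Fin k) (ZMod p) →+* _) X j).symm

theorem extFactor_genC_ne_zero (T : Finset (Fin (k + 1))) : extFactor p (genC p k) T ≠ 0 := by
  refine Finset.prod_ne_zero_iff.2 fun _ _ => mul_ne_zero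
    (pow_ne_zero _ (neg_ne_zero.2 one_ne_zero)) (pow_ne_zero _ ?_)
  have h : moore p (genC p k) = Polynomial.C (moore p X) :=
    (map_moore (Polynomial.C : MvPolynomial (Fin k) (ZMod p) →+* _) X).symm
  rw [h, Polynomial.C_ne_zero]
  exact moore_X_ne_zero (p := p) (id : Fin k → Fin k) Function.injective_id

theorem linearIndependent_invariant_monomials (hp : 2 * hh p + 1 = p) (T : Finset (Fin (k + 1))) :
    LinearIndependent (ZMod p) fun i : (Fin k → ℕ) × ℕ => extFactor p (genC p k) T *
      ((∏ j, basicVal p (genC p k) j ^ i.1 j) * fv p (genC p k) Polynomial.X ^ i.2) := by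
  have h1 := linearIndependent_smul (linearIndependent_basicInv_monomials (n := k) hp)
    (linearIndependent_polyV_pow (p := p) (k := k))
  have h2 := h1.map' (LinearMap.mulLeft (ZMod p) (extFactor p (genC p k) T))
    (LinearMap.ker_eq_bot.2 (mul_right_injective₀ (extFactor_genC_ne_zero T)))
  have e : (fun i : (Fin k → ℕ) × ℕ => extFactor p (genC p k) T *
      ((∏ j, basicVal p (genC p k) j ^ i.1 j) * fv p (genC p k) Polynomial.X ^ i.2)) =
      LinearMap.mulLeft (ZMod p) (extFactor p (genC p k) T) ∘
        fun i : (Fin k → ℕ) × ℕ => (∏ j, basicInv p k j ^ i.1 j) • polyV p k ^ i.2 := by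
    ext1 i
    rw [Function.comp_apply, LinearMap.mulLeft_apply, Polynomial.smul_eq_C_mul, map_prod]
    simp only [basicVal_genC, map_pow, polyV]
  rw [e]
  exact h2

theorem linearIndependent_of_map_extMonom {V ι κ K : Type} [AddCommGroup V] [Module (ZMod p) V]
    [CommRing K] [Algebra (ZMod p) K] {m : ℕ} (Φ : V →ₗ[ZMod p] EK p (Fin m) K) (f : ι → V)
    (φ : ι → Finset (Fin m) × κ) (hφ : Function.Injective φ) (G : Finset (Fin m) → κ → K)
    (hG : ∀ T, LinearIndependent (ZMod p) (G T))
    (h : ∀ i, Φ (f i) = extMonom p (φ i).1 ⊗ₜ G (φ i).1 (φ i).2) :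
    LinearIndependent (ZMod p) f := by
  have h1 := (linearIndependent_extMonom_tmul G hG).comp φ hφ
  have e : (fun i : Finset (Fin m) × κ => (extMonom p i.1 ⊗ₜ G i.1 i.2 : EK p (Fin m) K)) ∘ φ =
      Φ ∘ f := (funext h).symm
  rw [e] at h1
  exact LinearIndependent.of_comp Φ h1

theorem linearIndependent_monomVFamily (hp : 2 * hh p + 1 = p) :
    LinearIndependent (ZMod p) (monomVFamily p k) := by
  have h1 : 1 ≤ hh p := by
    have := (Fact.out : p.Prime).two_le
    omega
  exact linearIndependent_of_map_extMonom (diagV p (genC p k) Polynomial.X).toLinearMap _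
    (monomVIndex p k) monomVIndex_injective _ (linearIndependent_invariant_monomials hp)
    (diagV_monomVFamily (genC p k) Polynomial.X h1)

end IndependenceV

end

noncomputable section

open MvPolynomial

/-! ### Degrees of the invariants -/

section Degrees

variable {p : ℕ} {J : Type}

/-- The degree `1 + p + ⋯ + p^{n-1}` of the Moore determinant. -/
def gdeg (p n : ℕ) : ℕ := ∑ j : Fin n, p ^ (j : ℕ)

/-- A geometric series, since `2h = p - 1`; in other words, `L̃_n` has dimension `p^n - 1`. -/
theorem gdeg_spec (hp : 2 * hh p + 1 = p) (n : ℕ) : 2 * (hh p * gdeg p n) + 1 = p ^ n := by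
  induction n with
  | zero => simp [gdeg]
  | succ n ih =>
    have : gdeg p (n + 1) = gdeg p n + p ^ n := by
      rw [gdeg, Fin.sum_univ_castSucc]; rfl
    calc 2 * (hh p * gdeg p (n + 1)) + 1 = p ^ n * (2 * hh p) + (2 * (hh p * gdeg p n) + 1) := by
          rw [this]; ring
      _ = p ^ (n + 1) := by rw [ih, ← mul_add_one, hp, pow_succ]

/-- All `n` summands `p ^ j` are odd. -/
theorem neg_one_pow_mul_gdeg {K : Type} [CommRing K] (hp : 2 * hh p + 1 = p) (c n : ℕ) :
    (-1 : K) ^ (c * gdeg p n) = (-1) ^ (c * n) := by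
  have hodd : ∀ j, ∃ t, p ^ j = 2 * t + 1 := fun j =>
    (Odd.pow (n := j) ⟨hh p, hp.symm⟩)
  induction n with
  | zero => simp [gdeg]
  | succ n ih =>
    have : gdeg p (n + 1) = gdeg p n + p ^ n := by
      rw [gdeg, Fin.sum_univ_castSucc]; rfl
    obtain ⟨t, ht⟩ := hodd n
    rw [this, mul_add, pow_add, ih, mul_add, pow_add, ht, mul_add, mul_one, pow_add]
    have : (-1 : K) ^ (c * (2 * t)) = 1 := by
      rw [mul_left_comm, pow_mul]; simp
    rw [this, one_mul]

theorem isHomogeneous_neg_one_pow (r : ℕ) :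
    ((-1 : MvPolynomial J (ZMod p)) ^ r).IsHomogeneous 0 := by
  have h : (-1 : MvPolynomial J (ZMod p)).IsHomogeneous 0 := (isHomogeneous_one _ _).neg
  simpa using h.pow r

theorem isHomogeneous_br {n : ℕ} (v : Fin n → J) (e : Fin n → ℕ) :
    (br p (fun i => (X (v i) : MvPolynomial J (ZMod p))) e).IsHomogeneous (∑ j, p ^ e j) := by
  rw [br, Matrix.det_apply]
  refine IsHomogeneous.sum _ _ _ fun σ _ => ?_
  have h : (∏ i, (X (v (σ i)) : MvPolynomial J (ZMod p)) ^ p ^ e i).IsHomogeneous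
      (∑ j, p ^ e j) := by
    refine IsHomogeneous.prod _ _ _ fun i _ => ?_
    simpa using (isHomogeneous_X (ZMod p) (v (σ i))).pow (p ^ e i)
  rcases Int.units_eq_one_or (Equiv.Perm.sign σ) with hσ | hσ
  · rw [hσ, one_smul]
    exact h
  · rw [hσ]
    simpa [Units.smul_def] using h.neg

theorem isHomogeneous_moore {n : ℕ} (v : Fin n → J) :
    (moore p (fun i => (X (v i) : MvPolynomial J (ZMod p)))).IsHomogeneous (gdeg p n) :=
  isHomogeneous_br v _

theorem isHomogeneous_brx {n : ℕ} (v : Fin (n + 1) → J) (a : Fin (n + 1) → MvPolynomial J (ZMod p))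
    (ha : ∀ i, (a i).IsHomogeneous 0) (e : Fin n → ℕ) :
    (brx p a (fun i => (X (v i) : MvPolynomial J (ZMod p))) e).IsHomogeneous (∑ j, p ^ e j) := by
  refine IsHomogeneous.sum _ _ _ fun i _ => ?_
  have := (isHomogeneous_neg_one_pow (p := p) (J := J) (i : ℕ)).mul
    ((ha i).mul (isHomogeneous_br (p := p) (fun j => v (i.succAbove j)) e))
  simpa using this

theorem isHomogeneous_mu {n : ℕ} (v : Fin n → J) (a : Fin n → MvPolynomial J (ZMod p))
    (ha : ∀ i, (a i).IsHomogeneous 0) {s : ℕ} (hs : s < n) {d : ℕ} (hd : d + p ^ s = gdeg p n) :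
    (mu p a (fun i => (X (v i) : MvPolynomial J (ZMod p))) s).IsHomogeneous d := by
  cases n with
  | zero => omega
  | succ n =>
    have h := isHomogeneous_brx v a ha fun j => skip s j
    have e : ∑ j : Fin n, p ^ skip s j = d := by
      rw [gdeg, Fin.sum_univ_succAbove _ ⟨s, hs⟩, add_comm] at hd
      have := Nat.add_left_cancel hd
      rw [this]
      exact Finset.sum_congr rfl fun j _ => by rw [← skip_eq_succAbove]
    rwa [e] at h

variable [Fact p.Prime]

theorem isHomogeneous_cf {n : ℕ} (v : Fin n → J) {s d : ℕ} (h : d + p ^ s = p ^ n) :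
    (cf p (fun i => (X (v i) : MvPolynomial J (ZMod p))) s).IsHomogeneous d := by
  induction n generalizing s d with
  | zero =>
    have hs : s = 0 := by
      by_contra hs
      have := Nat.one_lt_pow hs (one_lt_p (p := p))
      simp at h
      omega
    subst hs
    simp only [pow_zero, Nat.add_eq_right] at h
    subst h
    simpa [cf] using isHomogeneous_one J (ZMod p)
  | succ n ih =>
    have hinit : Fin.init (fun i : Fin (n + 1) => (X (v i) : MvPolynomial J (ZMod p))) =
      fun i => X (v i.castSucc) := rfl
    have hp0 : 0 < p := (Fact.out : p.Prime).pos
    rw [cf, hinit]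
    refine IsHomogeneous.sub ?_ ?_
    · split_ifs with hs
      · exact isHomogeneous_zero _ _ _
      · obtain ⟨s, rfl⟩ := Nat.exists_eq_succ_of_ne_zero hs
        rw [Nat.succ_sub_one]
        obtain ⟨c, hc⟩ : ∃ c, c + p ^ s = p ^ n := by
          refine ⟨p ^ n - p ^ s, Nat.sub_add_cancel ?_⟩
          refine Nat.pow_le_pow_right hp0 ?_
          have : p ^ s.succ ≤ p ^ (n + 1) := by omega
          exact Nat.le_of_succ_le_succ ((Nat.pow_le_pow_iff_right (one_lt_p (p := p))).1 this)
        have e : c * p = d := by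
          have : c * p + p ^ s.succ = p ^ (n + 1) := by rw [pow_succ, pow_succ, ← hc]; ring
          omega
        rw [← e]
        exact (ih (fun i => v i.castSucc) hc).pow p
    · rcases Nat.lt_or_ge n s with hs | hs
      · rw [cf_eq_zero _ hs p_ne_zero, mul_zero]
        exact isHomogeneous_zero _ _ _
      · have hle : ∀ i ≤ n, p ^ n - p ^ i + p ^ i = p ^ n := fun i hi =>
          Nat.sub_add_cancel (Nat.pow_le_pow_right hp0 hi)
        have h1 : (∑ i ∈ Finset.range (n + 1), cf p (fun i : Fin n =>
            (X (v i.castSucc) : MvPolynomial J (ZMod p))) i * X (v (Fin.last n)) ^ p ^ i).IsHomogeneous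
            (p ^ n) := by
          refine IsHomogeneous.sum _ _ _ fun i hi => ?_
          have hi := Nat.lt_succ_iff.1 (Finset.mem_range.1 hi)
          have := (ih (fun i => v i.castSucc) (hle i hi)).mul
            ((isHomogeneous_X (ZMod p) (v (Fin.last n))).pow (p ^ i))
          rwa [one_mul, hle i hi] at this
        have h2 := (h1.pow (p - 1)).mul (ih (fun i => v i.castSucc) (hle s hs))
        have e : p ^ n * (p - 1) + (p ^ n - p ^ s) = d := by
          have h3 := hle s hs
          have h4 : p ^ n * (p - 1) + p ^ n = p ^ (n + 1) := by
            rw [← Nat.mul_succ, Nat.succ_eq_add_one, Nat.sub_add_cancel hp0, pow_succ]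
          omega
        rwa [e] at h2

theorem isBi_dicksonQ {n s d : ℕ} (hs : s ≤ n) (h : d + p ^ s = p ^ n) :
    IsBi (pol p _ _ (dicksonQ p (id : Fin n → Fin n) s)) 0 d := by
  refine Or.inl ⟨rfl, _, ?_, pol_eq_cst _⟩
  rw [dicksonQ_eq _ Function.injective_id hs]
  simpa using (isHomogeneous_neg_one_pow _).mul (isHomogeneous_cf (p := p) (id : Fin n → Fin n) h)

theorem isBi_muiV (k : ℕ) : IsBi (muiV p k) 0 (p ^ k) := by
  refine Or.inl ⟨rfl, _, ?_, muiV_eq k⟩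
  refine IsHomogeneous.sum _ _ _ fun s hs => ?_
  have hs := Nat.lt_succ_iff.1 (Finset.mem_range.1 hs)
  have e : p ^ k - p ^ s + p ^ s = p ^ k :=
    Nat.sub_add_cancel (Nat.pow_le_pow_right (Fact.out : p.Prime).pos hs)
  have := (isHomogeneous_cf (p := p) (fun i : Fin k => i.castSucc) e).mul
    ((isHomogeneous_X (ZMod p) (Fin.last k)).pow (p ^ s))
  rwa [one_mul, e] at this

theorem isHomogeneous_ee [DecidableEq J] (i j : J) :
    (ee (MvPolynomial J (ZMod p)) i j).IsHomogeneous 0 := by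
  by_cases h : j = i
  · subst h; simpa [ee] using isHomogeneous_one J (ZMod p)
  · simpa [ee, h] using isHomogeneous_zero J (ZMod p) 0

theorem isBi_muiMt {n s d : ℕ} (h1 : 1 ≤ hh p) (hs : s < n) (h : d + p ^ s = hh p * gdeg p n) :
    IsBi (muiMt p (id : Fin n → Fin n) s) 1 d := by
  refine Or.inr ⟨rfl, _, fun j => ?_, muiMt_natCast _ s⟩
  have hle : p ^ s ≤ gdeg p n :=
    Finset.single_le_sum (f := fun j : Fin n => p ^ (j : ℕ)) (fun _ _ => Nat.zero_le _)
      (Finset.mem_univ ⟨s, hs⟩)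
  have h2 := ((isHomogeneous_moore (p := p) (id : Fin n → Fin n)).pow (hh p - 1)).mul
    (isHomogeneous_mu (p := p) (id : Fin n → Fin n) (fun i => ee _ (id i) j)
      (fun i => isHomogeneous_ee _ _) hs (Nat.sub_add_cancel hle))
  have e : gdeg p n * (hh p - 1) + (gdeg p n - p ^ s) = d := by
    have h4 : gdeg p n * (hh p - 1) + gdeg p n = hh p * gdeg p n := by
      rw [← Nat.mul_succ, Nat.succ_eq_add_one, Nat.sub_add_cancel h1, mul_comm]
    omega
  rwa [e] at h2

theorem isBi_muiMt_neg_one (n : ℕ) :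
    IsBi (muiMt p (id : Fin n → Fin n) (-1)) 0 (hh p * gdeg p n) := by
  refine Or.inl ⟨rfl, _, ?_, muiMt_neg_one _⟩
  rw [mul_comm]
  exact (isHomogeneous_moore (p := p) (id : Fin n → Fin n)).pow (hh p)

theorem isBi_muiU (h1 : 1 ≤ hh p) (k : ℕ) : IsBi (muiU p k) 1 (hh p * gdeg p k) := by
  refine Or.inr ⟨rfl, _, fun j => ?_, muiU_eq k⟩
  have h2 : (dx p (fun i : Fin k => ee (MvPolynomial (Fin (k + 1)) (ZMod p)) i.castSucc j)
      (fun i : Fin k => X i.castSucc) (ee _ (Fin.last k) j) (X (Fin.last k))).IsHomogeneous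
      (gdeg p k) := by
    rw [dx, ← zero_add (gdeg p k)]
    refine (isHomogeneous_neg_one_pow k).mul (IsHomogeneous.add ?_ ?_)
    · simpa using (isHomogeneous_ee (p := p) (Fin.last k) j).mul
        (isHomogeneous_moore (p := p) fun i : Fin k => i.castSucc)
    · refine IsHomogeneous.sum _ _ _ fun s hs => ?_
      have hs := Finset.mem_range.1 hs
      have hle : p ^ s ≤ gdeg p k :=
        Finset.single_le_sum (f := fun j : Fin k => p ^ (j : ℕ)) (fun _ _ => Nat.zero_le _)
          (Finset.mem_univ ⟨s, hs⟩)
      have := (isHomogeneous_neg_one_pow (p := p) (s + 1)).mul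
        ((isHomogeneous_mu (p := p) (fun i : Fin k => i.castSucc) (fun i => ee _ i.castSucc j)
          (fun i => isHomogeneous_ee _ _) hs (Nat.sub_add_cancel hle)).mul
          ((isHomogeneous_X (ZMod p) (Fin.last k)).pow (p ^ s)))
      rwa [one_mul, zero_add, Nat.sub_add_cancel hle] at this
  have h3 := ((isHomogeneous_moore (p := p) fun i : Fin k => i.castSucc).pow (hh p - 1)).mul h2
  rwa [← Nat.mul_succ, Nat.succ_eq_add_one, Nat.sub_add_cancel h1, mul_comm (gdeg p k)] at h3

theorem brk_natCast (s : ℕ) : brk p s = -2 * (p : ℤ) ^ s := by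
  rw [brk, zpow_natCast]
  exact_mod_cast Int.floor_intCast (R := ℚ) (-2 * (p : ℤ) ^ s)

theorem brk_neg_one (hp : 2 * hh p + 1 = p) (h1 : 1 ≤ hh p) : brk p (-1) = -1 := by
  -- For `p ≥ 3` the number `-2/p` lies between `-1` and `0`.
  have h3 : (3 : ℚ) ≤ p := by exact_mod_cast (by omega : 3 ≤ p)
  rw [brk, zpow_neg_one, Int.floor_eq_iff]
  have hpos : (0 : ℚ) < p := by linarith
  have : (p : ℚ)⁻¹ ≤ 3⁻¹ := inv_anti₀ (by norm_num) h3
  have h0 : 0 < (p : ℚ)⁻¹ := inv_pos.2 hpos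
  push_cast
  constructor <;> linarith

/-- `V_{k+1}`, for `δ = 0`, or `U_{k+1}`, for `δ = 1`. -/
def invUV (p k δ : ℕ) : Coh p (k + 1) := muiU p k ^ δ * muiV p k ^ (1 - δ)

theorem isBi_invUV (hp : 2 * hh p + 1 = p) (h1 : 1 ≤ hh p) (k : ℕ) {δ : ℕ} (hδ : δ ≤ 1) :
    ∃ d : ℕ, IsBi (invUV p k δ) δ d ∧ ((δ + 2 * d : ℕ) : ℤ) = (2 - δ) * p ^ k ∧
      ∀ n, (-1 : ZMod p) ^ (n * (δ + d)) = (-1) ^ (n + n * k * hh p * δ) := by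
  interval_cases δ
  · refine ⟨p ^ k, by simpa [invUV] using isBi_muiV k, by push_cast; ring, fun n => ?_⟩
    rw [zero_add, mul_zero, add_zero, mul_comm, pow_mul]
    rw [(Odd.pow ⟨hh p, hp.symm⟩ : Odd (p ^ k)).neg_one_pow]
  · refine ⟨hh p * gdeg p k, by simpa [invUV] using isBi_muiU h1 k, ?_, fun n => ?_⟩
    · have : 2 * ((hh p : ℤ) * gdeg p k) + 1 = (p : ℤ) ^ k := by exact_mod_cast gdeg_spec hp k
      push_cast
      linear_combination this
    · rw [mul_add, mul_one, pow_add, pow_add, ← mul_assoc, neg_one_pow_mul_gdeg hp]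
      congr 2
      ring

/-- The index is `s = i - δ`. The floor makes the dimension formula uniform: for `s = -1` it gives
`p^n - 1`, the dimension of `L̃_n`. -/
theorem isBi_invMQ (hp : 2 * hh p + 1 = p) (h1 : 1 ≤ hh p) {n δ i : ℕ} (hδ : δ ≤ 1) (hi : i ≤ n) :
    ∃ e d : ℕ, IsBi (invMQ p n δ ((i : ℤ) - δ)) e d ∧
      ((e + 2 * d : ℕ) : ℤ) = (2 - δ) * p ^ n + brk p ((i : ℤ) - δ) ∧
      ∀ k, (-1 : ZMod p) ^ (k * (e + d)) = (-1) ^ (n * k * hh p * δ) := by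
  have hp0 : 0 < p := (Fact.out : p.Prime).pos
  have hodd : ∀ s, (-1 : ZMod p) ^ p ^ s = -1 := fun s =>
    (Odd.pow ⟨hh p, hp.symm⟩ : Odd (p ^ s)).neg_one_pow
  interval_cases δ
  · have e : p ^ n - p ^ i + p ^ i = p ^ n := Nat.sub_add_cancel (Nat.pow_le_pow_right hp0 hi)
    refine ⟨0, p ^ n - p ^ i, by simpa [invMQ] using isBi_dicksonQ hi e, ?_, fun k => ?_⟩
    · have e' : ((p ^ n - p ^ i : ℕ) : ℤ) + (p : ℤ) ^ i = (p : ℤ) ^ n := by exact_mod_cast e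
      rw [show (i : ℤ) - (0 : ℕ) = i by simp, brk_natCast]
      push_cast
      linear_combination 2 * e'
    · have h2 : (-1 : ZMod p) ^ (p ^ n - p ^ i) = 1 := by
        have h3 := hodd n
        rw [← e, pow_add, hodd i] at h3
        linear_combination -h3
      rw [zero_add, mul_comm, pow_mul, h2, one_pow, mul_zero, pow_zero]
  · have hg := gdeg_spec hp n
    rcases i with - | s
    · refine ⟨0, hh p * gdeg p n, by simpa [invMQ] using isBi_muiMt_neg_one n, ?_, fun k => ?_⟩
      · have : ((0 : ℕ) : ℤ) - (1 : ℕ) = -1 := by norm_num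
        rw [this, brk_neg_one hp h1]
        have hg' : 2 * ((hh p : ℤ) * gdeg p n) + 1 = (p : ℤ) ^ n := by exact_mod_cast hg
        push_cast
        linear_combination hg'
      · rw [zero_add, ← mul_assoc, neg_one_pow_mul_gdeg hp]
        congr 1
        ring
    · have hle : p ^ s ≤ hh p * gdeg p n := by
        calc p ^ s ≤ gdeg p n :=
              Finset.single_le_sum (f := fun j : Fin n => p ^ (j : ℕ)) (fun _ _ => Nat.zero_le _)
                (Finset.mem_univ ⟨s, hi⟩)
          _ ≤ _ := Nat.le_mul_of_pos_left _ h1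
      have e := Nat.sub_add_cancel hle
      have hs : ((s + 1 : ℕ) : ℤ) - (1 : ℕ) = s := by push_cast; ring
      refine ⟨1, hh p * gdeg p n - p ^ s, ?_, ?_, fun k => ?_⟩
      · rw [hs]
        simpa [invMQ] using isBi_muiMt h1 hi e
      · have e' : ((hh p * gdeg p n - p ^ s : ℕ) : ℤ) + (p : ℤ) ^ s = hh p * gdeg p n := by
          exact_mod_cast e
        have hg' : 2 * ((hh p : ℤ) * gdeg p n) + 1 = (p : ℤ) ^ n := by exact_mod_cast hg
        rw [hs, brk_natCast]
        push_cast
        linear_combination 2 * e' + hg'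
      · have h2 : (-1 : ZMod p) ^ (k * (1 + (hh p * gdeg p n - p ^ s))) =
            (-1) ^ (k * hh p * gdeg p n) := by
          have h4 : k * hh p * gdeg p n = k * (hh p * gdeg p n - p ^ s) + k * p ^ s := by
            rw [← mul_add, e, mul_assoc]
          rw [h4, mul_add, pow_add, pow_add, mul_one, mul_comm k (p ^ s), pow_mul _ (p ^ s), hodd,
            mul_comm]
        rw [h2, neg_one_pow_mul_gdeg hp]
        congr 1
        ring

end Degrees

end

noncomputable section

open MvPolynomial

/-! ### Comparing coefficients in a tensor product -/

section TensorCoefficients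

variable {F V W ι κ α β : Type} [Field F] [AddCommGroup V] [Module F V] [AddCommGroup W]
  [Module F W]

theorem exists_coordinate {b : ι → V} (hb : LinearIndependent F b) (i : ι) :
    ∃ φ : V →ₗ[F] F, φ (b i) = 1 ∧ ∀ j, j ≠ i → φ (b j) = 0 := by
  obtain ⟨φ, hφ⟩ := LinearMap.exists_extend (Finsupp.lapply i ∘ₗ hb.repr)
  have h : ∀ j, φ (b j) = Finsupp.single j (1 : F) i := by
    intro j
    have := LinearMap.congr_fun hφ ⟨b j, Submodule.subset_span ⟨j, rfl⟩⟩
    simp only [LinearMap.comp_apply, Submodule.subtype_apply] at this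
    rw [this, hb.repr_eq_single j _ rfl, Finsupp.lapply_apply]
  refine ⟨φ, by rw [h, Finsupp.single_eq_same], fun j hj => ?_⟩
  rw [h, Finsupp.single_eq_of_ne hj.symm]

/-- An element lying in both `span b ⊗ W` and `V ⊗ span b'` lies in `span b ⊗ span b'`. Functionals
dual to `b'` yield its coefficient matrix, and those dual to `b` show that the same matrix gives the
other expansion. -/
theorem exists_coeff_of_tmul_eq {b : ι → V} (hb : LinearIndependent F b) {b' : κ → W}
    (hb' : LinearIndependent F b') (s : Finset α) (t : Finset β) (f : α → ι) (hf : Set.InjOn f s)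
    (g : β → κ) (hg : Set.InjOn g t) (x : α → W) (y : β → V)
    (h : ∑ a ∈ s, b (f a) ⊗ₜ[F] x a = ∑ j ∈ t, y j ⊗ₜ[F] b' (g j)) :
    ∃ c : α → β → F, (∀ j ∈ t, y j = ∑ a ∈ s, c a j • b (f a)) ∧
      ∀ a ∈ s, x a = ∑ j ∈ t, c a j • b' (g j) := by
  choose φ hφ hφ' using fun j => exists_coordinate hb' j
  choose ψ hψ hψ' using fun i => exists_coordinate hb i
  have hy : ∀ j ∈ t, y j = ∑ a ∈ s, φ (g j) (x a) • b (f a) := by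
    intro j hj
    have h1 := congrArg ((TensorProduct.rid F V).toLinearMap ∘ₗ LinearMap.lTensor V (φ (g j))) h
    simp only [map_sum, LinearMap.comp_apply, LinearMap.lTensor_tmul, LinearEquiv.coe_coe,
      TensorProduct.rid_tmul] at h1
    rw [h1, Finset.sum_eq_single_of_mem j hj, hφ, one_smul]
    intro l hl hlj
    rw [hφ' _ _ fun e => hlj (hg hl hj e), zero_smul]
  refine ⟨fun a j => φ (g j) (x a), hy, fun a ha => ?_⟩
  have h1 := congrArg ((TensorProduct.lid F W).toLinearMap ∘ₗ LinearMap.rTensor W (ψ (f a))) h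
  simp only [map_sum, LinearMap.comp_apply, LinearMap.rTensor_tmul, LinearEquiv.coe_coe,
    TensorProduct.lid_tmul] at h1
  have hsum : ∀ c : α → F, ∑ l ∈ s, c l * ψ (f a) (b (f l)) = c a := by
    intro c
    rw [Finset.sum_eq_single_of_mem a ha, hψ, mul_one]
    intro l hl hla
    rw [hψ' _ _ fun e => hla (hf hl ha e), mul_zero]
  rw [Finset.sum_eq_single_of_mem a ha, hψ, one_smul] at h1
  · rw [h1]
    refine Finset.sum_congr rfl fun j hj => ?_
    conv_lhs => rw [hy j hj]
    simp only [map_sum, map_smul, smul_eq_mul]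
    rw [hsum fun l => φ (g j) (x l)]
  · intro l hl hla
    rw [hψ' _ _ fun e => hla (hf hl ha e), zero_smul]

theorem repr_sum_apply {b : ι → V} (hb : LinearIndependent F b) (s : Finset α) (f : α → ι)
    (hf : Set.InjOn f s) (c : α → F) (z : Submodule.span F (Set.range b))
    (hz : (z : V) = ∑ a ∈ s, c a • b (f a)) {a : α} (ha : a ∈ s) : hb.repr z (f a) = c a := by
  have h : hb.repr z = ∑ l ∈ s, c l • Finsupp.single (f l) 1 := by
    refine hb.repr_eq ?_
    rw [hz]
    simp
  rw [h, Finsupp.finsetSum_apply, Finset.sum_eq_single_of_mem a ha]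
  · simp
  · intro l hl hla
    rw [Finsupp.smul_apply, Finsupp.single_eq_of_ne fun e => hla (hf hl ha e.symm), smul_zero]

end TensorCoefficients

theorem dualPairing_sum {p n : ℕ} [Fact p.Prime] {α : Type}
    (hb : LinearIndependent (ZMod p) (monomFamily p n)) (s : Finset α)
    (f : α → Finset (Fin n) × (Fin n → ℕ)) (hf : Set.InjOn f s) (c : α → ZMod p) {a : α}
    (ha : a ∈ s) :
    dualPairing p n (f a).1 (f a).2 (∑ l ∈ s, c l • monomFamily p n (f l)) = c a := by
  have hm : ∑ l ∈ s, c l • monomFamily p n (f l) ∈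
      Submodule.span (ZMod p) (Set.range (monomFamily p n)) :=
    Submodule.sum_mem _ fun l _ => Submodule.smul_mem _ _ (Submodule.subset_span ⟨_, rfl⟩)
  rw [dualPairing, dif_pos ⟨hb, hm⟩]
  exact repr_sum_apply hb s f hf c ⟨_, hm⟩ rfl ha

/-- The last entry of `R` is dropped by `star`, but the first entry of the result determines the sum
of `R`; admissibility ensures that this first entry was not truncated. -/
theorem star_injOn {m : ℕ} (q : ℤ) : Set.InjOn (star (m := m) q) (admissible m q) := by
  intro R hR R' hR' h
  rw [Finset.mem_coe, mem_admissible] at hR hR'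
  cases m with
  | zero => exact Subsingleton.elim _ _
  | succ m =>
    have h0 := congrFun h 0
    simp only [star, Fin.val_zero, if_true] at h0
    have hi : ∀ i : Fin m, R i.castSucc = R' i.castSucc := by
      intro i
      have := congrFun h i.succ
      simp only [star, Fin.val_succ, Nat.succ_ne_zero, if_false] at this
      exact this
    have hs : ∑ j, (R j : ℤ) = ∑ j, (R' j : ℤ) := by omega
    rw [Fin.sum_univ_castSucc, Fin.sum_univ_castSucc] at hs
    simp only [hi, add_right_inj, Nat.cast_inj] at hs
    ext j
    refine Fin.lastCases hs hi j

theorem neg_one_pow_mul_eq_smul {p : ℕ} {A : Type} [Ring A] [Algebra (ZMod p) A] (r : ℕ) (a : A) :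
    (-1) ^ r * a = ((-1 : ZMod p) ^ r) • a := by
  rw [Algebra.smul_def, map_pow, map_neg, map_one]

theorem neg_one_pow_mul_self {R : Type} [CommRing R] (r : ℕ) : (-1 : R) ^ r * (-1) ^ r = 1 := by
  rw [← mul_pow]; simp

/-! ### The two expansions -/

section TwoExpansions

variable {p : ℕ} [Fact p.Prime] {J K : Type} [Fintype J] [DecidableEq J] [Field K]
  [Algebra (ZMod p) K] [CharP K p] {n k : ℕ}

theorem Pop_invUV (y : J → K) (v : Fin n → J) (w : Fin (k + 1) → J)
    (h : moore p (Fin.append (fun i => y (v i)) fun i : Fin k => y (w i.castSucc)) ≠ 0)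
    (hp : 1 ≤ hh p) {δ : ℕ} (hδ : δ ≤ 1) :
    Pop p y v w (invUV p k δ) = ∑ i ∈ Finset.range (n + 1),
      ((-1 : ZMod p) ^ (n + i + n * k * hh p * δ)) •
        (Pop p y (fun i => w i.castSucc) v (invMQ p n δ ((i : ℤ) - δ)) *
          kap p y w (muiVpow p k ((i : ℤ) - δ))) := by
  interval_cases δ
  · have e : invUV p k 0 = muiV p k := by simp [invUV]
    rw [e, Pop_muiV y v w h]
    refine Finset.sum_congr rfl fun s _ => ?_
    have e0 : (s : ℤ) - (0 : ℕ) = s := by simp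
    rw [neg_one_pow_mul_eq_smul (p := p), mul_zero, add_zero, e0, muiVpow, if_neg (by omega), map_pow,
      invMQ, pow_zero, one_mul, Nat.sub_zero, pow_one, Int.toNat_natCast]
  · have e : invUV p k 1 = muiU p k := by simp [invUV]
    rw [e, Pop_muiU y v w h hp, neg_one_pow_mul_eq_smul (p := p), Finset.sum_range_succ',
      smul_add, Finset.smul_sum]
    refine (add_comm _ _).trans (congrArg₂ (· + ·) ?_ ?_)
    · refine Finset.sum_congr rfl fun s _ => ?_
      have e1 : ((s + 1 : ℕ) : ℤ) - (1 : ℕ) = s := by push_cast; ring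
      rw [neg_one_pow_mul_eq_smul (p := p), smul_smul, ← pow_add, e1, muiVpow, if_neg (by omega), map_pow,
        invMQ, pow_one, Nat.sub_self, pow_zero, Int.toNat_natCast]
      simp only [mul_one]
      congr 2
      ring
    · have e1 : ((0 : ℕ) : ℤ) - (1 : ℕ) = -1 := by norm_num
      rw [e1, muiVpow, if_pos rfl, invMQ, pow_one, Nat.sub_self, pow_zero]
      simp only [mul_one]
      congr 2
      ring

/-- `Pop_expand` applied to both sides of `Pop_invUV`, with the classes of the block `v` brought to
the left. -/
theorem kap_expansions (hp : 2 * hh p + 1 = p) (y : J → K) (v : Fin n → J) (w : Fin (k + 1) → J)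
    (h : moore p (Fin.append (fun i => y (v i)) fun i : Fin k => y (w i.castSucc)) ≠ 0)
    (hv : moore p (fun i => y (v i)) ≠ 0) (hw : moore p (fun i : Fin k => y (w i.castSucc)) ≠ 0)
    {δ : ℕ} (hδ : δ ≤ 1) :
    ∑ S' : Finset (Fin n), ∑ R' ∈ admissible n ((2 - δ) * p ^ k - S'.card),
      kap p y v (monom p (id : Fin n → Fin n) S' (star ((2 - δ) * p ^ k - S'.card) R')) *
        kap p y w (((-1 : ZMod p) ^ rrNat S' R') • St p S' R' (invUV p k δ)) =
    ∑ i ∈ Finset.range (n + 1), ∑ S : Finset (Fin k),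
      ∑ R ∈ admissible k ((2 - δ) * p ^ n + brk p ((i : ℤ) - δ) - S.card),
        kap p y v (((-1 : ZMod p) ^ (i + rrNat S R + n * k * hh p * δ)) •
          (par p n)^[S.card] (St p S R (invMQ p n δ ((i : ℤ) - δ)))) *
        kap p y w (monom p Fin.castSucc S
          (star ((2 - δ) * p ^ n + brk p ((i : ℤ) - δ) - S.card) R) *
            muiVpow p k ((i : ℤ) - δ)) := by
  have h1 : 1 ≤ hh p := by
    have := (Fact.out : p.Prime).two_le
    omega
  have key := Pop_invUV y v w h h1 hδ
  obtain ⟨d, hd, hd1, hd2⟩ := isBi_invUV hp h1 k hδ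
  rw [Pop_expand y v w hp hv hd, neg_one_pow_mul_eq_smul (p := p), hd2, hd1] at key
  -- This cancels the overall sign on the left. On the right it meets the sign of the exchange and
  -- the sign `(-1)^{nkhδ}` from `isBi_invMQ`, leaving `i + r(S,R) + nkhδ` modulo two.
  have key2 := congrArg (fun x => ((-1 : ZMod p) ^ (n + n * k * hh p * δ)) • x) key
  simp only [smul_smul, Finset.smul_sum, ← pow_add] at key2
  have hsq : ∀ r, (-1 : ZMod p) ^ (r + r) = 1 := fun r => by rw [pow_add, neg_one_pow_mul_self]
  refine Eq.trans (Eq.trans ?_ key2) ?_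
  · refine Finset.sum_congr rfl fun S' _ => Finset.sum_congr rfl fun R' _ => ?_
    rw [neg_one_pow_mul_eq_smul (p := p), map_smul, mul_smul_comm, hsq, one_smul]
  · refine Finset.sum_congr rfl fun i hi => ?_
    obtain ⟨e, d, hd, hd1, hd2⟩ :=
      isBi_invMQ hp h1 hδ (Nat.lt_succ_iff.1 (Finset.mem_range.1 hi))
    rw [Pop_expand y (fun i => w i.castSucc) v hp hw hd, neg_one_pow_mul_eq_smul (p := p), hd2, hd1,
      smul_mul_assoc, smul_smul, ← pow_add, Finset.sum_mul, Finset.smul_sum]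
    refine Finset.sum_congr rfl fun S _ => ?_
    rw [Finset.sum_mul, Finset.smul_sum]
    refine Finset.sum_congr rfl fun R _ => ?_
    rw [neg_one_pow_mul_eq_smul (p := p), smul_mul_assoc, smul_smul, ← pow_add, map_smul,
      smul_mul_assoc, map_mul, kap_monom_comp y w _ (Fin.castSucc_injective k), kap_monom_mul_kap,
      mul_assoc (kap p y v _)]
    congr 1
    have : n + n * k * hh p * δ + (n + i + n * k * hh p * δ) + n * k * hh p * δ + rrNat S R =
        (i + rrNat S R + n * k * hh p * δ) + ((n + n * k * hh p * δ) + (n + n * k * hh p * δ)) := by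
      ring
    rw [this, pow_add, hsq, mul_one]

end TwoExpansions

/-! ### Descent to an identity in the tensor product. -/

section Universal

variable {p : ℕ} [Fact p.Prime] {n k : ℕ}

theorem kap_algHom {J K : Type} [Fintype J] [DecidableEq J] [CommRing K] [Algebra (ZMod p) K]
    (φ : MvPolynomial J (ZMod p) →ₐ[ZMod p] K) {m : ℕ} (w : Fin m → J) (z : Coh p m) :
    kap p (fun j => φ (X j)) w z = mapK φ (kap p X w z) := by
  have : kap p (fun j => φ (X j)) w = (mapK φ).comp (kap p X w) := by
    refine algHom_ext_EP (fun i => ?_) fun i => ?_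
    · simp only [AlgHom.comp_apply, kap, liftEP_tmul, map_one, one_smul, mapK_lin]
      congr 1
      ext1 j
      exact (map_ee φ.toRingHom _ _).symm
    · simp only [AlgHom.comp_apply, kap, liftEP_cst, aeval_X, mapK_cst]
  rw [this]
  rfl

/-- For independent variables in both blocks, the Moore determinants are nonzero and `L̃` is
invertible in the fraction field, so `kap_expansions` applies. The result descends to polynomials by
`mapK_injective` and to the tensor product by `block_mul_injective`. -/
theorem tmul_expansions (hp : 2 * hh p + 1 = p) {δ : ℕ} (hδ : δ ≤ 1) :
    ∑ S' : Finset (Fin n), ∑ R' ∈ admissible n ((2 - δ) * p ^ k - S'.card),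
      monom p (id : Fin n → Fin n) S' (star ((2 - δ) * p ^ k - S'.card) R') ⊗ₜ[ZMod p]
        (((-1 : ZMod p) ^ rrNat S' R') • St p S' R' (invUV p k δ)) =
    ∑ i ∈ Finset.range (n + 1), ∑ S : Finset (Fin k),
      ∑ R ∈ admissible k ((2 - δ) * p ^ n + brk p ((i : ℤ) - δ) - S.card),
        (((-1 : ZMod p) ^ (i + rrNat S R + n * k * hh p * δ)) •
          (par p n)^[S.card] (St p S R (invMQ p n δ ((i : ℤ) - δ)))) ⊗ₜ[ZMod p]
        (monom p Fin.castSucc S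
          (star ((2 - δ) * p ^ n + brk p ((i : ℤ) - δ) - S.card) R) *
            muiVpow p k ((i : ℤ) - δ)) := by
  let A := MvPolynomial (Fin n ⊕ Fin (k + 1)) (ZMod p)
  let φ : A →ₐ[ZMod p] FractionRing A := IsScalarTower.toAlgHom (ZMod p) A (FractionRing A)
  have hφ : Function.Injective φ := IsFractionRing.injective A (FractionRing A)
  have : CharP (FractionRing A) p := charP_of_injective_algebraMap (R := ZMod p)
    (algebraMap (ZMod p) (FractionRing A)).injective p
  have hmoore : ∀ {l : ℕ} (v : Fin l → Fin n ⊕ Fin (k + 1)), Function.Injective v →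
      moore p (fun i => φ (X (v i))) ≠ 0 := by
    intro l v hv
    have := (map_ne_zero_iff φ hφ).2 (moore_X_ne_zero (p := p) v hv)
    rwa [← AlgHom.coe_toRingHom, map_moore] at this
  have happ : (Fin.append (fun i : Fin n => φ (X (Sum.inl i)))
      fun i : Fin k => φ (X (Sum.inr i.castSucc))) =
      fun i => φ (X (Fin.append (fun i : Fin n => (Sum.inl i : Fin n ⊕ Fin (k + 1)))
        (fun i : Fin k => Sum.inr i.castSucc) i)) := by
    ext1 i
    refine Fin.addCases (fun i => ?_) (fun i => ?_) i <;> simp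
  have hinj : Function.Injective (Fin.append (fun i : Fin n => (Sum.inl i : Fin n ⊕ Fin (k + 1)))
        (fun i : Fin k => Sum.inr i.castSucc)) := by
    intro a b
    refine Fin.addCases (fun a => ?_) (fun a => ?_) a <;>
      refine Fin.addCases (fun b => ?_) (fun b => ?_) b <;> simp
  have key := kap_expansions hp (fun j => φ (X j)) (Sum.inl : Fin n → Fin n ⊕ Fin (k + 1)) Sum.inr
    (by rw [happ]; exact hmoore _ hinj) (hmoore _ Sum.inl_injective)
    (hmoore (fun i : Fin k => Sum.inr i.castSucc)
      (Sum.inr_injective.comp (Fin.castSucc_injective k))) hδ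
  simp only [kap_algHom φ, ← map_mul, ← map_sum] at key
  have key2 := mapK_injective φ hφ key
  rw [← sub_eq_zero] at key2 ⊢
  refine block_mul_injective _ ?_
  rw [map_sub, map_sub]
  simp only [map_sum, TensorProduct.map_tmul, LinearMap.mul'_apply, AlgHom.toLinearMap_apply]
  exact key2

end Universal

end

noncomputable section

open MvPolynomial

/-! ### The expansion of `St^{S',R'}` on `U_{k+1}` and `V_{k+1}` -/

section Parity

variable {p : ℕ} [Fact p.Prime] {n k : ℕ}

theorem par_par (z : Coh p n) : par p n (par p n z) = z := by
  have : (par p n).comp (par p n) = AlgHom.id (ZMod p) (Coh p n) := by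
    refine algHom_ext_EP (fun i => ?_) fun i => ?_
    · rw [AlgHom.comp_apply, par_gen, map_neg, par_gen, neg_neg]
      rfl
    · rw [AlgHom.comp_apply, par_cst, par_cst]
      rfl
  exact DFunLike.congr_fun this z

theorem par_iterate_iterate (t : ℕ) (z : Coh p n) : (par p n)^[t] ((par p n)^[t] z) = z := by
  rw [← Function.iterate_add_apply]
  exact congrFun (Function.Involutive.iterate_even par_par ⟨t, rfl⟩) z

theorem par_iterate_sum {α : Type} (t : ℕ) (s : Finset α)
    (f : α → Finset (Fin n) × (Fin n → ℕ)) (c : α → ZMod p) :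
    (par p n)^[t] (∑ a ∈ s, c a • monomFamily p n (f a)) =
      ∑ a ∈ s, ((-1) ^ (t * (f a).1.card) * c a) • monomFamily p n (f a) := by
  induction t with
  | zero => simp
  | succ t ih =>
    rw [Function.iterate_succ_apply', ih, map_sum]
    refine Finset.sum_congr rfl fun a _ => ?_
    rw [map_smul, monomFamily, par_monom, smul_smul]
    congr 1
    ring

/-- The coaction of a polynomial involves no `τ` and no `x`. This is what removes the sign
`(-1)^{t'}` in the case `s = -1`. -/
theorem par_St_cst (S : Finset (Fin k)) (R : Fin k → ℕ) (f : MvPolynomial (Fin n) (ZMod p)) :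
    par p n (St p S R (cst (Fin n) f)) = St p S R (cst (Fin n) f) := by
  rw [St_cst]
  by_cases hS : S = ∅
  · subst hS
    have := extCoeff_extMonom (p := p) (m := n) (∅ : Finset (Fin k)) ∅ 1
    rw [if_pos rfl] at this
    have h1 : extCoeff p (∅ : Finset (Fin k)) (1 : Ext p (Fin k ⊕ Fin n)) = 1 := by
      simpa [extMonom, extList] using this
    rw [h1]
    exact par_cst _
  · rw [extCoeff_one hS, TensorProduct.zero_tmul, map_zero]

end Parity

/-! ### One array of coefficients for both expansions. -/

section Expansion

variable {p : ℕ} [Fact p.Prime] {n k δ : ℕ}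

theorem exists_expansion (hp : 2 * hh p + 1 = p) (n k : ℕ) (hδ : δ ≤ 1) :
    ∃ d : Finset (Fin n) → (Fin n → ℕ) → ℕ → Finset (Fin k) → (Fin k → ℕ) → ZMod p,
      (∀ i ∈ Finset.range (n + 1), ∀ S : Finset (Fin k),
        ∀ R ∈ admissible k ((2 - δ) * p ^ n + brk p ((i : ℤ) - δ) - S.card),
        St p S R (invMQ p n δ ((i : ℤ) - δ)) =
          ∑ a ∈ (Finset.univ : Finset (Finset (Fin n))).sigma
              fun S' => admissible n ((2 - δ) * p ^ k - S'.card),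
            d a.1 a.2 i S R • monomFamily p n (a.1, star ((2 - δ) * p ^ k - a.1.card) a.2)) ∧
      ∀ S' : Finset (Fin n), ∀ R' ∈ admissible n ((2 - δ) * p ^ k - S'.card),
        St p S' R' (invUV p k δ) =
        ∑ i ∈ Finset.range (n + 1), ∑ S : Finset (Fin k),
          ∑ R ∈ admissible k ((2 - δ) * p ^ n + brk p ((i : ℤ) - δ) - S.card),
            ((-1) ^ (i + rrNat S R + rrNat S' R' + n * k * hh p * δ + S.card * S'.card) *
              d S' R' i S R) •
            (monom p Fin.castSucc S
              (star ((2 - δ) * p ^ n + brk p ((i : ℤ) - δ) - S.card) R) *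
                muiVpow p k ((i : ℤ) - δ)) := by
  let s := (Finset.univ : Finset (Finset (Fin n))).sigma
    fun S' => admissible n ((2 - δ) * p ^ k - S'.card)
  let t : Finset (Σ _ : ℕ, Σ _ : Finset (Fin k), (Fin k → ℕ)) :=
    (Finset.range (n + 1)).sigma fun i =>
      (Finset.univ : Finset (Finset (Fin k))).sigma
        fun S => admissible k ((2 - δ) * p ^ n + brk p ((i : ℤ) - δ) - S.card)
  let f : (Σ _ : Finset (Fin n), (Fin n → ℕ)) → Finset (Fin n) × (Fin n → ℕ) :=
    fun a => (a.1, star ((2 - δ) * p ^ k - a.1.card) a.2)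
  let g : (Σ _ : ℕ, Σ _ : Finset (Fin k), (Fin k → ℕ)) → ℕ × Finset (Fin k) × (Fin k → ℕ) :=
    -- `monomVFamily` indexes the power `V^{p^s}` by `s + 1`, and `s = i - δ`; the subtraction is
    -- not truncated since `δ ≤ 1`.
    fun b => (b.1 + 1 - δ, b.2.1,
      star ((2 - δ) * p ^ n + brk p ((b.1 : ℤ) - δ) - b.2.1.card) b.2.2)
  have hf : Set.InjOn f s := by
    rintro ⟨S, R⟩ ha ⟨S', R'⟩ hb h
    simp only [f, Prod.mk.injEq] at h
    obtain ⟨rfl, h⟩ := h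
    have ha := (Finset.mem_sigma.1 ha).2
    have hb := (Finset.mem_sigma.1 hb).2
    have := star_injOn _ ha hb h
    simp only at this
    rw [this]
  have hg : Set.InjOn g t := by
    rintro ⟨i, S, R⟩ ha ⟨i', S', R'⟩ hb h
    simp only [g, Prod.mk.injEq] at h
    obtain ⟨h1, rfl, h⟩ := h
    obtain rfl : i = i' := by omega
    have ha := (Finset.mem_sigma.1 (Finset.mem_sigma.1 ha).2).2
    have hb := (Finset.mem_sigma.1 (Finset.mem_sigma.1 hb).2).2
    have := star_injOn _ ha hb h
    simp only at this
    rw [this]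
  have hgV : ∀ b : (Σ _ : ℕ, Σ _ : Finset (Fin k), (Fin k → ℕ)), monomVFamily p k (g b) =
      monom p Fin.castSucc b.2.1
        (star ((2 - δ) * p ^ n + brk p ((b.1 : ℤ) - δ) - b.2.1.card) b.2.2) *
          muiVpow p k ((b.1 : ℤ) - δ) := by
    intro b
    have : ((b.1 + 1 - δ : ℕ) : ℤ) - 1 = (b.1 : ℤ) - δ := by omega
    simp only [monomVFamily, g, this]
  have key := tmul_expansions (n := n) (k := k) hp hδ
  obtain ⟨c, hy, hx⟩ := exists_coeff_of_tmul_eq (linearIndependent_monomFamily (n := n) hp)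
    (linearIndependent_monomVFamily (k := k) hp) s t f hf g hg
    (fun a => ((-1 : ZMod p) ^ rrNat a.1 a.2) • St p a.1 a.2 (invUV p k δ))
    (fun b => ((-1 : ZMod p) ^ (b.1 + rrNat b.2.1 b.2.2 + n * k * hh p * δ)) •
      (par p n)^[b.2.1.card] (St p b.2.1 b.2.2 (invMQ p n δ ((b.1 : ℤ) - δ)))) (by
    simp only [hgV, s, t, Finset.sum_sigma]
    exact key)
  -- The matrix `c` expands a signed parity image of `St^{S,R}`. Undoing the `t`-fold parity
  -- multiplies the coefficient of a monomial with `t'` exterior factors by `(-1)^{t t'}`.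
  refine ⟨fun S' R' i S R => (-1) ^ (S.card * S'.card) *
    ((-1) ^ (i + rrNat S R + n * k * hh p * δ) * c ⟨S', R'⟩ ⟨i, S, R⟩), ?_, ?_⟩
  · intro i hi S R hR
    have h1 := hy ⟨i, S, R⟩ (Finset.mem_sigma.2 ⟨hi, Finset.mem_sigma.2 ⟨Finset.mem_univ _, hR⟩⟩)
    have h2 := congrArg (fun z => ((-1 : ZMod p) ^ (i + rrNat S R + n * k * hh p * δ)) • z) h1
    simp only [smul_smul, neg_one_pow_mul_self, one_smul, Finset.smul_sum] at h2
    have h3 := congrArg (fun z => (par p n)^[S.card] z) h2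
    simp only [par_iterate_iterate, par_iterate_sum] at h3
    exact h3
  · intro S' R' hR'
    have h1 := hx ⟨S', R'⟩ (Finset.mem_sigma.2 ⟨Finset.mem_univ _, hR'⟩)
    have h2 := congrArg (fun z => ((-1 : ZMod p) ^ rrNat S' R') • z) h1
    simp only [smul_smul, neg_one_pow_mul_self, one_smul, Finset.smul_sum, hgV, t,
      Finset.sum_sigma] at h2
    rw [h2]
    refine Finset.sum_congr rfl fun i _ => Finset.sum_congr rfl fun S _ =>
      Finset.sum_congr rfl fun R _ => ?_
    congr 1
    have e : i + rrNat S R + rrNat S' R' + n * k * hh p * δ + S.card * S'.card =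
      rrNat S' R' + ((i + rrNat S R + n * k * hh p * δ) + S.card * S'.card) := by ring
    have h4 := neg_one_pow_mul_self (R := ZMod p) (i + rrNat S R + n * k * hh p * δ)
    have h5 := neg_one_pow_mul_self (R := ZMod p) (S.card * S'.card)
    rw [e, pow_add _ (rrNat S' R'), pow_add _ _ (S.card * S'.card)]
    linear_combination (-(-1) ^ rrNat S' R' * c ⟨S', R'⟩ ⟨i, S, R⟩) *
      ((-1) ^ (S.card * S'.card) * (-1) ^ (S.card * S'.card) * h4 + h5)

theorem sum_Icc_eq_sum_range {M : Type} [AddCommMonoid M] (n δ : ℕ) (F : ℤ → M) :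
    ∑ s ∈ Finset.Icc (-(δ : ℤ)) ((n : ℤ) - δ), F s =
      ∑ i ∈ Finset.range (n + 1), F ((i : ℤ) - δ) := by
  refine Finset.sum_nbij' (fun s => (s + δ).toNat) (fun i => (i : ℤ) - δ) ?_ ?_ ?_ ?_ ?_
  · intro s hs
    rw [Finset.mem_Icc] at hs
    rw [Finset.mem_range]
    omega
  · intro i hi
    rw [Finset.mem_range] at hi
    rw [Finset.mem_Icc]
    omega
  · intro s hs
    rw [Finset.mem_Icc] at hs
    omega
  · intro i _
    simp
  · intro s hs
    rw [Finset.mem_Icc] at hs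
    congr 1
    omega

theorem St_eq_zero_of_notMem_admissible {m N e d : ℕ} {z : Coh p m} (hz : IsBi z e d) {q : ℤ}
    (hq : ((e + 2 * d : ℕ) : ℤ) = q) {S : Finset (Fin N)} {R : Fin N → ℕ}
    (h : R ∉ admissible N (q - S.card)) : St p S R z = 0 := by
  refine hz.St_eq_zero ?_
  rw [mem_admissible, ← hq, not_le] at h
  have e : ((∑ j, R j : ℕ) : ℤ) = ∑ j, (R j : ℤ) := by push_cast; rfl
  rw [← e] at h
  push_cast at h
  by_contra! h'
  obtain ⟨h1, h2⟩ := h'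
  zify at h1 h2
  linarith

end Expansion

end

end MuiSteenrod

theorem corollary2p3 (p : ℕ) [Fact p.Prime] (hp : p ≠ 2) (n k : ℕ) (hn : 1 ≤ n)
    (δ : ℕ) (hδ : δ ≤ 1) (S' : Finset (Fin n)) (R' : Fin n → ℕ) :
    LinearIndependent (ZMod p) (MuiSteenrod.monomFamily p n) ∧
    (∀ s ∈ Finset.Icc (-(δ : ℤ)) ((n : ℤ) - δ), ∀ (S : Finset (Fin k)) (R : Fin k → ℕ),
      MuiSteenrod.St p S R (MuiSteenrod.invMQ p n δ s) ∈
        Submodule.span (ZMod p) (Set.range (MuiSteenrod.monomFamily p n))) ∧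
    MuiSteenrod.St p S' R' (MuiSteenrod.muiU p k ^ δ * MuiSteenrod.muiV p k ^ (1 - δ)) =
      ∑ s ∈ Finset.Icc (-(δ : ℤ)) ((n : ℤ) - δ),
        (∑ S : Finset (Fin k),
          ∑ R ∈ MuiSteenrod.admissible k
              ((2 - δ) * p ^ n + MuiSteenrod.brk p s - S.card),
            ((-1 : ZMod p) ^ MuiSteenrod.sigma p n k δ S' R' s S R *
                MuiSteenrod.coeffC p n k δ S' R' s S R) •
              MuiSteenrod.monom p (Fin.castSucc : Fin k → Fin (k + 1)) S
                (MuiSteenrod.star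
                  ((2 - δ) * p ^ n + MuiSteenrod.brk p s - S.card) R)) *
          MuiSteenrod.muiVpow p k s := by
  open MuiSteenrod in
  have hodd : 2 * hh p + 1 = p := by
    obtain ⟨m, hm⟩ := (Fact.out : p.Prime).odd_of_ne_two hp
    rw [hh]
    omega
  have h1 : 1 ≤ hh p := by
    have := (Fact.out : p.Prime).two_le
    omega
  obtain ⟨d, hd, hd'⟩ := exists_expansion hodd n k hδ
  have hLI := linearIndependent_monomFamily (n := n) hodd
  refine ⟨hLI, fun s hs S R => ?_, ?_⟩
  · rw [Finset.mem_Icc] at hs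
    obtain ⟨i, rfl⟩ : ∃ i : ℕ, s = (i : ℤ) - δ := ⟨(s + δ).toNat, by omega⟩
    have hi : i ≤ n := by omega
    by_cases hR : R ∈ admissible k ((2 - δ) * p ^ n + brk p ((i : ℤ) - δ) - S.card)
    · rw [hd i (Finset.mem_range.2 (Nat.lt_succ_of_le hi)) S R hR]
      exact Submodule.sum_mem _ fun a _ =>
        Submodule.smul_mem _ _ (Submodule.subset_span ⟨_, rfl⟩)
    -- Pairs outside the range of the expansion act as zero by instability.
    · obtain ⟨e, d, hz, hq, -⟩ := isBi_invMQ hodd h1 hδ hi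
      rw [St_eq_zero_of_notMem_admissible hz hq hR]
      exact zero_mem _
  · rw [sum_Icc_eq_sum_range]
    change St p S' R' (invUV p k δ) = _
    by_cases hR' : R' ∈ admissible n ((2 - δ) * p ^ k - S'.card)
    · rw [hd' S' R' hR']
      refine Finset.sum_congr rfl fun i hi => ?_
      rw [Finset.sum_mul]
      refine Finset.sum_congr rfl fun S _ => ?_
      rw [Finset.sum_mul]
      refine Finset.sum_congr rfl fun R hR => ?_
      rw [smul_mul_assoc]
      congr 1
      set s := (Finset.univ : Finset (Finset (Fin n))).sigma
        fun S' => admissible n ((2 - δ) * p ^ k - S'.card) with hs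
      have hinj : Set.InjOn (fun a : Σ _ : Finset (Fin n), (Fin n → ℕ) =>
          (a.1, star ((2 - δ) * p ^ k - a.1.card) a.2)) s := by
        rintro ⟨S, R⟩ ha ⟨S', R'⟩ hb h
        simp only [Prod.mk.injEq] at h
        obtain ⟨rfl, h⟩ := h
        have := star_injOn _ (Finset.mem_sigma.1 ha).2 (Finset.mem_sigma.1 hb).2 h
        simp only at this
        rw [this]
      have hmem : (⟨S', R'⟩ : Σ _ : Finset (Fin n), (Fin n → ℕ)) ∈ s :=
        Finset.mem_sigma.2 ⟨Finset.mem_univ _, hR'⟩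
      have hSt := hd i hi S R hR
      have hC : coeffC p n k δ S' R' ((i : ℤ) - δ) S R = d S' R' i S R := by
        rw [coeffC, if_pos (mem_admissible.1 hR'), hSt]
        exact dualPairing_sum hLI s _ hinj (fun a => d a.1 a.2 i S R) hmem
      -- The contribution `[-2p^s] t'` to `σ` is harmless. For `s ≥ 0` it is even; for `s = -1` the
      -- class `L̃_n` is polynomial, so comparing the expansion with its parity image shows that
      -- `(-1)^{t'}` fixes the coefficient.
      have hbrk : (-1 : ZMod p) ^ (brk p ((i : ℤ) - δ) * S'.card) * d S' R' i S R =
          d S' R' i S R := by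
        by_cases h0 : δ ≤ i
        · have e : (i : ℤ) - δ = ((i - δ : ℕ) : ℤ) := by omega
          rw [e, brk_natCast, Even.neg_one_zpow ⟨-(p : ℤ) ^ (i - δ) * S'.card, by ring⟩, one_mul]
        · obtain rfl : i = 0 := by omega
          obtain rfl : δ = 1 := by omega
          have e : ((0 : ℕ) : ℤ) - (1 : ℕ) = -1 := by norm_num
          rw [e] at hSt ⊢
          have hinv : invMQ p n 1 (-1) = cst _ (moore p (fun i : Fin n =>
              (MvPolynomial.X i : MvPolynomial (Fin n) (ZMod p))) ^ hh p) := by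
            rw [invMQ, pow_one, Nat.sub_self, pow_zero, mul_one, muiMt_neg_one]
            rfl
          have hpar : par p n (St p S R (invMQ p n 1 (-1))) = St p S R (invMQ p n 1 (-1)) := by
            rw [hinv, par_St_cst]
          rw [hSt] at hpar
          have h2 := par_iterate_sum 1 s (fun a : Σ _ : Finset (Fin n), (Fin n → ℕ) =>
            (a.1, star ((2 - (1 : ℕ)) * p ^ k - a.1.card) a.2)) fun a => d a.1 a.2 0 S R
          have h3 := dualPairing_sum hLI s _ hinj (fun a => d a.1 a.2 0 S R) hmem
          have h4 := dualPairing_sum hLI s _ hinj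
            (fun a => (-1) ^ (1 * a.1.card) * d a.1 a.2 0 S R) hmem
          rw [brk_neg_one hodd h1, neg_one_mul, zpow_neg, zpow_natCast, ← inv_pow, inv_neg_one]
          have h5 : ((-1) ^ (1 * S'.card) * d S' R' 0 S R : ZMod p) = d S' R' 0 S R := by
            refine h4.symm.trans (Eq.trans ?_ h3)
            congr 1
            exact h2.symm.trans hpar
          rwa [one_mul] at h5
      have hsig : sigma p n k δ S' R' ((i : ℤ) - δ) S R =
          ((i + rrNat S R + rrNat S' R' + n * k * hh p * δ + S.card * S'.card : ℕ) : ℤ) +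
            brk p ((i : ℤ) - δ) * S'.card := by
        rw [sigma, rr_eq, rr_eq]
        push_cast
        ring
      rw [hC, hsig, zpow_add₀ (neg_ne_zero.2 one_ne_zero), zpow_natCast, mul_assoc (_ ^ _),
        hbrk]
    -- Here the left side vanishes by instability, and the right side because `C` is zero by
    -- convention.
    · obtain ⟨e, hz, hq, -⟩ := isBi_invUV hodd h1 k hδ
      rw [St_eq_zero_of_notMem_admissible hz hq hR']
      symm
      refine Finset.sum_eq_zero fun i _ => ?_
      rw [Finset.sum_eq_zero, zero_mul]
      intro S _
      refine Finset.sum_eq_zero fun R _ => ?_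
      have : coeffC p n k δ S' R' ((i : ℤ) - δ) S R = 0 := by
        rw [coeffC, if_neg fun h => hR' (mem_admissible.2 h)]
      rw [this, mul_zero, zero_smul]
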